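/- **Setting.** Let $(M,g)$ be a smooth $D$-dimensional Riemannian manifold, $D=2n+\varepsilon$ with $\varepsilon\in\{0,1\}$, with Levi-Civita connection $\nabla$, and let $T$ be a smooth 3-form. Put $\nabla^T_XY=\nabla_XY+\tfrac12\sum_a T(X,Y,e_a)e_a$, where $\{e_a\}$ is any orthonormal frame, and, for forms $\Psi$, $d^T\Psi=\sum_a e^a\wedge\nabla^T_{e_a}\Psi$ and $\delta^T\Psi=-\sum_a e_a\lrcorner\nabla^T_{e_a}\Psi$. Let $h$ be a principal Killing–Yano (PKY) tensor with torsion, i.e. a smooth 2-form such that * $\nabla^T_Xh=\tfrac13X\lrcorner d^Th-\tfrac1{D-1}X^\flat\wedge\delta^Th$ for all $X$, and $d^Th=0$; * $h$ is non-degenerate: as a $(1,1)$-tensor it has rank $2n$ at every point, and its eigenvalues $\pm i x_\mu$ ($\mu=1,\dots,n$), together with one eigenvalue $0$ if $\varepsilon=1$, are functionally independent, i.e. near each point they are given by smooth functions $x_1,\dots,x_n$ with $dx_1,\dots,dx_n$ linearly independent at every point. Let $\xi=-\frac1{D-1}\delta^Th$. A canonical frame at a point is an orthonormal basis $(e_\mu,e_{\hat\mu})_{\mu=1}^n$,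 with one more vector $e_0$ if $\varepsilon=1$, of the tangent space, with dual basis $(e^\mu,e^{\hat\mu},e^0)$, such that there $$h=\sum_\mu x_\mu\,e^\mu\wedge e^{\hat\mu},\qquad \xi=\sum_\mu\sqrt{Q_\mu}\,e^{\hat\mu}+\varepsilon\sqrt{Q_0}\,e^0,\qquad Q_\mu>0,\ Q_0\ge0.$$ For $0\le 2j<D$ let $h^{(j)}=h\wedge\dots\wedge h$ ($j$ factors, $h^{(0)}=1$), $f^{(j)}=*h^{(j)}$ and $$K^{(j)}_{ab}=\frac{1}{(j!)^2\,(D-2j-1)!}\;f^{(j)}_{a c_1\cdots c_{D-2j-1}}\,f^{(j)}_{b}{}^{c_1\cdots c_{D-2j-1}},$$ where $*$ is the Hodge star for either of the two Riemannian volume elements at each point (the choice does not affect $K^{(j)}$). **Proposition.** 1. Each $K^{(j)}$ is a Killing tensor: it is smooth, symmetric, and $\nabla_{(a}K^{(j)}_{bc)}=0$. 2. A canonical frame exists at every point of $M$, and in every canonical frame $$K^{(j)}=\sum_{\mu=1}^nA^{(j)}_\mu\,(e^\mu\otimes e^\mu+e^{\hat\mu}\otimes e^{\hat\mu})+\varepsilon\,A^{(j)}\,e^0\otimes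 e^0,$$ where $A^{(j)}$ is the elementary symmetric polynomial of degree $j$ in $x_1^2,\dots,x_n^2$, and $A^{(j)}_\mu$ is the one in the variables $x_\nu^2$ with $\nu\ne\mu$ (so $A^{(n)}_\mu=0$). 3. For all $i,j$ with $2i,2j<D$, the tensors $K^{(i)}$ and $K^{(j)}$ commute under the Schouten–Nijenhuis bracket: $$[K^{(i)},K^{(j)}]_{abc}=K^{(i)}_{e(a}\nabla^eK^{(j)}_{bc)}-K^{(j)}_{e(a}\nabla^eK^{(i)}_{bc)}=0.$$ -/

import Mathlib

open scoped Manifold ContDiff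

noncomputable section

namespace TorsionKY

/-! ### Tensor calculus in a coordinate domain of `ℝ^D`

`Comp D k` is the type of component functions `S_{i₁…i_k}(y)` of a covariant tensor of rank `k`;
`G` is the matrix `g_{ij}(y)` of the metric and `Γ y l m i` stands for `Γ^l_{m i}(y)`, that is
`∇_{∂_m} ∂_i = ∑ l, Γ^l_{m i} ∂_l`. -/

/-- Components of a covariant tensor of rank `k` in coordinates. -/
abbrev Comp (D k : ℕ) : Type := EuclideanSpace ℝ (Fin D) → (Fin k → Fin D) → ℝ

/-- Components of a metric in coordinates. -/
abbrev MetricComp (D : ℕ) : Type := EuclideanSpace ℝ (Fin D) → Matrix (Fin D) (Fin D) ℝ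

/-- Connection coefficients in coordinates. -/
abbrev ConnComp (D : ℕ) : Type := EuclideanSpace ℝ (Fin D) → Fin D → Fin D → Fin D → ℝ

/-- The partial derivative `∂_m f (y)`. -/
def pderiv {D : ℕ} (m : Fin D) (f : EuclideanSpace ℝ (Fin D) → ℝ)
    (y : EuclideanSpace ℝ (Fin D)) : ℝ :=
  fderiv ℝ f y (EuclideanSpace.single m 1)

/-- Christoffel symbols of the Levi-Civita connection of `G`. -/
def leviCivita {D : ℕ} (G : MetricComp D) : ConnComp D := fun y l m i =>
  (1 / 2) * ∑ r, (G y)⁻¹ l r *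
    (pderiv m (fun z => G z r i) y + pderiv i (fun z => G z r m) y - pderiv r (fun z => G z m i) y)

/-- Coefficients of `∇^T_X Y = ∇_X Y + ½ ∑ₐ T(X, Y, eₐ) eₐ`. -/
def torsionConn {D : ℕ} (G : MetricComp D) (T : Comp D 3) : ConnComp D := fun y l m i =>
  leviCivita G y l m i + (1 / 2) * ∑ r, (G y)⁻¹ l r * T y ![m, i, r]

/-- `covD Γ S y m i` is `(∇_m S)_{i₁…i_k}(y)`. -/
def covD {D k : ℕ} (Γ : ConnComp D) (S : Comp D k) (y : EuclideanSpace ℝ (Fin D))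
    (m : Fin D) (i : Fin k → Fin D) : ℝ :=
  pderiv m (fun z => S z i) y - ∑ a, ∑ l, Γ y l m (i a) * S y (Function.update i a l)

/-- Components of `∑ₐ eᵃ ∧ ∇_{eₐ} k` for a form `k`. -/
def extD {D k : ℕ} (Γ : ConnComp D) (S : Comp D k) : Comp D (k + 1) := fun y i =>
  ∑ r : Fin (k + 1), (-1 : ℝ) ^ (r : ℕ) * covD Γ S y (i r) (fun a => i (r.succAbove a))

/-- Components of `-∑ₐ eₐ ⌟ ∇_{eₐ} k` for a form `k`. -/
def codiff {D k : ℕ} (G : MetricComp D) (Γ : ConnComp D) (S : Comp D (k + 1)) : Comp D k :=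
  fun y i => -∑ a, ∑ b, (G y)⁻¹ a b * covD Γ S y a (Fin.cons b i)

/-- Components of `X^♭ ∧ α` for `X = ∂_m`. -/
def flatWedge {D k : ℕ} (G : MetricComp D) (α : Comp D k) (y : EuclideanSpace ℝ (Fin D))
    (m : Fin D) (i : Fin (k + 1) → Fin D) : ℝ :=
  ∑ r : Fin (k + 1), (-1 : ℝ) ^ (r : ℕ) * G y m (i r) * α y (fun a => i (r.succAbove a))

/-- The conformal Killing–Yano equation
`∇_X k = 1/(p+1) X ⌟ d k - 1/(D-p+1) X^♭ ∧ δ k` at `y`, for a form `k` of degree `p = q + 1`. -/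
def CKYEquation {D q : ℕ} (G : MetricComp D) (Γ : ConnComp D) (S : Comp D (q + 1))
    (y : EuclideanSpace ℝ (Fin D)) : Prop :=
  ∀ (m : Fin D) (i : Fin (q + 1) → Fin D),
    covD Γ S y m i =
      1 / (((q + 1 : ℕ) : ℝ) + 1) * extD Γ S y (Fin.cons m i)
        - 1 / ((D : ℝ) - ((q + 1 : ℕ) : ℝ) + 1) * flatWedge G (codiff G Γ S) y m i

/-- The totally symmetric part `S_{(abc)}`. -/
def sym3 {D : ℕ} (S : Fin D → Fin D → Fin D → ℝ) (a b c : Fin D) : ℝ :=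
  (1 / 6) * (S a b c + S a c b + S b a c + S b c a + S c a b + S c b a)

/-- `K_{ea} ∇^e L_{bc}`, with the Levi-Civita connection of `G`. -/
def insertD {D : ℕ} (G : MetricComp D) (K L : Comp D 2) (y : EuclideanSpace ℝ (Fin D))
    (a b c : Fin D) : ℝ :=
  ∑ e, ∑ f, K y ![e, a] * (G y)⁻¹ e f * covD (leviCivita G) L y f ![b, c]

/-- The Schouten–Nijenhuis bracket
`[K, L]_{abc} = K_{e(a} ∇^e L_{bc)} - L_{e(a} ∇^e K_{bc)}`. -/
def schoutenNijenhuis {D : ℕ} (G : MetricComp D) (K L : Comp D 2)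
    (y : EuclideanSpace ℝ (Fin D)) (a b c : Fin D) : ℝ :=
  sym3 (insertD G K L y) a b c - sym3 (insertD G L K y) a b c

/-! ### Exterior algebra -/

/-- The wedge product, normalised so that `(α ∧ β)(u, v) = α(u) β(v) - α(v) β(u)`
for 1-forms. -/
def wedge {V : Type*} [AddCommGroup V] [Module ℝ V] {p q : ℕ}
    (α : V [⋀^Fin p]→ₗ[ℝ] ℝ) (β : V [⋀^Fin q]→ₗ[ℝ] ℝ) : V [⋀^Fin (p + q)]→ₗ[ℝ] ℝ :=
  ((LinearMap.mul' ℝ ℝ).compAlternatingMap (α.domCoprod β)).domDomCongr finSumFinEquiv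

/-- `h ∧ ⋯ ∧ h` with `j` factors. -/
def wedgePow {V : Type*} [AddCommGroup V] [Module ℝ V] (h : V [⋀^Fin 2]→ₗ[ℝ] ℝ) :
    (j : ℕ) → V [⋀^Fin (2 * j)]→ₗ[ℝ] ℝ
  | 0 => AlternatingMap.constOfIsEmpty ℝ V (Fin 0) (1 : ℝ)
  | j + 1 => wedge (wedgePow h j) h

/-! ### Tensor fields on a manifold -/

section Manifold

variable {D : ℕ} {M : Type*} [TopologicalSpace M] [ChartedSpace (EuclideanSpace ℝ (Fin D)) M]

variable (D M) in
/-- Covariant tensor fields of rank `k`, as functions of `k` tangent vectors. -/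
abbrev TensorField (k : ℕ) : Type _ :=
  (p : M) → (Fin k → TangentSpace (𝓡 D) p) → ℝ

variable (D M) in
/-- Differential `k`-forms (smoothness is stated separately). -/
abbrev FormField (k : ℕ) : Type _ :=
  (p : M) → (TangentSpace (𝓡 D) p) [⋀^Fin k]→ₗ[ℝ] ℝ

variable (D M) in
/-- Smooth Riemannian metrics on `M`. -/
abbrev Metric [IsManifold (𝓡 D) ∞ M] : Type _ :=
  Bundle.ContMDiffRiemannianMetric (𝓡 D) ∞ (EuclideanSpace ℝ (Fin D))
    (fun p : M => TangentSpace (𝓡 D) p)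

/-- The coordinate vector `∂_i` of the chart `φ` at the point with coordinates `y`. -/
def coordVec (φ : OpenPartialHomeomorph M (EuclideanSpace ℝ (Fin D)))
    (y : EuclideanSpace ℝ (Fin D)) (i : Fin D) : TangentSpace (𝓡 D) (φ.symm y) :=
  mfderiv (𝓡 D) (𝓡 D) φ.symm y
    (show TangentSpace (𝓡 D) y from EuclideanSpace.single i (1 : ℝ))

/-- The components of a tensor field in the chart `φ`. -/
def comp {k : ℕ} (S : TensorField D M k)
    (φ : OpenPartialHomeomorph M (EuclideanSpace ℝ (Fin D))) : Comp D k :=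
  fun y i => S (φ.symm y) (fun a => coordVec φ y (i a))

/-- A tensor field is smooth if its components in every chart of the atlas are. -/
def IsSmooth {k : ℕ} (S : TensorField D M k) : Prop :=
  ∀ φ ∈ atlas (EuclideanSpace ℝ (Fin D)) M, ∀ i : Fin k → Fin D,
    ContDiffOn ℝ ∞ (fun y => comp S φ y i) φ.target

/-- A form as a tensor field. -/
def toTensor {k : ℕ} (α : FormField D M k) : TensorField D M k :=
  fun p v => α p v

/-- The tangent vector at `p` with coordinates `δ_{i·}` in the preferred chart at `p`. -/
def stdVec (p : M) (i : Fin D) : TangentSpace (𝓡 D) p :=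
  show TangentSpace (𝓡 D) p from EuclideanSpace.single i (1 : ℝ)

variable [IsManifold (𝓡 D) ∞ M]

/-- The components of the metric in the chart `φ`. -/
def metricComp (g : Metric D M) (φ : OpenPartialHomeomorph M (EuclideanSpace ℝ (Fin D))) :
    MetricComp D :=
  fun y => Matrix.of fun i j => g.inner (φ.symm y) (coordVec φ y i) (coordVec φ y j)

/-- The coefficients of the connection `∇^T` in the chart `φ`. -/
def connT (g : Metric D M) (T : FormField D M 3)
    (φ : OpenPartialHomeomorph M (EuclideanSpace ℝ (Fin D))) : ConnComp D :=
  torsionConn (metricComp g φ) (comp (toTensor T) φ)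

/-- Generalized conformal Killing–Yano forms of degree `q + 1`. -/
def IsGCKY {q : ℕ} (g : Metric D M) (T : FormField D M 3) (k : FormField D M (q + 1)) : Prop :=
  IsSmooth (toTensor k) ∧
    ∀ φ ∈ atlas (EuclideanSpace ℝ (Fin D)) M, ∀ y ∈ φ.target,
      CKYEquation (metricComp g φ) (connT g T φ) (comp (toTensor k) φ) y

/-- The equation `d^T k = 0`. -/
def IsDTClosed {q : ℕ} (g : Metric D M) (T : FormField D M 3) (k : FormField D M q) : Prop :=
  ∀ φ ∈ atlas (EuclideanSpace ℝ (Fin D)) M, ∀ y ∈ φ.target, ∀ i : Fin (q + 1) → Fin D,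
    extD (connT g T φ) (comp (toTensor k) φ) y i = 0

/-- `A` is the 2-form `h` at `p` viewed as a (1,1)-tensor: `g(v, A u) = h(v, u)`. -/
def IsEndomorphismOf (g : Metric D M) (h : FormField D M 2) (p : M)
    (A : TangentSpace (𝓡 D) p →ₗ[ℝ] TangentSpace (𝓡 D) p) : Prop :=
  ∀ u v : TangentSpace (𝓡 D) p, g.inner p v (A u) = h p ![v, u]

/-- Non-degeneracy of a 2-form `h` in dimension `D = 2 n + ε`: its rank as a (1,1)-tensor is `2 n`
at all points, and its eigenvalues `± i x_μ` (with, in odd dimensions, one eigenvalue `0`) are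
functionally independent, i.e. locally they are given by smooth functions `x_1, …, x_n` whose
differentials are linearly independent at each point. -/
def IsNonDegenerate (g : Metric D M) (h : FormField D M 2) (n ε : ℕ) : Prop :=
  (∀ (p : M) (A : TangentSpace (𝓡 D) p →ₗ[ℝ] TangentSpace (𝓡 D) p),
      IsEndomorphismOf g h p A → Module.finrank ℝ (LinearMap.range A) = 2 * n) ∧
  ∀ p : M, ∃ (U : Set M) (x : Fin n → M → ℝ), IsOpen U ∧ p ∈ U ∧
    (∀ μ, ContMDiffOn (𝓡 D) 𝓘(ℝ, ℝ) ∞ (x μ) U) ∧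
    ∀ q ∈ U,
      (∀ A : EuclideanSpace ℝ (Fin D) →ₗ[ℝ] EuclideanSpace ℝ (Fin D),
        IsEndomorphismOf g h q A →
          A.charpoly = Polynomial.X ^ ε *
            ∏ μ : Fin n, (Polynomial.X ^ 2 + Polynomial.C (x μ q ^ 2))) ∧
      LinearIndependent ℝ (fun μ : Fin n =>
        show EuclideanSpace ℝ (Fin D) →L[ℝ] ℝ from mfderiv (𝓡 D) 𝓘(ℝ, ℝ) (x μ) q)

/-- `h` is a principal Killing–Yano tensor with torsion `T`: a non-degenerate rank-2 `d^T`-closed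
generalized conformal Killing–Yano tensor, in dimension `D = 2 n + ε`. -/
structure IsPKY (g : Metric D M) (T : FormField D M 3) (h : FormField D M 2) (n ε : ℕ) :
    Prop where
  gcky : IsGCKY g T h
  closed : IsDTClosed g T h
  nonDegenerate : IsNonDegenerate g h n ε

/-- The associated 1-form `ξ = -1/(D-1) δ^T h`, evaluated at `p` in the preferred chart at `p`
(in which tangent vectors at `p` coincide with their coordinates). -/
def assocForm (g : Metric D M) (T : FormField D M 3) (h : FormField D M 2) (p : M)
    (v : TangentSpace (𝓡 D) p) : ℝ :=
  -(1 / ((D : ℝ) - 1)) * ∑ i : Fin D,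
    codiff (metricComp g (chartAt (EuclideanSpace ℝ (Fin D)) p))
      (connT g T (chartAt (EuclideanSpace ℝ (Fin D)) p))
      (comp (toTensor h) (chartAt (EuclideanSpace ℝ (Fin D)) p))
      (chartAt (EuclideanSpace ℝ (Fin D)) p p) ![i] *
    (show EuclideanSpace ℝ (Fin D) from v) i

/-- The Gram matrix of the metric at `p` in the standard basis of the tangent space. -/
def gram (g : Metric D M) (p : M) : Matrix (Fin D) (Fin D) ℝ :=
  Matrix.of fun i j => g.inner p (stdVec p i) (stdVec p j)

/-- Full metric contraction `F_{i₁…i_m k₁…k_m} g^{i₁k₁} ⋯ g^{i_m k_m}`. -/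
def contract (g : Metric D M) (p : M) {m : ℕ}
    (F : (Fin m → TangentSpace (𝓡 D) p) → (Fin m → TangentSpace (𝓡 D) p) → ℝ) : ℝ :=
  ∑ i : Fin m → Fin D, ∑ k : Fin m → Fin D,
    (∏ a, (gram g p)⁻¹ (i a) (k a)) * F (fun a => stdVec p (i a)) (fun a => stdVec p (k a))

/-- `vol` is at each point one of the two Riemannian volume elements, i.e. its square on
`v₁, …, v_D` is the Gram determinant. -/
def IsVolumeElement (g : Metric D M) (vol : FormField D M D) : Prop :=
  ∀ (p : M) (v : Fin D → TangentSpace (𝓡 D) p),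
    vol p v ^ 2 = (Matrix.of fun i j => g.inner p (v i) (v j)).det

/-- The Hodge star of a `q`-form,
`(*α)_{b₁…b_m} = 1/q! α^{a₁…a_q} vol_{a₁…a_q b₁…b_m}` with `q + m = D`. -/
def hodgeStar (g : Metric D M) (vol : FormField D M D) {q m : ℕ} (hqm : q + m = D)
    (α : FormField D M q) : TensorField D M m := fun p v =>
  1 / (q.factorial : ℝ) *
    contract g p (fun s t => α p s * vol p (fun c => Fin.append t v (Fin.cast hqm.symm c)))

/-- `K^{(j)}_{ab} = [j!² (D-2j-1)!]⁻¹ f^{(j)}_{a c₁…} f^{(j)}_b{}^{c₁…}` with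
`f^{(j)} = *(h ∧ ⋯ ∧ h)` (`j` factors), for `2 j < D`. -/
def killingTensor (g : Metric D M) (vol : FormField D M D) (h : FormField D M 2) (j : ℕ)
    (hj : 2 * j < D) : TensorField D M 2 := fun p w =>
  1 / ((j.factorial : ℝ) ^ 2 * ((D - 2 * j - 1).factorial : ℝ)) *
    contract g p (m := D - 2 * j - 1) (fun s t =>
      hodgeStar g vol (q := 2 * j) (m := D - 2 * j - 1 + 1) (by omega)
          (fun p => wedgePow (h p) j) p (Fin.cons (w 0) s) *
        hodgeStar g vol (q := 2 * j) (m := D - 2 * j - 1 + 1) (by omega)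
          (fun p => wedgePow (h p) j) p (Fin.cons (w 1) t))

/-- Killing tensors of rank 2: smooth symmetric tensors with `∇_{(a} K_{bc)} = 0`. -/
def IsKillingTensor (g : Metric D M) (K : TensorField D M 2) : Prop :=
  IsSmooth K ∧ (∀ (p : M) (u v : TangentSpace (𝓡 D) p), K p ![u, v] = K p ![v, u]) ∧
    ∀ φ ∈ atlas (EuclideanSpace ℝ (Fin D)) M, ∀ y ∈ φ.target, ∀ a b c : Fin D,
      sym3 (fun a b c => covD (leviCivita (metricComp g φ)) (comp K φ) y a ![b, c]) a b c = 0

/-- The tensors `K` and `L` commute under the Schouten–Nijenhuis bracket. -/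
def SNCommute (g : Metric D M) (K L : TensorField D M 2) : Prop :=
  ∀ φ ∈ atlas (EuclideanSpace ℝ (Fin D)) M, ∀ y ∈ φ.target, ∀ a b c : Fin D,
    schoutenNijenhuis (metricComp g φ) (comp K φ) (comp L φ) y a b c = 0

/-- `(e_μ, ê_μ, e_0)` is a canonical frame at `p` (`e0` is indexed by `Fin ε`, so that it is absent
in even dimensions): it is orthonormal, `h = ∑ x_μ e^μ ∧ ê^μ` and
`ξ = ∑ √Q_μ ê^μ + ε √Q_0 e^0`, with `Q_μ > 0`. -/
structure IsCanonicalFrame (g : Metric D M) (T : FormField D M 3) (h : FormField D M 2) (p : M)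
    {n ε : ℕ} (x Q : Fin n → ℝ) (Q0 : ℝ) (e ehat : Fin n → TangentSpace (𝓡 D) p)
    (e0 : Fin ε → TangentSpace (𝓡 D) p) : Prop where
  orthonormal : ∀ a b : Fin n ⊕ Fin n ⊕ Fin ε,
    g.inner p (Sum.elim e (Sum.elim ehat e0) a) (Sum.elim e (Sum.elim ehat e0) b) =
      if a = b then 1 else 0
  form_h : ∀ u v : TangentSpace (𝓡 D) p, h p ![u, v] =
    ∑ μ, x μ * (g.inner p (e μ) u * g.inner p (ehat μ) v - g.inner p (ehat μ) u * g.inner p (e μ) v)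
  form_xi : ∀ v : TangentSpace (𝓡 D) p, assocForm g T h p v =
    ∑ μ, √(Q μ) * g.inner p (ehat μ) v + ∑ a, √Q0 * g.inner p (e0 a) v
  Q_pos : ∀ μ, 0 < Q μ
  Q0_nonneg : 0 ≤ Q0

end Manifold

/-- The elementary symmetric polynomial of degree `j` in the variables `x_ν²`, `ν ∈ s`. -/
def elemSymm {n : ℕ} (x : Fin n → ℝ) (s : Finset (Fin n)) (j : ℕ) : ℝ :=
  ∑ t ∈ s.powersetCard j, ∏ ν ∈ t, x ν ^ 2

end TorsionKY

end

namespace TorsionKY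

/-! ### Powers of a 2-form as sums of determinants of covectors -/

section WedgePowers

variable {V : Type*} [AddCommGroup V] [Module ℝ V]

/-! Everything is deduced from a generating function. Let `A` be the (1,1)-tensor of `h`, `B_s = (1
- s² A²)⁻¹`, `W_s = det (1 - s A)` and `K_s(u, v) = W_s g(u, B_s v)` (`genK`). In a canonical frame
`A²` is `-x_μ²` on the block spanned by `e_μ, ê_μ` and `0` on `e_0`, while `W_s = ∏ (1 + s² x_ν²)`.
Hence `K_s` is diagonal, with the entry `∏_{ν≠μ} (1 + s² x_ν²)` on the block `μ` and the full
product on `e_0`, so that `K_s = ∑_j s^{2j} K^{(j)}` once the contraction defining `K^{(j)}` is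
known in the frame. That contraction is pure combinatorics of the volume form (`sum_frameSeq_mul`,
`killingTensor_frame`) and also gives the diagonal form of `K^{(j)}`. Conversely, inverting a
Vandermonde matrix writes each `K^{(j)}` as a linear combination of finitely many `K_s`
(`exists_killingTensor_eq_sum`), so smoothness, the Killing equation and commutation need only be
proved for `K_s`.

The differential input is `∇^T_w h = w^♭ ∧ ξ`. Jacobi's formula for the determinant and the
derivative of an inverse give `∇^T K_s` explicitly (`LocalPKY.fderiv_genK`). With all arguments
equal the result vanishes and the totally antisymmetric torsion drops out; this is the Killing
equation. In the Schouten–Nijenhuis bracket of `K_s` and `K_r` the terms containing `ξ` cancel by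
the resolvent identity, leaving `2 W_s W_r τ(B_s u, u, B_r u)` with `τ` the torsion
(`LocalPKY.bracketTerm_sub`). This is zero as soon as `τ` vanishes on vectors from three different
eigenspaces of `A²`.

That vanishing is the heart of the commutation. Differentiating the characteristic polynomial shows
that `grad x_μ` is an eigenvector of `A²` and that `A ξ = ∑ x_μ grad x_μ`. This yields a smooth
orthogonal frame of gradients, hatted vectors proportional to `A grad x_μ`, and possibly a kernel
vector (`LocalEigen.exists_adaptedFrame`); normalised, it is a canonical frame. If one of the three
vectors is a gradient `grad x_μ`, the torsion component vanishes because brackets of fields tangent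
to the level sets of `x_μ` are tangent to them. If none is, the component is a structure function of
the frame, and two Jacobi identities with a rescaled gradient force its cube, times a non-zero
factor, to vanish (`LocalFrame.torsion_F`).

These arguments need the `x_μ²` to be distinct. Since the `x_μ` are non-zero with independent
differentials, such points are dense, and continuity covers the others
(`LocalEigen.eqOn_of_injective`). -/

theorem alternatingMap_sum_apply {ι κ W : Type*} [AddCommGroup W] [Module ℝ W] (s : Finset ι)
    (α : ι → V [⋀^κ]→ₗ[ℝ] W) (v : κ → V) : (∑ i ∈ s, α i) v = ∑ i ∈ s, α i v := by
  classical
  induction s using Finset.induction_on with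
  | empty => simp
  | insert i s hi ih => simp [Finset.sum_insert hi, ih]

/-- The alternating form `v ↦ det (θ_r (v_c))`, i.e. the wedge product of the covectors `θ_r`. -/
noncomputable def detForm {κ : Type*} [Fintype κ] [DecidableEq κ] (θ : κ → V →ₗ[ℝ] ℝ) :
    V [⋀^κ]→ₗ[ℝ] ℝ :=
  MultilinearMap.alternatization ((MultilinearMap.mkPiAlgebra ℝ κ ℝ).compLinearMap θ)

theorem detForm_apply {κ : Type*} [Fintype κ] [DecidableEq κ] (θ : κ → V →ₗ[ℝ] ℝ) (v : κ → V) :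
    detForm θ v = (Matrix.of fun r c => θ r (v c)).det := by
  rw [← Matrix.det_transpose]
  simp [detForm, MultilinearMap.alternatization_apply, Matrix.det_apply]

/-- The coproduct of two alternatizations is the alternatization of the tensor product, so with this
normalisation of the wedge no factorials appear. -/
theorem wedge_detForm {p q : ℕ} (θ : Fin p → V →ₗ[ℝ] ℝ) (η : Fin q → V →ₗ[ℝ] ℝ) :
    wedge (detForm θ) (detForm η) = detForm (Fin.append θ η) := by
  ext v
  have h1 : (detForm θ).domCoprod (detForm η) = MultilinearMap.alternatization
      (MultilinearMap.domCoprod ((MultilinearMap.mkPiAlgebra ℝ (Fin p) ℝ).compLinearMap θ)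
        ((MultilinearMap.mkPiAlgebra ℝ (Fin q) ℝ).compLinearMap η)) :=
    (MultilinearMap.domCoprod_alternization _ _).symm
  rw [detForm_apply, wedge, h1, ← Matrix.det_reindex_self finSumFinEquiv.symm,
    ← Matrix.det_transpose, Matrix.det_apply]
  simp [MultilinearMap.alternatization_apply, Fintype.prod_sum_type, LinearMap.compAlternatingMap]

theorem wedge_sum_left {p q : ℕ} {ι : Type*} (s : Finset ι) (c : ι → ℝ)
    (α : ι → V [⋀^Fin p]→ₗ[ℝ] ℝ) (β : V [⋀^Fin q]→ₗ[ℝ] ℝ) :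
    wedge (∑ i ∈ s, c i • α i) β = ∑ i ∈ s, c i • wedge (α i) β := by
  ext v
  simp only [wedge, ← AlternatingMap.domCoprod'_apply, TensorProduct.sum_tmul, map_sum,
    ← TensorProduct.smul_tmul', map_smul]
  simp [alternatingMap_sum_apply]

theorem wedge_sum_right {p q : ℕ} {ι : Type*} (s : Finset ι) (c : ι → ℝ)
    (α : V [⋀^Fin p]→ₗ[ℝ] ℝ) (β : ι → V [⋀^Fin q]→ₗ[ℝ] ℝ) :
    wedge α (∑ i ∈ s, c i • β i) = ∑ i ∈ s, c i • wedge α (β i) := by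
  ext v
  simp only [wedge, ← AlternatingMap.domCoprod'_apply, TensorProduct.tmul_sum, map_sum,
    TensorProduct.tmul_smul, map_smul]
  simp [alternatingMap_sum_apply]

/-- The sequence `a (f 0), b (f 0), a (f 1), b (f 1), …`. -/
def pairSeq {κ X : Type*} (a b : κ → X) {j : ℕ} (f : Fin j → κ) : Fin (2 * j) → X := fun c =>
  if (c : ℕ) % 2 = 0 then a (f ⟨c / 2, by omega⟩) else b (f ⟨c / 2, by omega⟩)

theorem pairSeq_snoc {κ X : Type*} (a b : κ → X) {j : ℕ} (f : Fin j → κ) (k : κ) :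
    pairSeq a b (Fin.snoc f k : Fin (j + 1) → κ) =
      Fin.append (pairSeq a b f) ![a k, b k] := by
  funext c
  refine Fin.addCases (m := 2 * j) (n := 2) (fun i => ?_) (fun i => ?_) c
  · rw [Fin.append_left]
    have h2 : (i : ℕ) / 2 < j := by omega
    simp [pairSeq, Fin.snoc, h2]
  · rw [Fin.append_right]
    fin_cases i
    · simp [pairSeq, Fin.snoc]
    · have h2 : (2 * j + 1) / 2 = j := by omega
      simp [pairSeq, Fin.snoc, h2]

/-- The power is expanded without collecting terms: the sum runs over all functions `f`. A repeated
block repeats a covector and contributes zero; the orderings of a given set of blocks stay separate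
and later produce the factors `j!`. -/
theorem wedgePow_eq_sum_detForm {κ : Type*} [Fintype κ] (h : V [⋀^Fin 2]→ₗ[ℝ] ℝ)
    (x : κ → ℝ) (a b : κ → V →ₗ[ℝ] ℝ)
    (hh : ∀ u v, h ![u, v] = ∑ k, x k * (a k u * b k v - b k u * a k v)) (j : ℕ) :
    wedgePow h j = ∑ f : Fin j → κ, (∏ i, x (f i)) • detForm (pairSeq a b f) := by
  have h1 : h = ∑ k, x k • detForm ![a k, b k] := by
    ext v
    have hv : v = ![v 0, v 1] := by ext i; fin_cases i <;> rfl
    conv_lhs => rw [hv, hh]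
    simp only [alternatingMap_sum_apply, AlternatingMap.smul_apply, detForm_apply,
      Matrix.det_fin_two, smul_eq_mul]
    refine Finset.sum_congr rfl fun k _ => ?_
    simp only [Matrix.of_apply, Matrix.cons_val_zero, Matrix.cons_val_one]
    ring
  induction j with
  | zero =>
    ext v
    rw [alternatingMap_sum_apply, Fintype.sum_unique]
    simp [wedgePow, detForm_apply]
  | succ j ih =>
    have h2 : wedgePow h (j + 1) = wedge (wedgePow h j) h := rfl
    rw [h2, ih, wedge_sum_left]
    conv_lhs => enter [2, f]; rw [h1, wedge_sum_right]
    rw [← (Fin.snocEquiv (fun _ : Fin (j + 1) => κ)).sum_comp, Fintype.sum_prod_type,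
      Finset.sum_comm]
    refine Finset.sum_congr rfl fun f _ => ?_
    rw [Finset.smul_sum]
    refine Finset.sum_congr rfl fun k _ => ?_
    rw [wedge_detForm, smul_smul]
    congr 1
    · simp [Fin.prod_univ_castSucc, Fin.snocEquiv]
    · exact congrArg detForm (pairSeq_snoc a b f k).symm

end WedgePowers

end TorsionKY

namespace TorsionKY

/-! ### Combinatorics of the double contraction in an orthonormal frame -/

section FrameCombinatorics

theorem filter_image_eq_orbit {κ : Type*} [Fintype κ] [DecidableEq κ] {m : ℕ} (f₀ : Fin m → κ)
    (hf₀ : Function.Injective f₀) :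
    (Finset.univ.filter fun f : Fin m → κ =>
        Function.Injective f ∧ Finset.univ.image f = Finset.univ.image f₀) =
      Finset.univ.image fun π : Equiv.Perm (Fin m) => f₀ ∘ π := by
  ext f
  simp only [Finset.mem_filter, Finset.mem_univ, true_and, Finset.mem_image]
  constructor
  · rintro ⟨hf, him⟩
    have h1 : ∀ i, ∃ k, f₀ k = f i := fun i => by
      have : f i ∈ Finset.univ.image f₀ := him ▸ Finset.mem_image_of_mem f (Finset.mem_univ i)
      simpa using this
    choose p hp using h1
    have hpi : Function.Injective p := fun i k hik => hf (by rw [← hp, ← hp, hik])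
    exact ⟨Equiv.ofBijective p (Finite.injective_iff_bijective.1 hpi), funext hp⟩
  · rintro ⟨π, rfl⟩
    refine ⟨hf₀.comp π.injective, ?_⟩
    ext y
    simp only [Finset.mem_image, Finset.mem_univ, true_and, Function.comp]
    exact ⟨fun ⟨k, hk⟩ => ⟨π k, hk⟩, fun ⟨k, hk⟩ => ⟨π.symm k, by simpa using hk⟩⟩

theorem sum_filter_image_eq {κ : Type*} [Fintype κ] [DecidableEq κ] {m : ℕ} (f₀ : Fin m → κ)
    (hf₀ : Function.Injective f₀) (F : (Fin m → κ) → ℝ) :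
    ∑ f : Fin m → κ with
        Function.Injective f ∧ Finset.univ.image f = Finset.univ.image f₀, F f =
      ∑ π : Equiv.Perm (Fin m), F (f₀ ∘ π) := by
  rw [filter_image_eq_orbit f₀ hf₀, Finset.sum_image]
  intro π _ ρ _ h
  exact Equiv.ext fun k => hf₀ (congrFun h k)

/-- The injective maps into `s` are grouped by their image `J`. Each `J` is enumerated in `j!` ways,
all with the same summand. -/
theorem sum_injective_prod_sq {n j : ℕ} (x : Fin n → ℝ) (s : Finset (Fin n)) :
    ∑ f : Fin j → Fin n with Function.Injective f ∧ ∀ k, f k ∈ s, (∏ k, x (f k)) ^ 2 =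
      (j.factorial : ℝ) * elemSymm x s j := by
  rw [elemSymm, Finset.mul_sum, ← Finset.sum_fiberwise_of_maps_to (t := s.powersetCard j)
    (g := fun f : Fin j → Fin n => Finset.univ.image f)]
  · refine Finset.sum_congr rfl fun J hJ => ?_
    rw [Finset.mem_powersetCard] at hJ
    obtain ⟨hJs, hJc⟩ := hJ
    have himJ : Finset.univ.image (J.orderEmbOfFin hJc) = J := by
      simp
    have h1 := sum_filter_image_eq (J.orderEmbOfFin hJc) (J.orderEmbOfFin hJc).injective
      (fun f => (∏ k, x (f k)) ^ 2)
    rw [himJ] at h1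
    rw [Finset.filter_filter]
    have h2 : (Finset.univ.filter fun f : Fin j → Fin n =>
        (Function.Injective f ∧ ∀ k, f k ∈ s) ∧ Finset.univ.image f = J) =
        Finset.univ.filter fun f : Fin j → Fin n =>
          Function.Injective f ∧ Finset.univ.image f = J := by
      ext f
      simp only [Finset.mem_filter, Finset.mem_univ, true_and]
      refine ⟨fun h => ⟨h.1.1, h.2⟩, fun h => ⟨⟨h.1, fun k => hJs ?_⟩, h.2⟩⟩
      rw [← h.2]
      exact Finset.mem_image_of_mem f (Finset.mem_univ k)
    rw [h2, h1]
    have h3 : ∀ π : Equiv.Perm (Fin j),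
        (∏ k, x (((J.orderEmbOfFin hJc) ∘ π) k)) ^ 2 = ∏ ν ∈ J, x ν ^ 2 := by
      intro π
      rw [← Finset.prod_pow]
      simp only [Function.comp]
      rw [Equiv.prod_comp π (fun k => x (J.orderEmbOfFin hJc k) ^ 2)]
      conv_rhs => rw [← himJ]
      rw [Finset.prod_image (fun a _ b _ h => (J.orderEmbOfFin hJc).injective h)]
    rw [Finset.sum_congr rfl fun π _ => h3 π]
    simp [Fintype.card_perm]
  · intro f hf
    simp only [Finset.mem_filter, Finset.mem_univ, true_and] at hf
    rw [Finset.mem_powersetCard]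
    refine ⟨fun y hy => ?_, by simp [Finset.card_image_of_injective _ hf.1]⟩
    simp only [Finset.mem_image, Finset.mem_univ, true_and] at hy
    obtain ⟨k, rfl⟩ := hy
    exact hf.2 k

/-- Index set of a canonical frame: `e_μ`, `ê_μ`, `e_0`. -/
abbrev FrameIdx (n ε : ℕ) : Type := Fin n ⊕ Fin n ⊕ Fin ε

/-- The sequence of frame indices `e_{f 0}, ê_{f 0}, e_{f 1}, …, a, i_1, i_2, …`. -/
def frameSeq {n ε j m N : ℕ} (hN : 2 * j + (m + 1) = N) (f : Fin j → Fin n)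
    (a : FrameIdx n ε) (i : Fin m → FrameIdx n ε) : Fin N → FrameIdx n ε := fun c =>
  Fin.append (pairSeq Sum.inl (fun k => Sum.inr (Sum.inl k)) f)
    (Fin.cons a i : Fin (m + 1) → FrameIdx n ε) (Fin.cast hN.symm c)

theorem pairSeq_mem {κ X : Type*} (a b : κ → X) {j : ℕ} (f : Fin j → κ) (y : X) :
    (∃ c, pairSeq a b f c = y) ↔ ∃ k, a (f k) = y ∨ b (f k) = y := by
  constructor
  · rintro ⟨c, rfl⟩
    refine ⟨⟨c / 2, by omega⟩, ?_⟩
    by_cases hc : (c : ℕ) % 2 = 0 <;> simp [pairSeq, hc]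
  · rintro ⟨k, hk | hk⟩
    · refine ⟨⟨2 * k, by omega⟩, ?_⟩
      simpa [pairSeq] using hk
    · refine ⟨⟨2 * k + 1, by omega⟩, ?_⟩
      have : (2 * (k : ℕ) + 1) / 2 = k := by omega
      simpa [pairSeq, this] using hk

theorem pairSeq_injective_iff {n ε j : ℕ} (f : Fin j → Fin n) :
    Function.Injective (pairSeq (Sum.inl : Fin n → FrameIdx n ε)
      (fun k => Sum.inr (Sum.inl k)) f) ↔ Function.Injective f := by
  constructor
  · intro h k l hkl
    have h1 : (⟨2 * k, by omega⟩ : Fin (2 * j)) = ⟨2 * l, by omega⟩ := h (by simp [pairSeq, hkl])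
    simp only [Fin.mk.injEq] at h1
    exact Fin.ext (by omega)
  · intro h c d hcd
    by_cases hc : (c : ℕ) % 2 = 0 <;> by_cases hd : (d : ℕ) % 2 = 0 <;>
      simp only [pairSeq, hc, hd, if_true, if_false, Sum.inl.injEq, Sum.inr.injEq, reduceCtorEq] at hcd
    all_goals
      have h2 := congrArg Fin.val (h hcd)
      simp only at h2
      exact Fin.ext (by omega)

theorem frameSeq_injective_iff {n ε j m N : ℕ} (hN : 2 * j + (m + 1) = N) (f : Fin j → Fin n)
    (a : FrameIdx n ε) (i : Fin m → FrameIdx n ε) :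
    Function.Injective (frameSeq hN f a i) ↔ Function.Injective f ∧ Function.Injective i ∧
      (∀ k, i k ≠ a) ∧ (∀ k, Sum.inl (f k) ≠ a ∧ Sum.inr (Sum.inl (f k)) ≠ a) ∧
      ∀ k l, Sum.inl (f k) ≠ i l ∧ Sum.inr (Sum.inl (f k)) ≠ i l := by
  have h0 : frameSeq hN f a i = Fin.append (pairSeq Sum.inl (fun k => Sum.inr (Sum.inl k)) f)
    (Fin.cons a i : Fin (m + 1) → FrameIdx n ε) ∘ finCongr hN.symm := rfl
  rw [h0, Equiv.injective_comp, Fin.append_injective_iff, pairSeq_injective_iff,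
    Fin.cons_injective_iff]
  have h1 : (∀ (p : Fin (2 * j)) (q : Fin (m + 1)),
      pairSeq (Sum.inl : Fin n → FrameIdx n ε) (fun k => Sum.inr (Sum.inl k)) f p ≠
        (Fin.cons a i : Fin (m + 1) → FrameIdx n ε) q) ↔
      (∀ k, Sum.inl (f k) ≠ a ∧ Sum.inr (Sum.inl (f k)) ≠ a) ∧
        ∀ k l, Sum.inl (f k) ≠ i l ∧ Sum.inr (Sum.inl (f k)) ≠ i l := by
    have h2 : ∀ y : FrameIdx n ε, (∀ p : Fin (2 * j), pairSeq (Sum.inl : Fin n → FrameIdx n ε)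
        (fun k => Sum.inr (Sum.inl k)) f p ≠ y) ↔
        ∀ k, Sum.inl (f k) ≠ y ∧ Sum.inr (Sum.inl (f k)) ≠ y := by
      intro y
      have := (pairSeq_mem (Sum.inl : Fin n → FrameIdx n ε) (fun k => Sum.inr (Sum.inl k)) f y).not
      push Not at this
      exact this
    rw [forall_comm, Fin.forall_fin_succ]
    simp only [Fin.cons_zero, Fin.cons_succ, h2]
    refine and_congr_right fun _ => forall_comm
  rw [h1]
  simp only [Set.mem_range, not_exists]
  tauto

/-- Permuting whole pairs acts by `π` on two copies of `Fin j`, so its sign is the square of that of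
`π`. Hence the orderings of a set of blocks add up instead of cancelling. -/
theorem frameSeq_comp_perm {n ε j m N : ℕ} (hN : 2 * j + (m + 1) = N) (f : Fin j → Fin n)
    (a : FrameIdx n ε) (i : Fin m → FrameIdx n ε) (π : Equiv.Perm (Fin j)) :
    ∃ ρ : Equiv.Perm (Fin N), Equiv.Perm.sign ρ = 1 ∧
      frameSeq hN (f ∘ π) a i = frameSeq hN f a i ∘ ρ := by
  let e : Fin (2 * j) ≃ Fin j × Fin 2 := (finCongr (mul_comm 2 j)).trans finProdFinEquiv.symm
  let ρ₀ : Equiv.Perm (Fin j × Fin 2) := Equiv.prodCongrLeft fun _ => π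
  let ρ₁ : Equiv.Perm (Fin (2 * j)) := e.symm.permCongr ρ₀
  let E : Fin (2 * j) ⊕ Fin (m + 1) ≃ Fin N := finSumFinEquiv.trans (finCongr hN)
  have hpair : ∀ (f : Fin j → Fin n) (c : Fin (2 * j)),
      pairSeq (Sum.inl : Fin n → FrameIdx n ε) (fun k => Sum.inr (Sum.inl k)) f c =
        if (e c).2 = 0 then Sum.inl (f (e c).1) else Sum.inr (Sum.inl (f (e c).1)) := by
    intro f c
    have h2 : ((e c).2 = 0) ↔ ((c : ℕ) % 2 = 0) := by
      simp [e, Fin.ext_iff]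
    have h3 : (e c).1 = ⟨c / 2, by omega⟩ := by
      simp [e, Fin.ext_iff]
    simp only [pairSeq, h2, h3]
  refine ⟨E.permCongr (Equiv.sumCongr ρ₁ 1), ?_, ?_⟩
  · rw [Equiv.Perm.sign_permCongr]
    have : Equiv.Perm.sign ρ₁ = 1 := by
      simp only [ρ₁, ρ₀, Equiv.Perm.sign_permCongr, Equiv.Perm.sign_prodCongrLeft]
      simp
    have h2 := Equiv.Perm.sign_sumCongr ρ₁ (1 : Equiv.Perm (Fin (m + 1)))
    rw [this] at h2
    simpa using h2
  · funext c
    obtain ⟨y, rfl⟩ := E.surjective c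
    rcases y with y | y
    · simp only [frameSeq, Function.comp, Equiv.permCongr_apply, Equiv.symm_apply_apply]
      simp only [E, Equiv.trans_apply, finCongr_apply, Equiv.sumCongr_apply, Sum.map_inl,
        finSumFinEquiv_apply_left, Fin.cast_cast, Fin.cast_eq_self, Fin.append_left, hpair]
      simp [ρ₁, ρ₀, Equiv.permCongr_apply]
    · simp only [frameSeq, Function.comp, Equiv.permCongr_apply, Equiv.symm_apply_apply]
      simp only [E, Equiv.trans_apply, finCongr_apply, Equiv.sumCongr_apply, Sum.map_inr,
        finSumFinEquiv_apply_right, Fin.cast_cast, Fin.cast_eq_self, Fin.append_right]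
      simp

/-- The labels `ν` whose block `{e_ν, ê_ν}` does not contain the frame vector `a`. -/
def offBlock {n ε : ℕ} (a : FrameIdx n ε) : Finset (Fin n) :=
  Finset.univ.filter fun ν => (Sum.inl ν : FrameIdx n ε) ≠ a ∧ Sum.inr (Sum.inl ν) ≠ a

theorem exists_of_frameSeq_injective {n ε j m N : ℕ} (hN : 2 * j + (m + 1) = N)
    (hcard : 2 * n + ε = N) {f : Fin j → Fin n} {a : FrameIdx n ε} {i : Fin m → FrameIdx n ε}
    (hf : Function.Injective (frameSeq hN f a i)) (y : FrameIdx n ε) :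
    (∃ k, Sum.inl (f k) = y ∨ Sum.inr (Sum.inl (f k)) = y) ∨ a = y ∨ ∃ l, i l = y := by
  have hb : Function.Bijective (frameSeq hN f a i) := by
    rw [Fintype.bijective_iff_injective_and_card]
    refine ⟨hf, ?_⟩
    simp
    omega
  obtain ⟨c, hc⟩ := hb.2 y
  obtain ⟨d, rfl⟩ : ∃ d, Fin.cast hN d = c := ⟨Fin.cast hN.symm c, by simp⟩
  simp only [frameSeq, Fin.cast_cast, Fin.cast_eq_self] at hc
  revert hc
  refine Fin.addCases (fun p => ?_) (fun q => ?_) d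
  · rw [Fin.append_left]
    intro h
    exact Or.inl ((pairSeq_mem _ _ _ _).1 ⟨p, h⟩)
  · rw [Fin.append_right]
    refine Fin.cases ?_ (fun l => ?_) q
    · intro h
      exact Or.inr (Or.inl (by simpa using h))
    · intro h
      exact Or.inr (Or.inr ⟨l, by simpa using h⟩)

/-- By cardinality both sequences exhaust the frame. If the block of `f k` were not among those of
`f'`, its two vectors, which do not occur in `i`, would both have to equal the single entry `b`. -/
theorem image_subset_of_frameSeq_injective {n ε j m N : ℕ} (hN : 2 * j + (m + 1) = N)
    (hcard : 2 * n + ε = N) {f f' : Fin j → Fin n} {a b : FrameIdx n ε}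
    {i : Fin m → FrameIdx n ε} (hf : Function.Injective (frameSeq hN f a i))
    (hf' : Function.Injective (frameSeq hN f' b i)) (k : Fin j) : ∃ l, f' l = f k := by
  have h1 := (frameSeq_injective_iff hN f a i).1 hf
  by_contra! hne
  have h2 : b = Sum.inl (f k) := by
    rcases exists_of_frameSeq_injective hN hcard hf' (Sum.inl (f k)) with ⟨l, hl | hl⟩ | h | ⟨l, hl⟩
    · exact absurd (Sum.inl_injective hl) (hne l)
    · simp at hl
    · exact h
    · exact absurd hl.symm (h1.2.2.2.2 k l).1
  have h3 : b = Sum.inr (Sum.inl (f k)) := by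
    rcases exists_of_frameSeq_injective hN hcard hf' (Sum.inr (Sum.inl (f k))) with
      ⟨l, hl | hl⟩ | h | ⟨l, hl⟩
    · simp at hl
    · exact absurd (Sum.inl_injective (Sum.inr_injective hl)) (hne l)
    · exact h
    · exact absurd hl.symm (h1.2.2.2.2 k l).2
  rw [h2] at h3
  simp at h3

/-- This is the source of the diagonal form of `K^{(j)}`: two components of the dual form with the
same contracted indices can both be non-zero only if their free indices agree, and then they come
from the same set of blocks. -/
theorem eq_of_frameSeq_injective {n ε j m N : ℕ} (hN : 2 * j + (m + 1) = N)
    (hcard : 2 * n + ε = N) {f f' : Fin j → Fin n} {a b : FrameIdx n ε}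
    {i : Fin m → FrameIdx n ε} (hf : Function.Injective (frameSeq hN f a i))
    (hf' : Function.Injective (frameSeq hN f' b i)) :
    a = b ∧ Finset.univ.image f' = Finset.univ.image f := by
  constructor
  · have h1 := (frameSeq_injective_iff hN f a i).1 hf
    rcases exists_of_frameSeq_injective hN hcard hf' a with ⟨k, hk⟩ | h | ⟨l, hl⟩
    · obtain ⟨l, hl⟩ := image_subset_of_frameSeq_injective hN hcard hf' hf k
      rw [← hl] at hk
      rcases hk with hk | hk
      · exact absurd hk (h1.2.2.2.1 l).1
      · exact absurd hk (h1.2.2.2.1 l).2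
    · exact h.symm
    · exact absurd hl (h1.2.2.1 l)
  · ext y
    simp only [Finset.mem_image, Finset.mem_univ, true_and]
    constructor
    · rintro ⟨k, rfl⟩
      exact image_subset_of_frameSeq_injective hN hcard hf' hf k
    · rintro ⟨k, rfl⟩
      exact image_subset_of_frameSeq_injective hN hcard hf hf' k

/-- The `2j + 1` prescribed entries must be distinct, and `i` must then enumerate their complement,
which has `m` elements. -/
theorem card_frameSeq_injective {n ε j m N : ℕ} (hN : 2 * j + (m + 1) = N)
    (hcard : 2 * n + ε = N) (f : Fin j → Fin n) (a : FrameIdx n ε) :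
    ((Finset.univ.filter fun i : Fin m → FrameIdx n ε =>
      Function.Injective (frameSeq hN f a i)).card : ℝ) =
      if Function.Injective f ∧ ∀ k, f k ∈ offBlock a then (m.factorial : ℝ) else 0 := by
  split_ifs with hfa
  · obtain ⟨hf, ha⟩ := hfa
    have ha' : ∀ k, (Sum.inl (f k) : FrameIdx n ε) ≠ a ∧ Sum.inr (Sum.inl (f k)) ≠ a :=
      fun k => by simpa [offBlock] using ha k
    set u : Fin (2 * j + 1) → FrameIdx n ε :=
      Fin.snoc (pairSeq Sum.inl (fun k => Sum.inr (Sum.inl k)) f) a with hu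
    have hui : Function.Injective u := by
      rw [hu, Fin.snoc_injective_iff]
      refine ⟨(pairSeq_injective_iff f).2 hf, ?_⟩
      rintro ⟨c, hc⟩
      obtain ⟨k, hk⟩ := (pairSeq_mem _ _ _ _).1 ⟨c, hc⟩
      rcases hk with hk | hk
      exacts [(ha' k).1 hk, (ha' k).2 hk]
    have hum : ∀ y, y ∈ Finset.univ.image u ↔
        (∃ k, Sum.inl (f k) = y ∨ Sum.inr (Sum.inl (f k)) = y) ∨ a = y := by
      intro y
      rw [← pairSeq_mem (Sum.inl : Fin n → FrameIdx n ε) (fun k => Sum.inr (Sum.inl k)) f y]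
      simp only [Finset.mem_image, Finset.mem_univ, true_and, Fin.exists_fin_succ', hu,
        Fin.snoc_castSucc, Fin.snoc_last]
    have hC : (Finset.univ.image u)ᶜ.card = m := by
      rw [Finset.card_compl, Finset.card_image_of_injective _ hui]
      simp
      omega
    set i₀ : Fin m → FrameIdx n ε := fun l => ((Finset.univ.image u)ᶜ.equivFinOfCardEq hC).symm l
    have hi₀ : Function.Injective i₀ := fun k l h =>
      ((Finset.univ.image u)ᶜ.equivFinOfCardEq hC).symm.injective (Subtype.ext h)
    have him : Finset.univ.image i₀ = (Finset.univ.image u)ᶜ := by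
      refine Finset.eq_of_subset_of_card_le (fun y hy => ?_) ?_
      · obtain ⟨l, -, rfl⟩ := Finset.mem_image.1 hy
        exact (((Finset.univ.image u)ᶜ.equivFinOfCardEq hC).symm l).2
      · rw [hC, Finset.card_image_of_injective _ hi₀]
        simp
    have h1 : (Finset.univ.filter fun i : Fin m → FrameIdx n ε =>
        Function.Injective (frameSeq hN f a i)) = Finset.univ.filter fun i =>
        Function.Injective i ∧ Finset.univ.image i = Finset.univ.image i₀ := by
      ext i
      simp only [Finset.mem_filter, Finset.mem_univ, true_and, frameSeq_injective_iff, him]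
      constructor
      · rintro ⟨-, hi, hia, -, hif⟩
        refine ⟨hi, Finset.eq_of_subset_of_card_le (fun y hy => ?_) ?_⟩
        · obtain ⟨l, -, rfl⟩ := Finset.mem_image.1 hy
          rw [Finset.mem_compl, hum]
          rintro (⟨k, hk | hk⟩ | hk)
          exacts [(hif k l).1 hk, (hif k l).2 hk, hia l hk.symm]
        · rw [hC, Finset.card_image_of_injective _ hi]
          simp
      · rintro ⟨hi, hc⟩
        have h2 : ∀ l, i l ∉ Finset.univ.image u := fun l => by
          rw [← Finset.mem_compl, ← hc]
          exact Finset.mem_image_of_mem i (Finset.mem_univ l)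
        simp only [hum, not_or, not_exists] at h2
        exact ⟨hf, hi, fun k h => (h2 k).2 h.symm, ha', fun k l => (h2 l).1 k⟩
    have h3 := sum_filter_image_eq i₀ hi₀ (fun _ => 1)
    rw [h1]
    simpa [Fintype.card_perm] using h3
  · rw [Nat.cast_eq_zero, Finset.card_eq_zero, Finset.filter_eq_empty_iff]
    intro i _ hi
    rw [frameSeq_injective_iff] at hi
    exact hfa ⟨hi.1, fun k => by simpa [offBlock] using hi.2.2.2.1 k⟩

/-- Here `w` models the volume form on sequences of frame vectors; only its values `0` and `±1` and
its invariance under even permutations matter. For a non-zero product the blocks of `f'` are a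
permutation of those of `f`, which gives one factor `j!`; counting `i` gives `m!`, and passing from
maps `f` to subsets gives the second `j!`. -/
theorem sum_frameSeq_mul {n ε j m N : ℕ} (hN : 2 * j + (m + 1) = N) (hcard : 2 * n + ε = N)
    (x : Fin n → ℝ) (w : (Fin N → FrameIdx n ε) → ℝ)
    (hw0 : ∀ σ, ¬ Function.Injective σ → w σ = 0) (hw1 : ∀ σ, Function.Injective σ → w σ ^ 2 = 1)
    (hwp : ∀ σ (ρ : Equiv.Perm (Fin N)), Equiv.Perm.sign ρ = 1 → w (σ ∘ ρ) = w σ)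
    (a b : FrameIdx n ε) :
    ∑ i : Fin m → FrameIdx n ε,
      (∑ f : Fin j → Fin n, (∏ k, x (f k)) * w (frameSeq hN f a i)) *
        (∑ f : Fin j → Fin n, (∏ k, x (f k)) * w (frameSeq hN f b i)) =
      if a = b then (j.factorial : ℝ) ^ 2 * m.factorial * elemSymm x (offBlock a) j else 0 := by
  have key : ∀ (i : Fin m → FrameIdx n ε) (f : Fin j → Fin n),
      w (frameSeq hN f a i) * (∑ f' : Fin j → Fin n, (∏ k, x (f' k)) * w (frameSeq hN f' b i)) =
        if a = b then
          if Function.Injective (frameSeq hN f a i) then (j.factorial : ℝ) * ∏ k, x (f k) else 0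
        else 0 := by
    intro i f
    by_cases hf : Function.Injective (frameSeq hN f a i)
    swap
    · simp [hw0 _ hf, hf]
    rw [if_pos hf, Finset.mul_sum]
    split_ifs with hab
    · subst hab
      have hfi := ((frameSeq_injective_iff hN f a i).1 hf).1
      have h1 : ∑ f' : Fin j → Fin n,
          w (frameSeq hN f a i) * ((∏ k, x (f' k)) * w (frameSeq hN f' a i)) =
          ∑ f' : Fin j → Fin n with
            Function.Injective f' ∧ Finset.univ.image f' = Finset.univ.image f,
            w (frameSeq hN f a i) * ((∏ k, x (f' k)) * w (frameSeq hN f' a i)) := by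
        symm
        refine Finset.sum_subset (Finset.filter_subset _ _) fun f' _ hf' => ?_
        have : ¬ Function.Injective (frameSeq hN f' a i) := fun h => hf' (by
          simp only [Finset.mem_filter, Finset.mem_univ, true_and]
          exact ⟨((frameSeq_injective_iff hN f' a i).1 h).1,
            (eq_of_frameSeq_injective hN hcard hf h).2⟩)
        simp [hw0 _ this]
      rw [h1, sum_filter_image_eq f hfi]
      have h2 : ∀ π : Equiv.Perm (Fin j), w (frameSeq hN f a i) *
          ((∏ k, x ((f ∘ π) k)) * w (frameSeq hN (f ∘ π) a i)) = ∏ k, x (f k) := by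
        intro π
        obtain ⟨ρ, hρ, hρ'⟩ := frameSeq_comp_perm hN f a i π
        rw [hρ', hwp _ _ hρ]
        simp only [Function.comp]
        rw [Equiv.prod_comp π (fun k => x (f k))]
        linear_combination (∏ k, x (f k)) * hw1 _ hf
      rw [Finset.sum_congr rfl fun π _ => h2 π]
      simp [Fintype.card_perm]
    · refine Finset.sum_eq_zero fun f' _ => ?_
      have : ¬ Function.Injective (frameSeq hN f' b i) := fun h =>
        hab (eq_of_frameSeq_injective hN hcard hf h).1
      simp [hw0 _ this]
  simp_rw [Finset.sum_mul, mul_assoc, key]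
  split_ifs with hab
  · rw [Finset.sum_comm]
    have h3 : ∀ f : Fin j → Fin n, ∑ i : Fin m → FrameIdx n ε, (∏ k, x (f k)) *
        (if Function.Injective (frameSeq hN f a i) then (j.factorial : ℝ) * ∏ k, x (f k) else 0) =
        (j.factorial : ℝ) * m.factorial *
          if Function.Injective f ∧ ∀ k, f k ∈ offBlock a then (∏ k, x (f k)) ^ 2 else 0 := by
      intro f
      simp_rw [mul_ite, mul_zero]
      rw [← Finset.sum_filter, Finset.sum_const, nsmul_eq_mul, card_frameSeq_injective hN hcard]
      split_ifs
      · ring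
      · ring
    rw [Finset.sum_congr rfl fun f _ => h3 f, ← Finset.mul_sum, ← Finset.sum_filter,
      sum_injective_prod_sq]
    ring
  · simp

end FrameCombinatorics

end TorsionKY

namespace TorsionKY

/-! ### Contractions and the Hodge star in an orthonormal frame -/

section PartialEvaluation

variable {V : Type*}

theorem append_update_left_cast {q m N : ℕ} (h : q + m = N) (t : Fin q → V) (v : Fin m → V)
    (i : Fin q) (x : V) :
    (fun c => Fin.append (Function.update t i x) v (Fin.cast h.symm c)) =
      Function.update (fun c => Fin.append t v (Fin.cast h.symm c))
        (Fin.cast h (Fin.castAdd m i)) x := by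
  subst h
  funext c
  refine Fin.addCases (fun k => ?_) (fun k => ?_) c
  · by_cases hk : k = i
    · subst hk; simp
    · have : Fin.castAdd m k ≠ Fin.castAdd m i := fun h => hk (Fin.castAdd_injective _ _ h)
      simp [hk]
  · have : Fin.natAdd q k ≠ Fin.castAdd m i := by
      simp only [ne_eq, Fin.ext_iff, Fin.val_natAdd, Fin.val_castAdd]; omega
    simp [this]

theorem append_update_right_cast {q m N : ℕ} (h : q + m = N) (t : Fin q → V) (v : Fin m → V)
    (i : Fin m) (x : V) :
    (fun c => Fin.append t (Function.update v i x) (Fin.cast h.symm c)) =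
      Function.update (fun c => Fin.append t v (Fin.cast h.symm c))
        (Fin.cast h (Fin.natAdd q i)) x := by
  subst h
  funext c
  refine Fin.addCases (fun k => ?_) (fun k => ?_) c
  · have : Fin.castAdd m k ≠ Fin.natAdd q i := by
      simp only [ne_eq, Fin.ext_iff, Fin.val_natAdd, Fin.val_castAdd]; omega
    simp [this]
  · by_cases hk : k = i
    · subst hk; simp
    · have : Fin.natAdd q k ≠ Fin.natAdd q i := by
        simpa [Fin.ext_iff] using hk
      simp [hk]

variable [AddCommGroup V] [Module ℝ V]

/-- The form `t ↦ w (t, v)`. -/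
def fixRight {q m N : ℕ} (h : q + m = N) (w : V [⋀^Fin N]→ₗ[ℝ] ℝ) (v : Fin m → V) :
    V [⋀^Fin q]→ₗ[ℝ] ℝ where
  toFun t := w (fun c => Fin.append t v (Fin.cast h.symm c))
  map_update_add' {inst} t i x y := by
    have : inst = instDecidableEqFin q := Subsingleton.elim _ _
    subst this
    change w (fun c => Fin.append (Function.update t i (x + y)) v (Fin.cast h.symm c)) =
      w (fun c => Fin.append (Function.update t i x) v (Fin.cast h.symm c)) +
      w (fun c => Fin.append (Function.update t i y) v (Fin.cast h.symm c))
    rw [append_update_left_cast h, append_update_left_cast h, append_update_left_cast h,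
      AlternatingMap.map_update_add]
  map_update_smul' {inst} t i r x := by
    have : inst = instDecidableEqFin q := Subsingleton.elim _ _
    subst this
    change w (fun c => Fin.append (Function.update t i (r • x)) v (Fin.cast h.symm c)) =
      r • w (fun c => Fin.append (Function.update t i x) v (Fin.cast h.symm c))
    rw [append_update_left_cast h, append_update_left_cast h, AlternatingMap.map_update_smul]
  map_eq_zero_of_eq' t i k hik hne := by
    refine w.map_eq_zero_of_eq _ (i := Fin.cast h (Fin.castAdd m i))
      (j := Fin.cast h (Fin.castAdd m k)) (by simpa using hik) ?_
    simpa [Fin.ext_iff] using hne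

/-- The form `v ↦ w (t, v)`. -/
def fixLeft {q m N : ℕ} (h : q + m = N) (w : V [⋀^Fin N]→ₗ[ℝ] ℝ) (t : Fin q → V) :
    V [⋀^Fin m]→ₗ[ℝ] ℝ where
  toFun v := w (fun c => Fin.append t v (Fin.cast h.symm c))
  map_update_add' {inst} v i x y := by
    have : inst = instDecidableEqFin m := Subsingleton.elim _ _
    subst this
    change w (fun c => Fin.append t (Function.update v i (x + y)) (Fin.cast h.symm c)) =
      w (fun c => Fin.append t (Function.update v i x) (Fin.cast h.symm c)) +
      w (fun c => Fin.append t (Function.update v i y) (Fin.cast h.symm c))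
    rw [append_update_right_cast h, append_update_right_cast h, append_update_right_cast h,
      AlternatingMap.map_update_add]
  map_update_smul' {inst} v i r x := by
    have : inst = instDecidableEqFin m := Subsingleton.elim _ _
    subst this
    change w (fun c => Fin.append t (Function.update v i (r • x)) (Fin.cast h.symm c)) =
      r • w (fun c => Fin.append t (Function.update v i x) (Fin.cast h.symm c))
    rw [append_update_right_cast h, append_update_right_cast h, AlternatingMap.map_update_smul]
  map_eq_zero_of_eq' v i k hik hne := by
    refine w.map_eq_zero_of_eq _ (i := Fin.cast h (Fin.natAdd q i))
      (j := Fin.cast h (Fin.natAdd q k)) (by simpa using hik) ?_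
    simpa [Fin.ext_iff] using hne

/-- In the Leibniz expansion the permutation `σ` forces `i = s ∘ σ`, and its sign cancels against
the one produced by `β`. All `q!` terms are therefore equal. -/
theorem sum_det_mul_alternating {q : ℕ} {ι : Type*} [Fintype ι] [DecidableEq ι] (E : ι → V)
    (s : Fin q → ι) (β : V [⋀^Fin q]→ₗ[ℝ] ℝ) :
    ∑ i : Fin q → ι, (Matrix.of fun r c => if s r = i c then (1 : ℝ) else 0).det *
      β (fun c => E (i c)) = (q.factorial : ℝ) * β fun c => E (s c) := by
  simp_rw [Matrix.det_apply, Finset.sum_mul]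
  rw [Finset.sum_comm]
  have h1 : ∀ σ : Equiv.Perm (Fin q), ∑ i : Fin q → ι, (Equiv.Perm.sign σ •
      ∏ c, (Matrix.of fun r c => if s r = i c then (1 : ℝ) else 0) (σ c) c) *
        β (fun c => E (i c)) = β fun c => E (s c) := by
    intro σ
    rw [Finset.sum_eq_single (fun c => s (σ c))]
    · have h2 := β.map_perm (fun c => E (s c)) σ
      simp only [Function.comp_def] at h2
      rw [h2]
      rcases Int.units_eq_one_or (Equiv.Perm.sign σ) with h | h <;> simp [h]
    · intro i _ hi
      have : ∃ c, s (σ c) ≠ i c := by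
        by_contra! hc
        exact hi (funext fun c => (hc c).symm)
      obtain ⟨c, hc⟩ := this
      rw [Finset.prod_eq_zero (Finset.mem_univ c) (by simp [hc])]
      simp
    · simp
  rw [Finset.sum_congr rfl fun σ _ => h1 σ]
  simp [Fintype.card_perm]

end PartialEvaluation

section Frames

variable {D : ℕ} {M : Type*} [TopologicalSpace M] [ChartedSpace (EuclideanSpace ℝ (Fin D)) M]

theorem eq_sum_stdVec (p : M) (v : TangentSpace (𝓡 D) p) :
    v = ∑ i, (show EuclideanSpace ℝ (Fin D) from v) i • stdVec p i := by
  have := (EuclideanSpace.basisFun (Fin D) ℝ).sum_repr (show EuclideanSpace ℝ (Fin D) from v)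
  simp only [EuclideanSpace.basisFun_apply] at this
  exact this.symm

variable [IsManifold (𝓡 D) ∞ M]

theorem metric_symm (g : Metric D M) (p : M) (u v : TangentSpace (𝓡 D) p) :
    g.inner p u v = g.inner p v u := g.symm p u v

/-- The frame `E` is orthonormal at `p`. -/
def IsOrthonormal (g : Metric D M) (p : M) {ι : Type*} [DecidableEq ι]
    (E : ι → TangentSpace (𝓡 D) p) : Prop :=
  ∀ a b, g.inner p (E a) (E b) = if a = b then 1 else 0

/-- The coordinates of the frame vectors. -/
def frameMatrix (p : M) {ι : Type*} (E : ι → TangentSpace (𝓡 D) p) : Matrix (Fin D) ι ℝ :=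
  Matrix.of fun i a => (show EuclideanSpace ℝ (Fin D) from E a) i

theorem frameMatrix_gram (g : Metric D M) (p : M) {ι : Type*} [Fintype ι] [DecidableEq ι]
    {E : ι → TangentSpace (𝓡 D) p} (hE : IsOrthonormal g p E) :
    (frameMatrix p E).transpose * gram g p * frameMatrix p E = 1 := by
  ext a b
  have h := hE a b
  rw [eq_sum_stdVec p (E a), eq_sum_stdVec p (E b)] at h
  rw [Matrix.one_apply, ← h, Matrix.mul_apply]
  simp only [Matrix.mul_apply, Matrix.transpose_apply, map_sum, map_smul,
    sum_apply, smul_apply, smul_eq_mul, gram, frameMatrix, Matrix.of_apply]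
  exact Finset.sum_congr rfl fun _ _ => mul_comm _ _

/-- Orthonormality reads `EᵀGE = 1` for the matrix `E` of the frame, which is square by `hι`; its
one-sided inverse is two-sided. -/
theorem gram_inv (g : Metric D M) (p : M) {ι : Type*} [Fintype ι] [DecidableEq ι]
    (hι : Fintype.card ι = D) {E : ι → TangentSpace (𝓡 D) p} (hE : IsOrthonormal g p E) :
    (gram g p)⁻¹ = frameMatrix p E * (frameMatrix p E).transpose := by
  refine Matrix.inv_eq_left_inv ?_
  have h := frameMatrix_gram g p hE
  rw [Matrix.mul_eq_one_comm_of_card_eq _ _ _ (by simp [hι])] at h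
  rwa [← Matrix.mul_assoc] at h

theorem contract_eq_sum (g : Metric D M) (p : M) {ι : Type*} [Fintype ι] [DecidableEq ι]
    (hι : Fintype.card ι = D) {E : ι → TangentSpace (𝓡 D) p} (hE : IsOrthonormal g p E) {m : ℕ}
    (α β : MultilinearMap ℝ (fun _ : Fin m => TangentSpace (𝓡 D) p) ℝ) :
    contract g p (fun s t => α s * β t) =
      ∑ i : Fin m → ι, α (fun k => E (i k)) * β (fun k => E (i k)) := by
  have hexp : ∀ (γ : MultilinearMap ℝ (fun _ : Fin m => TangentSpace (𝓡 D) p) ℝ) (i : Fin m → ι),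
      γ (fun k => E (i k)) = ∑ r : Fin m → Fin D, (∏ k, frameMatrix p E (r k) (i k)) *
        γ (fun k => stdVec p (r k)) := by
    intro γ i
    have h1 : (fun k => E (i k)) = fun k => ∑ l, frameMatrix p E l (i k) • stdVec p l :=
      funext fun k => eq_sum_stdVec p (E (i k))
    rw [h1, MultilinearMap.map_sum]
    simp only [MultilinearMap.map_smul_univ, smul_eq_mul]
  simp_rw [hexp, contract, gram_inv g p hι hE, Matrix.mul_apply, Matrix.transpose_apply,
    Finset.prod_univ_sum, Fintype.piFinset_univ, Finset.prod_mul_distrib, Finset.sum_mul_sum,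
    Finset.sum_mul]
  conv_rhs => rw [Finset.sum_comm]
  refine Finset.sum_congr rfl fun r _ => ?_
  rw [Finset.sum_comm]
  refine Finset.sum_congr rfl fun i _ => ?_
  refine Finset.sum_congr rfl fun s _ => ?_
  ring

/-- Only the square is determined: the sign of `vol` may change from point to point. This is
harmless because `vol` enters `K^{(j)}` twice. -/
theorem vol_frame (g : Metric D M) {vol : FormField D M D} (hvol : IsVolumeElement g vol) (p : M)
    {ι : Type*} [DecidableEq ι] {E : ι → TangentSpace (𝓡 D) p} (hE : IsOrthonormal g p E)
    {s : Fin D → ι} (hs : Function.Injective s) : vol p (fun c => E (s c)) ^ 2 = 1 := by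
  rw [hvol]
  have : (Matrix.of fun i j => g.inner p (E (s i)) (E (s j))) = 1 := by
    ext i j
    simp [hE (s i) (s j), Matrix.one_apply, hs.eq_iff]
  rw [this, Matrix.det_one]

/-- Contracting a product of dual covectors with the volume form inserts the corresponding frame
vectors; the `(2j)!` permutations of them cancel the prefactor of the star. -/
theorem hodgeStar_wedgePow (g : Metric D M) (vol : FormField D M D) (h : FormField D M 2) (p : M)
    {n ε : ℕ} (hD : D = 2 * n + ε) {x : Fin n → ℝ} {E : FrameIdx n ε → TangentSpace (𝓡 D) p}
    (hE : IsOrthonormal g p E)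
    (hh : ∀ u v : TangentSpace (𝓡 D) p, h p ![u, v] = ∑ μ, x μ *
      (g.inner p (E (.inl μ)) u * g.inner p (E (.inr (.inl μ))) v -
        g.inner p (E (.inr (.inl μ))) u * g.inner p (E (.inl μ)) v)) {j m : ℕ}
    (hjm : 2 * j + m = D) (v : Fin m → TangentSpace (𝓡 D) p) :
    hodgeStar g vol hjm (fun p => wedgePow (h p) j) p v =
      (∑ f : Fin j → Fin n, (∏ k, x (f k)) • fixLeft hjm (vol p)
        (fun c => E (pairSeq Sum.inl (fun k => Sum.inr (Sum.inl k)) f c))) v := by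
  have hι : Fintype.card (FrameIdx n ε) = D := by simp [hD]; ring
  have h1 := wedgePow_eq_sum_detForm (h p) x (fun μ => (g.inner p (E (.inl μ))).toLinearMap)
    (fun μ => (g.inner p (E (.inr (.inl μ)))).toLinearMap) hh j
  have h2 := contract_eq_sum g p hι hE (wedgePow (h p) j).toMultilinearMap
    (fixRight hjm (vol p) v).toMultilinearMap
  have h3 : hodgeStar g vol hjm (fun p => wedgePow (h p) j) p v = 1 / ((2 * j).factorial : ℝ) *
      ∑ i : Fin (2 * j) → FrameIdx n ε, wedgePow (h p) j (fun k => E (i k)) *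
        fixRight hjm (vol p) v (fun k => E (i k)) := by
    exact congrArg (fun z => 1 / ((2 * j).factorial : ℝ) * z) h2
  have h4 : ∀ (f : Fin j → Fin n) (i : Fin (2 * j) → FrameIdx n ε),
      detForm (pairSeq (fun μ => (g.inner p (E (.inl μ))).toLinearMap)
        (fun μ => (g.inner p (E (.inr (.inl μ)))).toLinearMap) f) (fun k => E (i k)) =
      (Matrix.of fun r c => if pairSeq Sum.inl (fun k => Sum.inr (Sum.inl k)) f r = i c
        then (1 : ℝ) else 0).det := by
    intro f i
    rw [detForm_apply]
    congr 1
    ext r c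
    by_cases hr : (r : ℕ) % 2 = 0 <;> simp only [Matrix.of_apply, pairSeq, hr, if_true, if_false]
    · exact hE _ _
    · exact hE _ _
  rw [h3, h1, alternatingMap_sum_apply]
  simp_rw [alternatingMap_sum_apply, AlternatingMap.smul_apply, h4, Finset.sum_mul, smul_eq_mul]
  rw [Finset.sum_comm]
  simp_rw [mul_assoc, ← Finset.mul_sum, sum_det_mul_alternating, Finset.mul_sum]
  refine Finset.sum_congr rfl fun f _ => ?_
  have : ((2 * j).factorial : ℝ) ≠ 0 := by positivity
  field_simp
  rfl

theorem eq_sum_frame (g : Metric D M) (p : M) {ι : Type*} [Fintype ι] [DecidableEq ι]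
    (hι : Fintype.card ι = D) {E : ι → TangentSpace (𝓡 D) p} (hE : IsOrthonormal g p E)
    (v : TangentSpace (𝓡 D) p) : v = ∑ a, g.inner p (E a) v • E a := by
  have hli : LinearIndependent ℝ E := by
    rw [Fintype.linearIndependent_iff]
    intro c hc a
    have h1 := congrArg (g.inner p (E a)) hc
    simpa [hE a] using h1
  have hfr : Module.finrank ℝ (TangentSpace (𝓡 D) p) = D := by
    have : Module.finrank ℝ (EuclideanSpace ℝ (Fin D)) = D := by simp
    exact this
  have hne : FiniteDimensional ℝ (TangentSpace (𝓡 D) p) :=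
    inferInstanceAs (FiniteDimensional ℝ (EuclideanSpace ℝ (Fin D)))
  have hspan := hli.span_eq_top_of_card_eq_finrank' (by rw [hι, hfr])
  have hv : v ∈ Submodule.span ℝ (Set.range E) := hspan ▸ Submodule.mem_top
  obtain ⟨c, rfl⟩ := (Submodule.mem_span_range_iff_exists_fun ℝ).1 hv
  refine Finset.sum_congr rfl fun a _ => ?_
  congr 1
  simp [hE a]

/-- Purely algebraic and pointwise: only the canonical form of `h` at `p` is used, not the equations
satisfied by `h`. The normalising constant of `K^{(j)}` is the one that cancels `j!² m!` in
`sum_frameSeq_mul`. -/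
theorem killingTensor_frame (g : Metric D M) {vol : FormField D M D}
    (hvol : IsVolumeElement g vol) (h : FormField D M 2) (p : M)
    {n ε : ℕ} (hD : D = 2 * n + ε) {x : Fin n → ℝ} {E : FrameIdx n ε → TangentSpace (𝓡 D) p}
    (hE : IsOrthonormal g p E)
    (hh : ∀ u v : TangentSpace (𝓡 D) p, h p ![u, v] = ∑ μ, x μ *
      (g.inner p (E (.inl μ)) u * g.inner p (E (.inr (.inl μ))) v -
        g.inner p (E (.inr (.inl μ))) u * g.inner p (E (.inl μ)) v)) (j : ℕ) (hj : 2 * j < D)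
    (u v : TangentSpace (𝓡 D) p) :
    killingTensor g vol h j hj p ![u, v] =
      ∑ a, elemSymm x (offBlock a) j * (g.inner p (E a) u * g.inner p (E a) v) := by
  have hι : Fintype.card (FrameIdx n ε) = D := by simp [hD]; ring
  set m := D - 2 * j - 1 with hm
  have hjm : 2 * j + (m + 1) = D := by omega
  -- `R` is the dual form `f^{(j)}` at `p` as an alternating map; currying separates its free first
  -- slot from the contracted ones.
  set R : TangentSpace (𝓡 D) p [⋀^Fin (m + 1)]→ₗ[ℝ] ℝ :=
    ∑ f : Fin j → Fin n, (∏ k, x (f k)) • fixLeft hjm (vol p)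
        (fun c => E (pairSeq Sum.inl (fun k => Sum.inr (Sum.inl k)) f c)) with hR
  have h1 : killingTensor g vol h j hj p ![u, v] =
      1 / ((j.factorial : ℝ) ^ 2 * (m.factorial : ℝ)) *
        contract g p (fun s t => (R.curryLeft u).toMultilinearMap s *
          (R.curryLeft v).toMultilinearMap t) := by
    simp only [killingTensor]
    congr 2
    funext s t
    rw [hodgeStar_wedgePow g vol h p hD hE hh hjm, hodgeStar_wedgePow g vol h p hD hE hh hjm]
    rfl
  rw [h1, contract_eq_sum g p hι hE]
  have h2 : ∀ (w : TangentSpace (𝓡 D) p) (i : Fin m → FrameIdx n ε),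
      (R.curryLeft w).toMultilinearMap (fun k => E (i k)) =
        ∑ a, g.inner p (E a) w * ∑ f : Fin j → Fin n, (∏ k, x (f k)) *
          vol p (fun c => E (frameSeq hjm f a i c)) := by
    intro w i
    conv_lhs => rw [eq_sum_frame g p hι hE w]
    rw [map_sum]
    change (∑ a, R.curryLeft (g.inner p (E a) w • E a)) (fun k => E (i k)) = _
    rw [alternatingMap_sum_apply]
    refine Finset.sum_congr rfl fun a _ => ?_
    rw [map_smul, AlternatingMap.smul_apply, smul_eq_mul, AlternatingMap.curryLeft_apply_apply, hR,
      alternatingMap_sum_apply]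
    congr 1
    refine Finset.sum_congr rfl fun f _ => ?_
    rw [AlternatingMap.smul_apply, smul_eq_mul]
    congr 1
    change vol p _ = _
    congr 1
    funext c
    obtain ⟨d, rfl⟩ : ∃ d, Fin.cast hjm d = c := ⟨Fin.cast hjm.symm c, by simp⟩
    simp only [frameSeq, Fin.cast_cast, Fin.cast_eq_self]
    refine Fin.addCases (fun k => ?_) (fun k => ?_) d
    · simp
    · refine Fin.cases ?_ (fun l => ?_) k <;> simp
  simp_rw [h2]
  have h3 := sum_frameSeq_mul (m := m) hjm (by omega) x (fun s => vol p (fun c => E (s c)))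
    (fun s hs => by
      simp only [Function.Injective, not_forall] at hs
      obtain ⟨c, d, hcd, hne⟩ := hs
      exact (vol p).map_eq_zero_of_eq _ (by rw [hcd]) hne)
    (fun s hs => vol_frame g hvol p hE hs)
    (fun s ρ hρ => by
      have := (vol p).map_perm (fun c => E (s c)) ρ
      rw [hρ, one_smul] at this
      exact this)
  simp_rw [Finset.sum_mul_sum]
  rw [Finset.sum_comm]
  conv_lhs => enter [2, 2, a]; rw [Finset.sum_comm]
  have h4 : ∀ a b, ∑ i : Fin m → FrameIdx n ε, (g.inner p (E a) u * ∑ f : Fin j → Fin n,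
      (∏ k, x (f k)) * vol p (fun c => E (frameSeq hjm f a i c))) *
      (g.inner p (E b) v * ∑ f : Fin j → Fin n,
      (∏ k, x (f k)) * vol p (fun c => E (frameSeq hjm f b i c))) =
      if a = b then (j.factorial : ℝ) ^ 2 * m.factorial * elemSymm x (offBlock a) j *
        (g.inner p (E a) u * g.inner p (E a) v) else 0 := by
    intro a b
    have h5 := h3 a b
    simp_rw [mul_mul_mul_comm, ← Finset.mul_sum]
    rw [h5]
    split_ifs with hab
    · subst hab; ring
    · ring
  simp_rw [h4]
  simp only [Finset.sum_ite_eq, Finset.mem_univ, if_true, Finset.mul_sum]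
  refine Finset.sum_congr rfl fun a _ => ?_
  have hj0 : (j.factorial : ℝ) ≠ 0 := by positivity
  have hm0 : (m.factorial : ℝ) ≠ 0 := by positivity
  field_simp

end Frames

end TorsionKY

namespace TorsionKY

/-! ### Jacobi's formula for the derivative of a determinant -/

section DetDerivative

variable {E : Type*} [NormedAddCommGroup E] [NormedSpace ℝ E] [FiniteDimensional ℝ E]

theorem contDiff_det : ContDiff ℝ ∞ fun f : E →L[ℝ] E => LinearMap.det (f : E →ₗ[ℝ] E) := by
  let b := Module.finBasis ℝ E
  have h1 : ∀ f : E →L[ℝ] E, LinearMap.det (f : E →ₗ[ℝ] E) =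
      ∑ σ : Equiv.Perm (Fin (Module.finrank ℝ E)), (Equiv.Perm.sign σ : ℝ) *
        ∏ i, (b.coord (σ i)).toContinuousLinearMap (f (b i)) := by
    intro f
    rw [← LinearMap.det_toMatrix b, Matrix.det_apply']
    simp [LinearMap.toMatrix_apply]
  simp_rw [h1]
  refine ContDiff.sum fun σ _ => contDiff_const.mul (contDiff_prod fun i _ => ?_)
  fun_prop

/-- Along the line `f + r X = f (1 + r N X)` the determinant is `det f` times a polynomial in `r`
whose linear coefficient is the trace of `N X`. -/
theorem fderiv_det {f N : E →L[ℝ] E} (hN : f * N = 1) (X : E →L[ℝ] E) :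
    fderiv ℝ (fun f : E →L[ℝ] E => LinearMap.det (f : E →ₗ[ℝ] E)) f X =
      LinearMap.det (f : E →ₗ[ℝ] E) * LinearMap.trace ℝ E (N * X : E →L[ℝ] E) := by
  let b := Module.finBasis ℝ E
  have hd : HasFDerivAt (fun f : E →L[ℝ] E => LinearMap.det (f : E →ₗ[ℝ] E))
      (fderiv ℝ (fun f : E →L[ℝ] E => LinearMap.det (f : E →ₗ[ℝ] E)) f) (f + (0 : ℝ) • X) := by
    rw [zero_smul, add_zero]
    exact (contDiff_det.differentiable (by simp) f).hasFDerivAt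
  have hl : HasDerivAt (fun r : ℝ => f + r • X) X 0 := by
    simpa using ((hasDerivAt_id (0 : ℝ)).smul_const X).const_add f
  have h1 := hd.comp_hasDerivAt (0 : ℝ) hl
  set C := LinearMap.toMatrix b b ((N * X : E →L[ℝ] E) : E →ₗ[ℝ] E) with hC
  have h2 : ∀ r : ℝ, LinearMap.det ((f + r • X : E →L[ℝ] E) : E →ₗ[ℝ] E) =
      LinearMap.det (f : E →ₗ[ℝ] E) * (1 + r • C).det := by
    intro r
    have e1 : f + r • X = f * (1 + r • (N * X)) := by
      rw [mul_add, mul_one, mul_smul_comm, ← mul_assoc, hN, one_mul]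
    have e2 : (1 + r • C) = LinearMap.toMatrix b b
        ((1 + r • (N * X) : E →L[ℝ] E) : E →ₗ[ℝ] E) := by
      have : ((1 + r • (N * X) : E →L[ℝ] E) : E →ₗ[ℝ] E) =
          LinearMap.id + r • ((N * X : E →L[ℝ] E) : E →ₗ[ℝ] E) := rfl
      rw [this, map_add, map_smul, LinearMap.toMatrix_id]
    rw [e1, e2, LinearMap.det_toMatrix, ← LinearMap.det_comp]
    rfl
  have h3 : HasDerivAt (fun r : ℝ => LinearMap.det (f : E →ₗ[ℝ] E) * (1 + r • C).det)
      (LinearMap.det (f : E →ₗ[ℝ] E) * C.trace) 0 := by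
    refine HasDerivAt.const_mul _ ?_
    set q : Polynomial ℝ := (1 + (Polynomial.X : Polynomial ℝ) • C.map ⇑Polynomial.C).det.divX.divX
    have e : (fun r : ℝ => (1 + r • C).det) = fun r => 1 + C.trace * r + q.eval r * r ^ 2 :=
      funext fun r => Matrix.det_one_add_smul r C
    rw [e]
    have h5 : HasDerivAt (fun r : ℝ => 1 + C.trace * r + q.eval r * r ^ 2)
        (C.trace * 1 + (q.derivative.eval 0 * 0 ^ 2 + q.eval 0 * (2 * 0 ^ 1 * 1))) 0 := by
      refine (((hasDerivAt_id' (0 : ℝ)).const_mul C.trace).const_add 1).add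
        ((q.hasDerivAt 0).mul ?_)
      simpa using (hasDerivAt_id' (0 : ℝ)).fun_pow 2
    simpa using h5
  have h4 : C.trace = LinearMap.trace ℝ E (N * X : E →L[ℝ] E) := by
    rw [hC, LinearMap.trace_eq_matrix_trace ℝ b]
  rw [← h4]
  have e : ((fun f : E →L[ℝ] E => LinearMap.det (f : E →ₗ[ℝ] E)) ∘ fun r : ℝ => f + r • X) =
      fun r => LinearMap.det (f : E →ₗ[ℝ] E) * (1 + r • C).det := funext h2
  rw [e] at h1
  exact h1.unique h3

end DetDerivative

/-- A metric `g`, a connection `Γ` with totally antisymmetric torsion and an endomorphism field `A`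
(the `(1,1)`-tensor of a 2-form `h`) on the open set `O`, such that `g` is parallel and
`∇_w h = w ∧ z`. -/
structure LocalPKY {E : Type*} [NormedAddCommGroup E] [NormedSpace ℝ E] (O : Set E)
    (g : E → E →L[ℝ] E →L[ℝ] ℝ) (A : E → E →L[ℝ] E) (Γ : E → E →L[ℝ] E →L[ℝ] E) (z : E → E) :
    Prop where
  isOpen : IsOpen O
  smooth_metric : ContDiffOn ℝ ∞ g O
  smooth_endo : ContDiffOn ℝ ∞ A O
  continuousOn_conn : ContinuousOn Γ O
  continuousOn_z : ContinuousOn z O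
  symm : ∀ y ∈ O, ∀ u v, g y u v = g y v u
  pos : ∀ y ∈ O, ∀ v, v ≠ 0 → 0 < g y v v
  skew : ∀ y ∈ O, ∀ u v, g y (A y u) v = -g y u (A y v)
  compat : ∀ y ∈ O, ∀ w u v, fderiv ℝ g y w u v = g y (Γ y w u) v + g y u (Γ y w v)
  torsion : ∀ y ∈ O, ∀ u v w, g y (Γ y u v - Γ y v u) w = -g y (Γ y u w - Γ y w u) v
  deriv_endo : ∀ y ∈ O, ∀ w u, fderiv ℝ A y w u =
    A y (Γ y w u) - Γ y w (A y u) + g y (z y) u • w - g y w u • z y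

/-! ### The generating function and its algebra -/

section Resolvent

variable {E : Type*} [NormedAddCommGroup E] [NormedSpace ℝ E]

/-- `1 - s² A²` at a point. -/
def resolventArg (A : E →L[ℝ] E) (s : ℝ) : E →L[ℝ] E := 1 - s ^ 2 • (A * A)

/-- `B_s = (1 - s² A²)⁻¹`. -/
noncomputable def resolvent (A : E →L[ℝ] E) (s : ℝ) : E →L[ℝ] E := Ring.inverse (resolventArg A s)

/-- `W_s = det (1 - s A)`. -/
noncomputable def detW (A : E →L[ℝ] E) (s : ℝ) : ℝ :=
  LinearMap.det ((1 - s • A : E →L[ℝ] E) : E →ₗ[ℝ] E)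

/-- The generating function `W_s g(u, B_s v)` of the Killing tensors. -/
noncomputable def genK (g : E →L[ℝ] E →L[ℝ] ℝ) (A : E →L[ℝ] E) (s : ℝ) (u v : E) : ℝ :=
  detW A s * g u (resolvent A s v)

variable {O : Set E} {g : E → E →L[ℝ] E →L[ℝ] ℝ} {A : E → E →L[ℝ] E}
  {Γ : E → E →L[ℝ] E →L[ℝ] E} {z : E → E}

namespace LocalPKY

theorem nonneg (H : LocalPKY O g A Γ z) {y : E} (hy : y ∈ O) (v : E) : 0 ≤ g y v v := by
  by_cases hv : v = 0
  · simp [hv]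
  · exact (H.pos y hy v hv).le

theorem ext_inner (H : LocalPKY O g A Γ z) {y : E} (hy : y ∈ O) {u v : E}
    (h : ∀ w, g y w u = g y w v) : u = v := by
  by_contra hne
  have := H.pos y hy (u - v) (sub_ne_zero.2 hne)
  rw [map_sub, h, sub_self] at this
  exact lt_irrefl _ this

theorem inner_endo_self (H : LocalPKY O g A Γ z) {y : E} (hy : y ∈ O) (v : E) :
    g y v (A y v) = 0 := by
  have := H.skew y hy v v
  rw [H.symm y hy] at this
  linarith

theorem differentiableAt_metric (H : LocalPKY O g A Γ z) {y : E} (hy : y ∈ O) :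
    DifferentiableAt ℝ g y :=
  (H.smooth_metric.contDiffAt (H.isOpen.mem_nhds hy)).differentiableAt (by simp)

theorem differentiableAt_endo (H : LocalPKY O g A Γ z) {y : E} (hy : y ∈ O) :
    DifferentiableAt ℝ A y :=
  (H.smooth_endo.contDiffAt (H.isOpen.mem_nhds hy)).differentiableAt (by simp)

variable [FiniteDimensional ℝ E]

/-- As `A` is skew, `g(v, (1 - s² A²) v) = |v|² + s² |A v|²`, which is positive for `v ≠ 0` and
every real `s`. -/
theorem isUnit_resolventArg (H : LocalPKY O g A Γ z) {y : E} (hy : y ∈ O) (s : ℝ) :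
    IsUnit (resolventArg (A y) s) := by
  rw [ContinuousLinearMap.isUnit_iff_bijective]
  have hinj : Function.Injective (resolventArg (A y) s) := by
    rw [injective_iff_map_eq_zero]
    intro v hv
    by_contra hne
    have h1 : g y v (resolventArg (A y) s v) = g y v v + s ^ 2 * g y (A y v) (A y v) := by
      rw [H.skew y hy]
      simp [resolventArg]
      ring
    rw [hv, map_zero] at h1
    have := H.pos y hy v hne
    have h2 := H.nonneg hy (A y v)
    nlinarith [mul_nonneg (sq_nonneg s) h2]
  exact ⟨hinj, LinearMap.injective_iff_surjective (f := (resolventArg (A y) s : E →ₗ[ℝ] E)).1 hinj⟩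

theorem resolventArg_mul (H : LocalPKY O g A Γ z) {y : E} (hy : y ∈ O) (s : ℝ) :
    resolventArg (A y) s * resolvent (A y) s = 1 :=
  Ring.mul_inverse_cancel _ (H.isUnit_resolventArg hy s)

theorem resolvent_mul (H : LocalPKY O g A Γ z) {y : E} (hy : y ∈ O) (s : ℝ) :
    resolvent (A y) s * resolventArg (A y) s = 1 :=
  Ring.inverse_mul_cancel _ (H.isUnit_resolventArg hy s)

theorem resolvent_apply (H : LocalPKY O g A Γ z) {y : E} (hy : y ∈ O) (s : ℝ) (v : E) :
    resolvent (A y) s v - s ^ 2 • A y (A y (resolvent (A y) s v)) = v := by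
  have := congrArg (fun f : E →L[ℝ] E => f v) (H.resolventArg_mul hy s)
  simpa [resolventArg] using this

theorem resolvent_resolventArg (H : LocalPKY O g A Γ z) {y : E} (hy : y ∈ O) (s : ℝ) (v : E) :
    resolvent (A y) s (v - s ^ 2 • A y (A y v)) = v := by
  have := congrArg (fun f : E →L[ℝ] E => f v) (H.resolvent_mul hy s)
  simpa [resolventArg] using this

theorem resolvent_endo (H : LocalPKY O g A Γ z) {y : E} (hy : y ∈ O) (s : ℝ) (v : E) :
    resolvent (A y) s (A y v) = A y (resolvent (A y) s v) := by
  conv_lhs => rw [← H.resolvent_apply hy s v, map_sub, map_smul]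
  exact H.resolvent_resolventArg hy s _

theorem resolvent_symm (H : LocalPKY O g A Γ z) {y : E} (hy : y ∈ O) (s : ℝ) (u v : E) :
    g y (resolvent (A y) s u) v = g y u (resolvent (A y) s v) := by
  conv_lhs => rw [← H.resolvent_apply hy s v]
  conv_rhs => rw [← H.resolvent_apply hy s u]
  simp only [map_sub, map_smul, sub_apply, smul_apply]
  rw [← neg_neg (g y (resolvent (A y) s u) (A y (A y (resolvent (A y) s v)))), ← H.skew y hy,
    H.skew y hy (A y (resolvent (A y) s u))]

/-- Resolvent identity for `A²`; it is responsible for the cancellation of the terms with `z` in the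
bracket. -/
theorem resolvent_resolvent (H : LocalPKY O g A Γ z) {y : E} (hy : y ∈ O) (r s : ℝ) (v : E) :
    r ^ 2 • resolvent (A y) r v - s ^ 2 • resolvent (A y) s v =
      (r ^ 2 - s ^ 2) • resolvent (A y) r (resolvent (A y) s v) := by
  set w := resolvent (A y) s v with hw
  have h1 : v = w - s ^ 2 • A y (A y w) := (H.resolvent_apply hy s v).symm
  have h2 := H.resolvent_apply hy r w
  rw [h1, map_sub, map_smul, H.resolvent_endo hy, H.resolvent_endo hy]
  set p := resolvent (A y) r w
  rw [← h2]
  module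

theorem resolvent_comm (H : LocalPKY O g A Γ z) {y : E} (hy : y ∈ O) (r s : ℝ) (v : E) :
    resolvent (A y) r (resolvent (A y) s v) = resolvent (A y) s (resolvent (A y) r v) := by
  conv_rhs => rw [← H.resolvent_apply hy s v, map_sub, map_smul, H.resolvent_endo hy,
    H.resolvent_endo hy]
  exact (H.resolvent_resolventArg hy s _).symm

theorem genK_resolventArg (H : LocalPKY O g A Γ z) {y : E} (hy : y ∈ O) (s : ℝ) (u v : E) :
    genK (g y) (A y) s u (v - s ^ 2 • A y (A y v)) = detW (A y) s * g y u v := by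
  rw [genK, H.resolvent_resolventArg hy]

theorem smooth_resolvent (H : LocalPKY O g A Γ z) (s : ℝ) :
    ContDiffOn ℝ ∞ (fun y => resolvent (A y) s) O := by
  intro y hy
  have h1 : ContDiffWithinAt ℝ ∞ (fun y => resolventArg (A y) s) O y := by
    have := H.smooth_endo y hy
    unfold resolventArg
    exact contDiffWithinAt_const.sub ((this.mul this).const_smul _)
  obtain ⟨u, hu⟩ := H.isUnit_resolventArg hy s
  have h2 := contDiffAt_ringInverse ℝ (n := ∞) u
  rw [hu] at h2
  exact h2.comp_contDiffWithinAt y h1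

theorem smooth_detW (H : LocalPKY O g A Γ z) (s : ℝ) :
    ContDiffOn ℝ ∞ (fun y => detW (A y) s) O := by
  intro y hy
  have h1 : ContDiffWithinAt ℝ ∞ (fun y => (1 - s • A y : E →L[ℝ] E)) O y :=
    contDiffWithinAt_const.sub ((H.smooth_endo y hy).const_smul _)
  exact contDiff_det.contDiffAt.comp_contDiffWithinAt y h1

theorem smooth_genK (H : LocalPKY O g A Γ z) (s : ℝ) (u v : E) :
    ContDiffOn ℝ ∞ (fun y => genK (g y) (A y) s u v) O := by
  have h1 := (H.smooth_resolvent s).clm_apply (contDiffOn_const (c := v))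
  have h2 := (H.smooth_metric.clm_apply (contDiffOn_const (c := u))).clm_apply h1
  exact (H.smooth_detW s).mul h2

theorem genK_symm (H : LocalPKY O g A Γ z) {y : E} (hy : y ∈ O) (s : ℝ) (u v : E) :
    genK (g y) (A y) s u v = genK (g y) (A y) s v u := by
  rw [genK, genK, ← H.resolvent_symm hy, H.symm y hy]

/-- By Jacobi's formula the logarithmic derivative is `-s` times the trace of `(1 - s A)⁻¹ ∂_v A`.
The connection part of `∂_v A` is a commutator with `A` and has trace zero against a function of
`A`, so only the part of rank at most two built from `v` and `z` contributes. -/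
theorem fderiv_detW (H : LocalPKY O g A Γ z) {y : E} (hy : y ∈ O) (s : ℝ) (v : E) :
    fderiv ℝ (fun y => detW (A y) s) y v =
      -2 * s ^ 2 * detW (A y) s * g y (z y) (A y (resolvent (A y) s v)) := by
  set B := resolvent (A y) s with hB
  set N : E →L[ℝ] E := (1 + s • A y) * B with hN
  have hN1 : (1 - s • A y) * N = 1 := by
    have e : (1 - s • A y) * (1 + s • A y) = resolventArg (A y) s := by
      simp only [resolventArg, pow_two, sub_mul, mul_add, mul_one, one_mul, smul_mul_smul_comm]
      abel
    rw [hN, ← mul_assoc, e]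
    exact H.resolventArg_mul hy s
  have hN2 : N * (1 - s • A y) = 1 := by
    have hu : IsUnit (1 - s • A y : E →L[ℝ] E) := by
      rw [ContinuousLinearMap.isUnit_iff_bijective]
      have hsurj : Function.Surjective (1 - s • A y : E →L[ℝ] E) := fun v =>
        ⟨N v, congrArg (fun f : E →L[ℝ] E => f v) hN1⟩
      exact ⟨LinearMap.injective_iff_surjective
        (f := ((1 - s • A y : E →L[ℝ] E) : E →ₗ[ℝ] E)).2 hsurj, hsurj⟩
    have := hu.mul_left_cancel (b := N * (1 - s • A y)) (c := 1) (by
      rw [← mul_assoc, hN1, one_mul, mul_one])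
    exact this
  have hA := (H.differentiableAt_endo hy).hasFDerivAt
  have h1 : HasFDerivAt (fun y => (1 - s • A y : E →L[ℝ] E)) (-(s • fderiv ℝ A y)) y := by
    simpa using (hA.const_smul s).const_sub 1
  have h2 := ((contDiff_det (E := E)).differentiable (by simp) (1 - s • A y)).hasFDerivAt.comp y h1
  have h3 : fderiv ℝ (fun y => detW (A y) s) y v = fderiv ℝ
      (fun f : E →L[ℝ] E => LinearMap.det (f : E →ₗ[ℝ] E)) (1 - s • A y)
        (-(s • fderiv ℝ A y v)) := by
    have := h2.fderiv
    exact congrArg (fun f : E →L[ℝ] ℝ => f v) this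
  rw [h3, fderiv_det hN1]
  have h4 : fderiv ℝ A y v = A y * Γ y v - Γ y v * A y +
      ((g y (z y)).smulRight v - (g y v).smulRight (z y)) := by
    ext u
    simp [H.deriv_endo y hy v u, add_sub_assoc]
  -- Both products are `(N - 1) / s` because `N` is a two-sided inverse; this needs `s ≠ 0`, and for
  -- `s = 0` one has `N = 1`.
  have hcomm : A y * N = N * A y := by
    have e1 : s • (A y * N) = N - 1 := by
      rw [← hN1, sub_mul, one_mul, smul_mul_assoc]; abel
    have e2 : s • (N * A y) = N - 1 := by
      rw [← hN2, mul_sub, mul_one, mul_smul_comm]; abel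
    by_cases hs : s = 0
    · have : N = 1 := by simpa [hs] using hN1
      rw [this, one_mul, mul_one]
    · exact smul_right_injective _ hs (e1.trans e2.symm)
  have h5 : LinearMap.trace ℝ E ((N * (A y * Γ y v - Γ y v * A y) : E →L[ℝ] E) : E →ₗ[ℝ] E) = 0 := by
    have : N * (A y * Γ y v - Γ y v * A y) = A y * (N * Γ y v) - (N * Γ y v) * A y := by
      rw [mul_sub, ← mul_assoc, ← mul_assoc, ← mul_assoc, hcomm]
    rw [this]
    have h6 := LinearMap.trace_mul_comm ℝ (A y : E →ₗ[ℝ] E) ((N * Γ y v : E →L[ℝ] E) : E →ₗ[ℝ] E)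
    change LinearMap.trace ℝ E ((A y : E →ₗ[ℝ] E) * ((N * Γ y v : E →L[ℝ] E) : E →ₗ[ℝ] E) -
      ((N * Γ y v : E →L[ℝ] E) : E →ₗ[ℝ] E) * (A y : E →ₗ[ℝ] E)) = 0
    rw [map_sub, h6, sub_self]
  have h6 : LinearMap.trace ℝ E ((N * ((g y (z y)).smulRight v - (g y v).smulRight (z y)) :
      E →L[ℝ] E) : E →ₗ[ℝ] E) = g y (z y) (N v) - g y v (N (z y)) := by
    have : ((N * ((g y (z y)).smulRight v - (g y v).smulRight (z y)) : E →L[ℝ] E) : E →ₗ[ℝ] E) =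
        (g y (z y) : E →ₗ[ℝ] ℝ).smulRight (N v) - (g y v : E →ₗ[ℝ] ℝ).smulRight (N (z y)) := by
      ext u
      simp
    rw [this, map_sub, LinearMap.trace_smulRight, LinearMap.trace_smulRight]
    rfl
  -- Of `N = (1 + s A) B` the part `B` is symmetric and cancels in the difference, while `s A B` is
  -- skew and doubles.
  have h7 : g y (z y) (N v) - g y v (N (z y)) = 2 * s * g y (z y) (A y (B v)) := by
    have e1 : g y v (B (z y)) = g y (z y) (B v) := by
      rw [← H.resolvent_symm hy, H.symm y hy]
    have e2 : g y v (A y (B (z y))) = -g y (z y) (A y (B v)) := by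
      rw [← neg_eq_iff_eq_neg, ← H.skew y hy, ← H.resolvent_symm hy, H.resolvent_endo hy,
        H.symm y hy]
    simp only [hN, mul_apply_eq_comp, add_apply, one_apply_eq_self,
      smul_apply, map_add, map_smul, e1, e2, smul_eq_mul]
    ring
  have h8 : LinearMap.trace ℝ E ((N * (-(s • fderiv ℝ A y v)) : E →L[ℝ] E) : E →ₗ[ℝ] E) =
      -s * (2 * s * g y (z y) (A y (B v))) := by
    rw [h4]
    have e : ((N * (-(s • (A y * Γ y v - Γ y v * A y +
        ((g y (z y)).smulRight v - (g y v).smulRight (z y)))))  : E →L[ℝ] E) : E →ₗ[ℝ] E) =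
        (-s) • (((N * (A y * Γ y v - Γ y v * A y) : E →L[ℝ] E) : E →ₗ[ℝ] E) +
        ((N * ((g y (z y)).smulRight v - (g y v).smulRight (z y)) : E →L[ℝ] E) : E →ₗ[ℝ] E)) := by
      ext u
      simp only [ContinuousLinearMap.coe_coe, mul_apply_eq_comp, neg_apply, smul_apply,
        add_apply, LinearMap.smul_apply, LinearMap.add_apply, map_neg, map_smul, map_add]
      module
    rw [e, map_smul, map_add, h5, h6, h7]
    simp
  rw [h8]
  change detW (A y) s * _ = _
  ring

end LocalPKY

end Resolvent

end TorsionKY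

/-! ### Killing equation and bracket for the generating function -/

namespace TorsionKY

/-- The torsion `Γ(u, v) - Γ(v, u)`. -/
noncomputable def torsionVec {E : Type*} [NormedAddCommGroup E] [NormedSpace ℝ E] (Γ : E →L[ℝ] E →L[ℝ] E)
    (u v : E) : E := Γ u v - Γ v u

/-- The symmetric part of a connection, i.e. the Levi-Civita connection if the torsion is totally
antisymmetric. -/
noncomputable def symConn {E : Type*} [NormedAddCommGroup E] [NormedSpace ℝ E]
    (Γ : E →L[ℝ] E →L[ℝ] E) (u v : E) : E := (1 / 2 : ℝ) • (Γ u v + Γ v u)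

theorem torsionVec_swap {E : Type*} [NormedAddCommGroup E] [NormedSpace ℝ E]
    (Γ₀ : E →L[ℝ] E →L[ℝ] E) (u v : E) :
    torsionVec Γ₀ u v = -torsionVec Γ₀ v u := by simp [torsionVec]

namespace LocalPKY

variable {E : Type*} [NormedAddCommGroup E] [NormedSpace ℝ E]
  {O : Set E} {g : E → E →L[ℝ] E →L[ℝ] ℝ} {A : E → E →L[ℝ] E}
  {Γ : E → E →L[ℝ] E →L[ℝ] E} {z : E → E}

theorem torsion_swap (H : LocalPKY O g A Γ z) {y : E} (hy : y ∈ O) (u v w : E) :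
    g y (torsionVec (Γ y) u v) w = -g y (torsionVec (Γ y) u w) v := H.torsion y hy u v w

variable [FiniteDimensional ℝ E]

/-- Obtained by differentiating `(1 - s² A²) B_s u = u`, which holds on all of `O`, and applying
`B_s` again. -/
theorem fderiv_resolvent (H : LocalPKY O g A Γ z) {y : E} (hy : y ∈ O) (s : ℝ) (w u : E) :
    fderiv ℝ (fun y => resolvent (A y) s) y w u =
      s ^ 2 • resolvent (A y) s (fderiv ℝ A y w (A y (resolvent (A y) s u)) +
        A y (fderiv ℝ A y w (resolvent (A y) s u))) := by
  have hd := ((H.smooth_resolvent s).contDiffAt (H.isOpen.mem_nhds hy)).differentiableAt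
    (by simp)
  have hA := H.differentiableAt_endo hy
  have hf := hd.hasFDerivAt.clm_apply (hasFDerivAt_const u y)
  have h1 : HasFDerivAt (fun y => resolvent (A y) s u -
      s ^ 2 • A y (A y (resolvent (A y) s u))) (0 : E →L[ℝ] E) y := by
    refine (hasFDerivAt_const u y).congr_of_eventuallyEq ?_
    filter_upwards [H.isOpen.mem_nhds hy] with x hx
    exact H.resolvent_apply hx s u
  have h3 := (hf.sub ((hA.hasFDerivAt.clm_apply (hA.hasFDerivAt.clm_apply hf)).const_smul
    (s ^ 2))).unique h1
  have h4 := congrArg (fun f : E →L[ℝ] E => f w) h3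
  set B' := fderiv ℝ (fun y => resolvent (A y) s) y
  simp only [add_apply, sub_apply, smul_apply, ContinuousLinearMap.comp_apply,
    ContinuousLinearMap.flip_apply, zero_apply, map_zero, zero_add, map_add] at h4
  have h5 : resolventArg (A y) s (B' w u) = s ^ 2 • (fderiv ℝ A y w (A y (resolvent (A y) s u)) +
        A y (fderiv ℝ A y w (resolvent (A y) s u))) := by
    simp only [resolventArg, sub_apply, smul_apply, mul_apply_eq_comp, one_apply_eq_self]
    rw [← sub_eq_zero, ← h4]
    module
  have h6 := congrArg (fun f : E →L[ℝ] E => f (B' w u)) (H.resolvent_mul hy s)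
  simp only [mul_apply_eq_comp, one_apply_eq_self, h5, map_smul] at h6
  exact h6.symm

/-- The left side is the covariant derivative along `w`, with torsion, of `K_s` on `(u, u)`.
Compatibility with the metric and the commutator part of `∂A` remove every connection coefficient;
what remains comes from `z`, through `W_s` and through `B_s`. -/
theorem fderiv_genK (H : LocalPKY O g A Γ z) {y : E} (hy : y ∈ O) (s : ℝ) (w u : E) :
    fderiv ℝ (fun y => genK (g y) (A y) s u u) y w - 2 * genK (g y) (A y) s (Γ y w u) u =
      2 * s ^ 2 * detW (A y) s *
        (g y (z y) (A y (resolvent (A y) s u)) * g y w (resolvent (A y) s u) -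
          g y (z y) (A y (resolvent (A y) s w)) * g y u (resolvent (A y) s u) -
          g y (z y) (resolvent (A y) s u) * g y w (A y (resolvent (A y) s u))) := by
  have hB := ((H.smooth_resolvent s).contDiffAt (H.isOpen.mem_nhds hy)).differentiableAt (by simp)
  have hW := ((H.smooth_detW s).contDiffAt (H.isOpen.mem_nhds hy)).differentiableAt (by simp)
  have hg := H.differentiableAt_metric hy
  have h1 : HasFDerivAt (fun y => genK (g y) (A y) s u u) _ y :=
    hW.hasFDerivAt.mul ((hg.hasFDerivAt.clm_apply (hasFDerivAt_const u y)).clm_apply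
      (hB.hasFDerivAt.clm_apply (hasFDerivAt_const u y)))
  rw [h1.fderiv]
  have h2 : ∀ a b : E, g y a (resolvent (A y) s b) = g y (resolvent (A y) s a) b := fun a b =>
    (H.resolvent_symm hy s a b).symm
  set B := resolvent (A y) s with hBdef
  have h3 : g y u (fderiv ℝ (fun y => resolvent (A y) s) y w u) =
      s ^ 2 * (2 * (g y (z y) (A y (B u)) * g y w (B u) - g y (z y) (B u) * g y w (A y (B u)))) +
        (g y (Γ y w u) (B u) - g y u (Γ y w (B u))) := by
    rw [H.fderiv_resolvent hy, map_smul, h2]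
    set p := B u with hp
    -- Replacing `s² A² p` by `p - u` makes the connection terms telescope, in `e2` and `e3`.
    have e0 : s ^ 2 • A y (A y p) = p - u := by
      rw [← H.resolvent_apply hy s u, ← hBdef, ← hp]; abel
    rw [H.deriv_endo y hy, H.deriv_endo y hy]
    simp only [map_add, map_sub, map_smul, smul_eq_mul]
    have e1 : g y p (A y (z y)) = -g y (z y) (A y p) := by
      rw [← H.skew y hy, H.symm y hy]
    have e2 : s ^ 2 * g y p (A y (A y (Γ y w p))) = g y p (Γ y w p) - g y u (Γ y w p) := by
      have := congrArg (fun q => g y q (Γ y w p)) e0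
      simp only [map_smul, map_sub, smul_apply, sub_apply, smul_eq_mul] at this
      rw [← this, H.skew y hy, H.skew y hy]
      ring
    have e3 : s ^ 2 * g y p (Γ y w (A y (A y p))) = g y p (Γ y w p) - g y p (Γ y w u) := by
      have := congrArg (fun q => g y p (Γ y w q)) e0
      simpa only [map_smul, map_sub, smul_eq_mul] using this
    have e4 : g y p w = g y w p := H.symm y hy _ _
    have e5 : g y p (Γ y w u) = g y (Γ y w u) p := H.symm y hy _ _
    have e6 : g y p (z y) = g y (z y) p := H.symm y hy _ _
    have e7 : g y p (A y w) = -g y w (A y p) := by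
      rw [← H.skew y hy, H.symm y hy]
    rw [e1, e4, e6, e7]
    rw [e5] at e3
    linear_combination e2 - e3
  simp only [add_apply, smul_apply, ContinuousLinearMap.comp_apply, smul_eq_mul, H.fderiv_detW hy,
    ContinuousLinearMap.flip_apply, zero_apply, map_zero, zero_add]
  simp only [h3, H.compat y hy, genK]
  ring

/-- This is the Killing equation. For `w = u` the first two terms of `fderiv_genK` cancel and the
third vanishes because `A B_s` is skew. The torsion does not contribute, since `Γ(u, u)` only
involves the symmetric part of the connection. -/
theorem fderiv_genK_self (H : LocalPKY O g A Γ z) {y : E} (hy : y ∈ O) (s : ℝ) (u : E) :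
    fderiv ℝ (fun y => genK (g y) (A y) s u u) y u =
      2 * genK (g y) (A y) s (symConn (Γ y) u u) u := by
  have h := H.fderiv_genK hy s u u
  have h1 : g y u (A y (resolvent (A y) s u)) = 0 := by
    rw [← H.resolvent_endo hy, ← H.resolvent_symm hy]
    have h2 := H.resolvent_symm hy s (resolvent (A y) s u) (A y u)
    have h3 := H.skew y hy u (resolvent (A y) s u)
    rw [← H.resolvent_endo hy, H.symm y hy, H.resolvent_symm hy] at h3
    have h4 := H.resolvent_symm hy s u (A y u)
    have h5 := H.symm y hy u (resolvent (A y) s (A y u))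
    have h6 := H.resolvent_symm hy s (A y u) u
    linarith
  have h2 : symConn (Γ y) u u = Γ y u u := by simp [symConn]; module
  rw [h1] at h
  rw [h2]
  linarith

/-- The first term of the Schouten–Nijenhuis bracket of the Killing tensors `genK s`, `genK r`,
evaluated on `u, u, u`. -/
noncomputable def bracketTerm (g : E → E →L[ℝ] E →L[ℝ] ℝ) (A : E → E →L[ℝ] E)
    (Γ : E → E →L[ℝ] E →L[ℝ] E) (y : E) (s r : ℝ) (u : E) : ℝ :=
  fderiv ℝ (fun y => genK (g y) (A y) r u u) y (detW (A y) s • resolvent (A y) s u) -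
    2 * genK (g y) (A y) r (symConn (Γ y) (detW (A y) s • resolvent (A y) s u) u) u

/-- The direction is `w = B_s u` in `fderiv_genK`, where one term vanishes because `B_s A B_r` is
skew. Replacing `Γ` by its symmetric part subtracts half the torsion in each of two equal slots, so
the torsion term has coefficient one. -/
theorem bracketTerm_eq (H : LocalPKY O g A Γ z) {y : E} (hy : y ∈ O) (s r : ℝ) (u : E) :
    bracketTerm g A Γ y s r u = detW (A y) s * detW (A y) r *
      (2 * (r ^ 2 * g y (z y) (A y (resolvent (A y) r u)) *
        g y u (resolvent (A y) s (resolvent (A y) r u)) -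
        r ^ 2 * g y (z y) (A y (resolvent (A y) r (resolvent (A y) s u))) *
          g y u (resolvent (A y) r u)) +
      g y (torsionVec (Γ y) (resolvent (A y) s u) u) (resolvent (A y) r u)) := by
  set Y := resolvent (A y) s u with hY
  have h := H.fderiv_genK hy r Y u
  have h1 : g y Y (A y (resolvent (A y) r u)) = 0 := by
    have e : resolvent (A y) r u = u + r ^ 2 • A y (A y (resolvent (A y) r u)) := by
      have := H.resolvent_apply hy r u
      exact (eq_add_of_sub_eq this)
    have key : ∀ a b : E, g y a (A y b) = -g y b (A y a) := fun a b => by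
      rw [← H.skew y hy, H.symm y hy]
    have h2 := key (resolvent (A y) s u) (resolvent (A y) r u)
    have h3 : g y (resolvent (A y) r u) (A y (resolvent (A y) s u)) =
        g y (resolvent (A y) s u) (A y (resolvent (A y) r u)) := by
      rw [← H.resolvent_endo hy, ← H.resolvent_endo hy, H.resolvent_symm hy,
        H.resolvent_symm hy, H.resolvent_comm hy]
    linarith
  have h2 : g y Y (resolvent (A y) r u) = g y u (resolvent (A y) s (resolvent (A y) r u)) := by
    rw [hY, H.resolvent_symm hy]
  have h3 : symConn (Γ y) (detW (A y) s • Y) u =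
      detW (A y) s • (Γ y Y u - (1 / 2 : ℝ) • torsionVec (Γ y) Y u) := by
    simp only [symConn, torsionVec, map_smul, smul_apply]
    module
  have h4 : genK (g y) (A y) r (symConn (Γ y) (detW (A y) s • Y) u) u =
      detW (A y) s * (genK (g y) (A y) r (Γ y Y u) u - (1 / 2) *
        (detW (A y) r * g y (torsionVec (Γ y) Y u) (resolvent (A y) r u))) := by
    rw [h3]
    simp only [genK, map_smul, map_sub, smul_apply, sub_apply, smul_eq_mul]
    ring
  rw [bracketTerm, ← hY, h4, map_smul, smul_eq_mul]
  rw [h1, h2] at h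
  linear_combination detW (A y) s * h

/-- After exchanging `s` and `r` and subtracting, the terms with `z` cancel by the resolvent
identity. The torsion terms, by total antisymmetry, add up. -/
theorem bracketTerm_sub (H : LocalPKY O g A Γ z) {y : E} (hy : y ∈ O) (s r : ℝ) (u : E) :
    bracketTerm g A Γ y s r u - bracketTerm g A Γ y r s u = 2 * (detW (A y) s * detW (A y) r *
      g y (torsionVec (Γ y) (resolvent (A y) s u) u) (resolvent (A y) r u)) := by
  rw [H.bracketTerm_eq hy, H.bracketTerm_eq hy, H.resolvent_comm hy s r]
  have h1 := H.resolvent_resolvent hy r s u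
  have h2 := congrArg (fun v => g y (z y) (A y v)) h1
  have h3 := congrArg (fun v => g y u v) h1
  simp only [map_sub, map_smul, smul_eq_mul] at h2 h3
  have h4 : g y (torsionVec (Γ y) (resolvent (A y) r u) u) (resolvent (A y) s u) =
      -g y (torsionVec (Γ y) (resolvent (A y) s u) u) (resolvent (A y) r u) := by
    rw [torsionVec_swap, map_neg, neg_apply, H.torsion_swap hy, torsionVec_swap, map_neg,
      neg_apply, H.torsion_swap hy]
    ring
  rw [h4]
  linear_combination detW (A y) s * detW (A y) r * 2 *
    (g y u (resolvent (A y) r (resolvent (A y) s u)) * h2 -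
      g y (z y) (A y (resolvent (A y) r (resolvent (A y) s u))) * h3)

end LocalPKY

end TorsionKY

/-! ### Brackets of eigenvector fields and torsion components with a gradient -/

namespace TorsionKY

theorem minSmoothness_le_infty : minSmoothness ℝ 2 ≤ (∞ : WithTop ℕ∞) := by
  rw [minSmoothness_of_isRCLikeNormedField]
  exact ENat.LEInfty.out

variable {E : Type*} [NormedAddCommGroup E] [NormedSpace ℝ E]

/-- The covariant derivative of the vector field `Y` in direction `w`. -/
noncomputable def covDeriv (Γ : E → E →L[ℝ] E →L[ℝ] E) (Y : E → E) (y w : E) : E :=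
  fderiv ℝ Y y w + Γ y w (Y y)

/-- The squared eigenvalues of the hatted frame vectors. -/
def eigSq {n ε : ℕ} (x : Fin n → E → ℝ) : Fin n ⊕ Fin ε → E → ℝ :=
  Sum.elim (fun μ y => x μ y ^ 2) (fun _ _ => 0)

/-- A smooth orthogonal frame adapted to `A`: `N μ` is the gradient of
`x μ`, the remaining `F` are orthonormal and `A` exchanges `N μ` and `F (inl μ)`. -/
structure AdaptedFrame {n ε : ℕ} (O : Set E) (g : E → E →L[ℝ] E →L[ℝ] ℝ) (A : E → E →L[ℝ] E)
    (z : E → E) (x q : Fin n → E → ℝ) (N : Fin n → E → E) (F : Fin n ⊕ Fin ε → E → E) :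
    Prop where
  smooth_x : ∀ μ, ContDiffOn ℝ ∞ (x μ) O
  smooth_N : ∀ μ, ContDiffOn ℝ ∞ (N μ) O
  smooth_F : ∀ i, ContDiffOn ℝ ∞ (F i) O
  x_ne : ∀ y ∈ O, ∀ μ, x μ y ≠ 0
  q_pos : ∀ y ∈ O, ∀ μ, 0 < q μ y
  inner_NN_self : ∀ y ∈ O, ∀ μ, g y (N μ y) (N μ y) = q μ y ^ 2
  grad : ∀ y ∈ O, ∀ μ v, fderiv ℝ (x μ) y v = g y (N μ y) v
  inner_NN : ∀ y ∈ O, ∀ μ ν, μ ≠ ν → g y (N μ y) (N ν y) = 0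
  inner_FF : ∀ y ∈ O, ∀ i j, g y (F i y) (F j y) = if i = j then 1 else 0
  inner_NF : ∀ y ∈ O, ∀ μ i, g y (N μ y) (F i y) = 0
  inner_zN : ∀ y ∈ O, ∀ μ, g y (z y) (N μ y) = 0
  inner_zF : ∀ y ∈ O, ∀ μ, g y (z y) (F (.inl μ) y) = q μ y
  endo_N : ∀ y ∈ O, ∀ μ, A y (N μ y) = -(x μ y * q μ y) • F (.inl μ) y
  endo_F : ∀ y ∈ O, ∀ μ, A y (F (.inl μ) y) = (x μ y / q μ y) • N μ y
  endo_F_inr : ∀ y ∈ O, ∀ a, A y (F (.inr a) y) = 0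
  complete : ∀ y ∈ O, ∀ v, (∀ i, g y (F i y) v = 0) → (∀ μ, g y (N μ y) v = 0) → v = 0

/-- An adapted frame on a set where the eigenvalues of `A²` are distinct. -/
structure LocalFrame {n ε : ℕ} (O : Set E) (g : E → E →L[ℝ] E →L[ℝ] ℝ) (A : E → E →L[ℝ] E)
    (z : E → E) (x q : Fin n → E → ℝ) (N : Fin n → E → E) (F : Fin n ⊕ Fin ε → E → E) : Prop
    extends AdaptedFrame O g A z x q N F where
  eig_inj : ∀ y ∈ O, Function.Injective fun i : Fin n ⊕ Fin ε => eigSq x i y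

variable {O : Set E} {g : E → E →L[ℝ] E →L[ℝ] ℝ} {A : E → E →L[ℝ] E}
  {Γ : E → E →L[ℝ] E →L[ℝ] E} {z : E → E}

namespace LocalPKY

theorem fderiv_inner (H : LocalPKY O g A Γ z) {y : E} (hy : y ∈ O) {U V : E → E}
    (hU : DifferentiableAt ℝ U y) (hV : DifferentiableAt ℝ V y) (w : E) :
    fderiv ℝ (fun y => g y (U y) (V y)) y w =
      g y (covDeriv Γ U y w) (V y) + g y (U y) (covDeriv Γ V y w) := by
  have h1 := ((H.differentiableAt_metric hy).hasFDerivAt.clm_apply hU.hasFDerivAt).clm_apply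
    hV.hasFDerivAt
  rw [h1.fderiv]
  simp only [add_apply, ContinuousLinearMap.comp_apply, ContinuousLinearMap.flip_apply,
    H.compat y hy, covDeriv, map_add]
  ring

theorem lieBracket_eq (Γ : E → E →L[ℝ] E →L[ℝ] E) (U V : E → E) (y : E) :
    VectorField.lieBracket ℝ U V y = covDeriv Γ V y (U y) - covDeriv Γ U y (V y) -
      torsionVec (Γ y) (U y) (V y) := by
  simp only [VectorField.lieBracket, covDeriv, torsionVec]
  abel

/-- The component of the covariant derivative of an eigenvector field of `A²` along a different
eigenspace. -/
theorem inner_covDeriv_eigen (H : LocalPKY O g A Γ z) {y : E} (hy : y ∈ O) {Y : E → E} {e : E → ℝ}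
    (hY : DifferentiableAt ℝ Y y) (he : DifferentiableAt ℝ e y)
    (hYe : ∀ y ∈ O, A y (A y (Y y)) = -e y • Y y) {w : E} {f : ℝ} (hw : A y (A y w) = -f • w)
    (hYw : g y w (Y y) = 0) (v : E) :
    (f - e y) * g y w (covDeriv Γ Y y v) =
      g y (z y) (A y (Y y)) * g y v w - g y v (A y (Y y)) * g y (z y) w -
        g y (z y) (Y y) * g y v (A y w) + g y v (Y y) * g y (z y) (A y w) := by
  have hA := (H.differentiableAt_endo hy).hasFDerivAt
  have h1 := hA.clm_apply (hA.clm_apply hY.hasFDerivAt)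
  -- Both sides of `A² Y = -e Y` are differentiated and paired with `w`. The derivative of `e` drops
  -- out by `hYw`, and moving `A²` onto `w` produces the factor `f - e`.
  have h2 := (he.hasFDerivAt.fun_neg.fun_smul hY.hasFDerivAt).congr_of_eventuallyEq
    (f₁ := fun y => A y (A y (Y y)))
    (Filter.eventuallyEq_of_mem (H.isOpen.mem_nhds hy) fun p hp => hYe p hp)
  have h3 := congrArg (fun f : E →L[ℝ] E => g y w (f v)) (h1.unique h2)
  simp only [add_apply, ContinuousLinearMap.comp_apply, ContinuousLinearMap.flip_apply,
    H.deriv_endo y hy, map_add, map_sub, map_smul, smul_eq_mul, smul_apply,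
    ContinuousLinearMap.smulRight_apply, neg_apply, hYw, hYe y hy, map_neg, neg_smul] at h3
  have key : ∀ a b : E, g y a (A y b) = -g y (A y a) b := fun a b => by
    rw [H.skew y hy, neg_neg]
  have h4 : ∀ b : E, g y w (A y (A y b)) = -f * g y w b := by
    intro b
    rw [key, key, neg_neg, hw, map_smul, smul_apply, smul_eq_mul]
  rw [h4, h4] at h3
  have h5 : g y w (A y v) = - g y v (A y w) := by rw [key, H.symm y hy]
  have h6 : g y w (A y (z y)) = - g y (z y) (A y w) := by rw [key, H.symm y hy]
  have h7 : g y w v = g y v w := H.symm y hy _ _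
  have h8 : g y w (z y) = g y (z y) w := H.symm y hy _ _
  rw [h5, h6, h7, h8] at h3
  simp only [covDeriv, map_add]
  linear_combination -h3

end LocalPKY

namespace LocalFrame

variable {n ε : ℕ} {x q : Fin n → E → ℝ} {N : Fin n → E → E} {F : Fin n ⊕ Fin ε → E → E}

theorem endo_endo_F (L : LocalFrame O g A z x q N F) {y : E} (hy : y ∈ O)
    (i : Fin n ⊕ Fin ε) : A y (A y (F i y)) = -eigSq x i y • F i y := by
  rcases i with μ | a
  · rw [L.endo_F y hy, map_smul, L.endo_N y hy, smul_smul]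
    have := (L.q_pos y hy μ).ne'
    congr 1
    simp only [eigSq, Sum.elim_inl]
    field_simp
  · simp [L.endo_F_inr y hy, eigSq]

theorem endo_endo_N (L : LocalFrame O g A z x q N F) {y : E} (hy : y ∈ O)
    (μ : Fin n) : A y (A y (N μ y)) = -(x μ y ^ 2) • N μ y := by
  rw [L.endo_N y hy, map_smul, L.endo_F y hy, smul_smul]
  have := (L.q_pos y hy μ).ne'
  congr 1
  field_simp

theorem differentiableAt_F (H : LocalPKY O g A Γ z) (L : LocalFrame O g A z x q N F) {y : E}
    (hy : y ∈ O) (i : Fin n ⊕ Fin ε) : DifferentiableAt ℝ (F i) y :=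
  ((L.smooth_F i).contDiffAt (H.isOpen.mem_nhds hy)).differentiableAt (by simp)

theorem differentiableAt_N (H : LocalPKY O g A Γ z) (L : LocalFrame O g A z x q N F) {y : E}
    (hy : y ∈ O) (μ : Fin n) : DifferentiableAt ℝ (N μ) y :=
  ((L.smooth_N μ).contDiffAt (H.isOpen.mem_nhds hy)).differentiableAt (by simp)

theorem differentiableAt_x (H : LocalPKY O g A Γ z) (L : LocalFrame O g A z x q N F) {y : E}
    (hy : y ∈ O) (μ : Fin n) : DifferentiableAt ℝ (x μ) y :=
  ((L.smooth_x μ).contDiffAt (H.isOpen.mem_nhds hy)).differentiableAt (by simp)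

theorem differentiableAt_eigSq (H : LocalPKY O g A Γ z) (L : LocalFrame O g A z x q N F) {y : E}
    (hy : y ∈ O) (i : Fin n ⊕ Fin ε) : DifferentiableAt ℝ (eigSq x i) y := by
  rcases i with μ | a
  · exact (L.differentiableAt_x H hy μ).pow 2
  · exact differentiableAt_const 0

theorem inner_F_endo_F (H : LocalPKY O g A Γ z) (L : LocalFrame O g A z x q N F) {y : E}
    (hy : y ∈ O) (i j : Fin n ⊕ Fin ε) : g y (F i y) (A y (F j y)) = 0 := by
  rcases j with μ | a
  · rw [L.endo_F y hy, map_smul, H.symm y hy, L.inner_NF y hy, smul_zero]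
  · rw [L.endo_F_inr y hy, map_zero]

theorem inner_z_endo_F (L : LocalFrame O g A z x q N F) {y : E}
    (hy : y ∈ O) (j : Fin n ⊕ Fin ε) : g y (z y) (A y (F j y)) = 0 := by
  rcases j with μ | a
  · rw [L.endo_F y hy, map_smul, L.inner_zN y hy, smul_zero]
  · rw [L.endo_F_inr y hy, map_zero]

theorem inner_N_endo_F (L : LocalFrame O g A z x q N F) {y : E}
    (hy : y ∈ O) {μ : Fin n} {j : Fin n ⊕ Fin ε} (h : j ≠ .inl μ) :
    g y (N μ y) (A y (F j y)) = 0 := by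
  rcases j with ν | a
  · rw [L.endo_F y hy, map_smul, L.inner_NN y hy _ _ (fun e => h (by rw [e])), smul_zero]
  · rw [L.endo_F_inr y hy, map_zero]

/-- The covariant derivative of a hatted frame field along another one has no hatted
components. -/
theorem inner_F_covDeriv_F (H : LocalPKY O g A Γ z) (L : LocalFrame O g A z x q N F) {y : E}
    (hy : y ∈ O) (i j k : Fin n ⊕ Fin ε) : g y (F k y) (covDeriv Γ (F j) y (F i y)) = 0 := by
  by_cases hkj : k = j
  · subst hkj
    have h1 := H.fderiv_inner hy (L.differentiableAt_F H hy k) (L.differentiableAt_F H hy k) (F i y)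
    have h2 : fderiv ℝ (fun y => g y (F k y) (F k y)) y = 0 := by
      refine ((hasFDerivAt_const (1 : ℝ) y).congr_of_eventuallyEq ?_).fderiv
      filter_upwards [H.isOpen.mem_nhds hy] with p hp
      simp [L.inner_FF p hp]
    rw [h2, H.symm y hy (covDeriv Γ (F k) y (F i y))] at h1
    simp only [zero_apply] at h1
    linarith
  · have h1 := H.inner_covDeriv_eigen hy (L.differentiableAt_F H hy j)
      (L.differentiableAt_eigSq H hy j) (fun y hy => L.endo_endo_F hy j) (L.endo_endo_F hy k)
      (by simp [L.inner_FF y hy, hkj]) (F i y)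
    rw [L.inner_z_endo_F hy, L.inner_F_endo_F H hy, L.inner_F_endo_F H hy,
      L.inner_z_endo_F hy] at h1
    have h2 : eigSq x k y - eigSq x j y ≠ 0 := sub_ne_zero.2 fun h => hkj (L.eig_inj y hy h)
    simpa [h2] using h1

/-- Consequently the structure functions of the hatted fields are, up to sign, torsion components
and hence totally antisymmetric. -/
theorem inner_F_lieBracket (H : LocalPKY O g A Γ z) (L : LocalFrame O g A z x q N F) {y : E}
    (hy : y ∈ O) (i j k : Fin n ⊕ Fin ε) :
    g y (F k y) (VectorField.lieBracket ℝ (F i) (F j) y) =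
      -g y (torsionVec (Γ y) (F i y) (F j y)) (F k y) := by
  rw [LocalPKY.lieBracket_eq Γ, map_sub, map_sub, L.inner_F_covDeriv_F H hy,
    L.inner_F_covDeriv_F H hy, H.symm y hy (F k y)]
  ring

/-- The bracket of two fields along which `dx_μ` is constant is annihilated by `dx_μ`. -/
theorem inner_N_lieBracket [FiniteDimensional ℝ E] (H : LocalPKY O g A Γ z)
    (L : LocalFrame O g A z x q N F) {y : E}
    (hy : y ∈ O) (μ : Fin n) {U V : E → E} (hU : DifferentiableAt ℝ U y)
    (hV : DifferentiableAt ℝ V y) {c d : ℝ} (hUc : ∀ y ∈ O, g y (N μ y) (U y) = c)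
    (hVd : ∀ y ∈ O, g y (N μ y) (V y) = d) :
    g y (N μ y) (VectorField.lieBracket ℝ U V y) = 0 := by
  rw [← L.grad y hy, VectorField.fderiv_apply_lieBracket
    ((L.smooth_x μ).contDiffAt (H.isOpen.mem_nhds hy)) minSmoothness_le_infty hV hU]
  have h : ∀ {W : E → E} {a : ℝ}, (∀ y ∈ O, g y (N μ y) (W y) = a) →
      fderiv ℝ (fun y => fderiv ℝ (x μ) y (W y)) y = 0 := by
    intro W a hW
    refine ((hasFDerivAt_const a y).congr_of_eventuallyEq ?_).fderiv
    filter_upwards [H.isOpen.mem_nhds hy] with p hp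
    rw [L.grad p hp, hW p hp]
  rw [h hUc, h hVd]
  simp

/-- The torsion has no component with one unhatted vector and two vectors of other blocks. -/
theorem torsion_N [FiniteDimensional ℝ E] (H : LocalPKY O g A Γ z)
    (L : LocalFrame O g A z x q N F) {y : E}
    (hy : y ∈ O) (μ : Fin n) {U V : E → E} {e f : E → ℝ} (hU : DifferentiableAt ℝ U y)
    (hV : DifferentiableAt ℝ V y) (he : DifferentiableAt ℝ e y) (hf : DifferentiableAt ℝ f y)
    (hUe : ∀ y ∈ O, A y (A y (U y)) = -e y • U y) (hVf : ∀ y ∈ O, A y (A y (V y)) = -f y • V y)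
    (hμe : x μ y ^ 2 ≠ e y) (hμf : x μ y ^ 2 ≠ f y)
    (hNU : ∀ y ∈ O, g y (N μ y) (U y) = 0) (hNV : ∀ y ∈ O, g y (N μ y) (V y) = 0)
    (hUV : g y (U y) (V y) = 0) (hUAV : g y (U y) (A y (V y)) = 0)
    (hUAN : g y (U y) (A y (N μ y)) = 0) (hVAN : g y (V y) (A y (N μ y)) = 0) :
    g y (torsionVec (Γ y) (U y) (V y)) (N μ y) = 0 := by
  -- The bracket of `U` and `V` has no component along `N μ`, and neither have the two covariant
  -- derivatives, by the eigenvalue equations `h2`, `h3`. The torsion is what remains of the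
  -- bracket.
  have h1 := L.inner_N_lieBracket H hy μ hU hV hNU hNV
  have h2 := H.inner_covDeriv_eigen hy hV hf hVf (L.endo_endo_N hy μ) (hNV y hy) (U y)
  have h3 := H.inner_covDeriv_eigen hy hU he hUe (L.endo_endo_N hy μ) (hNU y hy) (V y)
  have h4 : g y (V y) (A y (U y)) = 0 := by
    rw [H.symm y hy, H.skew y hy, hUAV, neg_zero]
  rw [H.symm y hy (U y) (N μ y), hNU y hy, hUAV, hUAN, hUV] at h2
  rw [H.symm y hy (V y) (N μ y), hNV y hy, h4, hVAN, H.symm y hy (V y) (U y), hUV] at h3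
  have h5 : g y (N μ y) (covDeriv Γ V y (U y)) = 0 := by
    simpa [sub_ne_zero.2 hμf] using h2
  have h6 : g y (N μ y) (covDeriv Γ U y (V y)) = 0 := by
    simpa [sub_ne_zero.2 hμe] using h3
  rw [LocalPKY.lieBracket_eq Γ, map_sub, map_sub, h5, h6] at h1
  rw [H.symm y hy]
  linarith

end LocalFrame

end TorsionKY

namespace TorsionKY

namespace LocalFrame

variable {E : Type*} [NormedAddCommGroup E] [NormedSpace ℝ E]
  {O : Set E} {g : E → E →L[ℝ] E →L[ℝ] ℝ} {A : E → E →L[ℝ] E}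
  {Γ : E → E →L[ℝ] E →L[ℝ] E} {z : E → E}
  {n ε : ℕ} {x q : Fin n → E → ℝ} {N : Fin n → E → E} {F : Fin n ⊕ Fin ε → E → E}

open VectorField

theorem expand (L : LocalFrame O g A z x q N F) {y : E} (hy : y ∈ O) {v : E}
    (hv : ∀ μ, g y (N μ y) v = 0) : v = ∑ k, g y (F k y) v • F k y := by
  rw [← sub_eq_zero]
  refine L.complete y hy _ (fun i => ?_) (fun μ => ?_)
  · rw [map_sub, map_sum]
    simp only [map_smul, smul_eq_mul, L.inner_FF y hy, mul_ite, mul_one, mul_zero,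
      Finset.sum_ite_eq, Finset.mem_univ, if_true, sub_self]
  · simp [map_sub, map_sum, L.inner_NF y hy, hv]

/-- The field `W` is tangent to the level sets of all `x μ`, so the expansion of `W` in the fields
`F k` holds on all of `O`; Leibniz' rule is applied to it. -/
theorem inner_lieBracket_expand (H : LocalPKY O g A Γ z) (L : LocalFrame O g A z x q N F) {y : E}
    (hy : y ∈ O) (X : E → E) {W : E → E} (hW : DifferentiableAt ℝ W y)
    (hWN : ∀ y ∈ O, ∀ μ, g y (N μ y) (W y) = 0) (i : Fin n ⊕ Fin ε) :
    g y (F i y) (lieBracket ℝ X W y) = fderiv ℝ (fun y => g y (F i y) (W y)) y (X y) +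
      ∑ k, g y (F k y) (W y) * g y (F i y) (lieBracket ℝ X (F k) y) := by
  have hc : ∀ k, DifferentiableAt ℝ (fun y => g y (F k y) (W y)) y := fun k =>
    ((H.differentiableAt_metric hy).clm_apply (L.differentiableAt_F H hy k)).clm_apply hW
  have hF := L.differentiableAt_F H hy
  have h1 : HasFDerivAt (fun y => ∑ k, g y (F k y) (W y) • F k y) _ y :=
    HasFDerivAt.fun_sum fun k _ => (hc k).hasFDerivAt.fun_smul (hF k).hasFDerivAt
  have h2 := h1.congr_of_eventuallyEq (f₁ := W)
    (Filter.eventuallyEq_of_mem (H.isOpen.mem_nhds hy) fun p hp => L.expand hp (hWN p hp))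
  have h3 : lieBracket ℝ X W y = ∑ k, (fderiv ℝ (fun y => g y (F k y) (W y)) y (X y) • F k y +
      g y (F k y) (W y) • lieBracket ℝ X (F k) y) := by
    simp only [lieBracket, h2.fderiv, smul_sub]
    conv_lhs => enter [2]; rw [L.expand hy (hWN y hy)]
    simp only [map_sum, map_smul, sum_apply, add_apply, smul_apply,
      ContinuousLinearMap.smulRight_apply]
    rw [← Finset.sum_sub_distrib]
    exact Finset.sum_congr rfl fun k _ => by abel
  rw [h3]
  simp only [map_sum, map_add, map_smul, smul_eq_mul, L.inner_FF y hy, mul_ite, mul_one, mul_zero,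
    Finset.sum_add_distrib, Finset.sum_ite_eq, Finset.mem_univ, if_true]

theorem torsion_cyclic (H : LocalPKY O g A Γ z) {y : E} (hy : y ∈ O) (u v w : E) :
    g y (torsionVec (Γ y) u v) w = -g y (torsionVec (Γ y) w v) u := by
  rw [torsionVec_swap, map_neg, neg_apply, H.torsion_swap hy, torsionVec_swap, map_neg, neg_apply]
  ring

/-- For `i ≠ .inl ν` neither the derivative of `F k` along `N ν` nor the torsion has an `F i`
component, and the eigenvalue equation of `N ν` gives the remaining derivative. For `i = .inl ν` the
torsion is not known to vanish, but the bracket of `F (.inl ν)` and `F k` is orthogonal to `N ν`;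
this expresses the torsion by covariant derivatives, which then cancel. -/
theorem inner_F_lieBracket_N [FiniteDimensional ℝ E] (H : LocalPKY O g A Γ z)
    (L : LocalFrame O g A z x q N F) {y : E} (hy : y ∈ O) (ν : Fin n) {k : Fin n ⊕ Fin ε}
    (hk : k ≠ .inl ν) (i : Fin n ⊕ Fin ε) :
    g y (F i y) (lieBracket ℝ (N ν) (F k) y) =
      if i = k then x ν y * q ν y ^ 2 / (eigSq x k y - x ν y ^ 2) else 0 := by
  have hFk := L.differentiableAt_F H hy k
  have hN := L.differentiableAt_N H hy ν
  have hx2 : DifferentiableAt ℝ (fun y => x ν y ^ 2) y := (L.differentiableAt_x H hy ν).pow 2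
  have hev : eigSq x k y - x ν y ^ 2 ≠ 0 := sub_ne_zero.2 fun h => hk (L.eig_inj y hy h)
  have hNAF : g y (N ν y) (A y (F k y)) = 0 := L.inner_N_endo_F hy hk
  have hFN : ∀ i, g y (F i y) (N ν y) = 0 := fun i => by rw [H.symm y hy, L.inner_NF y hy]
  have hzAN : g y (z y) (A y (N ν y)) = -(x ν y * q ν y ^ 2) := by
    rw [L.endo_N y hy, map_smul, L.inner_zF y hy, smul_eq_mul]; ring
  rw [LocalPKY.lieBracket_eq Γ, map_sub, map_sub]
  by_cases hi : i = .inl ν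
  · subst hi
    rw [if_neg (Ne.symm hk)]
    have hS := L.differentiableAt_F H hy (.inl ν)
    have h1 := L.inner_N_lieBracket H hy ν hS hFk (fun y hy => L.inner_NF y hy ν _)
      (fun y hy => L.inner_NF y hy ν _)
    rw [LocalPKY.lieBracket_eq Γ, map_sub, map_sub] at h1
    have h2 := H.fderiv_inner hy hN hS (F k y)
    have h2' : fderiv ℝ (fun y => g y (N ν y) (F (.inl ν) y)) y = 0 := by
      refine ((hasFDerivAt_const (0 : ℝ) y).congr_of_eventuallyEq ?_).fderiv
      filter_upwards [H.isOpen.mem_nhds hy] with p hp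
      simp [L.inner_NF p hp]
    rw [h2', zero_apply, H.symm y hy (covDeriv Γ (N ν) y (F k y))] at h2
    have h3 := H.inner_covDeriv_eigen hy hFk (L.differentiableAt_eigSq H hy k)
      (fun y hy => L.endo_endo_F hy k) (L.endo_endo_F hy (.inl ν))
      (by simp [L.inner_FF y hy, Ne.symm hk]) (N ν y)
    have h4 := H.inner_covDeriv_eigen hy hFk (L.differentiableAt_eigSq H hy k)
      (fun y hy => L.endo_endo_F hy k) (L.endo_endo_N hy ν)
      (L.inner_NF y hy ν k) (F (.inl ν) y)
    rw [L.inner_z_endo_F hy, hNAF, L.inner_NF y hy] at h3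
    rw [L.inner_z_endo_F hy, L.inner_F_endo_F H hy, hzAN, L.inner_FF y hy, if_neg (Ne.symm hk)] at h4
    have h5 : g y (N ν y) (A y (F (.inl ν) y)) = -g y (F (.inl ν) y) (A y (N ν y)) := by
      rw [← H.skew y hy, H.symm y hy]
    rw [h5] at h3
    have h6 : (x ν y ^ 2 - eigSq x k y) * (g y (F (.inl ν) y) (covDeriv Γ (F k) y (N ν y)) +
        g y (N ν y) (covDeriv Γ (F k) y (F (.inl ν) y))) = 0 := by
      have e : eigSq x (.inl ν : Fin n ⊕ Fin ε) y = x ν y ^ 2 := rfl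
      rw [e] at h3
      linear_combination h3 + h4 + g y (z y) (A y (F (.inl ν) y)) * L.inner_NF y hy ν k
    have h7 : x ν y ^ 2 - eigSq x k y ≠ 0 := by
      rw [← neg_sub]; exact neg_ne_zero.2 hev
    have h8 := (mul_eq_zero.1 h6).resolve_left h7
    have h9 := torsion_cyclic H hy (N ν y) (F k y) (F (.inl ν) y)
    rw [H.symm y hy (N ν y) (torsionVec _ _ _)] at h1
    rw [H.symm y hy (F (.inl ν) y) (torsionVec _ _ _)]
    linear_combination h8 - h1 + h2 - h9
  · have hevi : eigSq x i y - x ν y ^ 2 ≠ 0 := sub_ne_zero.2 fun h => hi (L.eig_inj y hy h)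
    have hNAFi : g y (N ν y) (A y (F i y)) = 0 := L.inner_N_endo_F hy hi
    have hFAN : g y (F k y) (A y (N ν y)) = 0 := by
      rw [← neg_eq_zero, ← H.skew y hy, H.symm y hy, hNAF]
    have h1 : g y (F i y) (covDeriv Γ (F k) y (N ν y)) = 0 := by
      by_cases hik : i = k
      · subst hik
        have h1 := H.fderiv_inner hy hFk hFk (N ν y)
        have h2 : fderiv ℝ (fun y => g y (F i y) (F i y)) y = 0 := by
          refine ((hasFDerivAt_const (1 : ℝ) y).congr_of_eventuallyEq ?_).fderiv
          filter_upwards [H.isOpen.mem_nhds hy] with p hp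
          simp [L.inner_FF p hp]
        rw [h2, H.symm y hy (covDeriv Γ (F i) y (N ν y)), zero_apply] at h1
        linarith
      · have h1 := H.inner_covDeriv_eigen hy hFk (L.differentiableAt_eigSq H hy k)
          (fun y hy => L.endo_endo_F hy k) (L.endo_endo_F hy i)
          (by simp [L.inner_FF y hy, hik]) (N ν y)
        rw [L.inner_z_endo_F hy, L.inner_z_endo_F hy, hNAF, hNAFi] at h1
        have h2 : eigSq x i y - eigSq x k y ≠ 0 := sub_ne_zero.2 fun h => hik (L.eig_inj y hy h)
        simpa [h2] using h1
    have h2 := H.inner_covDeriv_eigen hy hN hx2 (fun y hy => L.endo_endo_N hy ν)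
      (L.endo_endo_F hy i) (hFN i) (F k y)
    rw [hzAN, hFAN, L.inner_zN y hy, hFN, L.inner_FF y hy] at h2
    have h3 : g y (F i y) (torsionVec (Γ y) (N ν y) (F k y)) = 0 := by
      rw [H.symm y hy]
      by_cases hik : i = k
      · subst hik
        have := H.torsion_swap hy (N ν y) (F i y) (F i y)
        linarith
      · have h4 := L.torsion_N H hy ν (L.differentiableAt_F H hy i) hFk
          (L.differentiableAt_eigSq H hy i) (L.differentiableAt_eigSq H hy k)
          (fun y hy => L.endo_endo_F hy i) (fun y hy => L.endo_endo_F hy k)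
          (sub_ne_zero.1 hevi).symm (sub_ne_zero.1 hev).symm (fun y hy => L.inner_NF y hy ν i)
          (fun y hy => L.inner_NF y hy ν k) (by simp [L.inner_FF y hy, hik])
          (L.inner_F_endo_F H hy i k)
          (by rw [← neg_eq_zero, ← H.skew y hy, H.symm y hy, hNAFi]) hFAN
        rw [torsion_cyclic H hy, h4, neg_zero]
    rw [h1, h3]
    split_ifs with hik
    · subst hik
      rw [if_pos rfl] at h2
      field_simp
      linear_combination -h2
    · rw [if_neg (Ne.symm hik)] at h2
      simpa [hevi] using h2

end LocalFrame

end TorsionKY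

/-! ### Jacobi identities and torsion components of three hatted vectors -/

namespace TorsionKY

namespace LocalFrame

variable {E : Type*} [NormedAddCommGroup E] [NormedSpace ℝ E]
  {O : Set E} {g : E → E →L[ℝ] E →L[ℝ] ℝ} {A : E → E →L[ℝ] E}
  {Γ : E → E →L[ℝ] E →L[ℝ] E} {z : E → E}
  {n ε : ℕ} {x q : Fin n → E → ℝ} {N : Fin n → E → E} {F : Fin n ⊕ Fin ε → E → E}

open VectorField

theorem fderiv_eq_zero_of_eqOn (H : LocalPKY O g A Γ z) {y : E} (hy : y ∈ O) {f : E → ℝ} {c : ℝ}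
    (hf : ∀ y ∈ O, f y = c) : fderiv ℝ f y = 0 :=
  ((hasFDerivAt_const c y).congr_of_eventuallyEq
    (Filter.eventuallyEq_of_mem (H.isOpen.mem_nhds hy) hf)).fderiv

/-- The vector field with `dx_μ(Z) = δ_{μν}` proportional to the gradient of `x_ν`. -/
noncomputable def dualGrad (q : Fin n → E → ℝ) (N : Fin n → E → E) (ν : Fin n) (y : E) : E :=
  (q ν y ^ 2)⁻¹ • N ν y

/-- Smoothness of `q` is not part of the frame data, but its square is the squared norm of the
smooth field `N ν`. -/
theorem smooth_q_sq_inv (H : LocalPKY O g A Γ z) (L : LocalFrame O g A z x q N F) (ν : Fin n) :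
    ContDiffOn ℝ ∞ (fun y => (q ν y ^ 2)⁻¹) O := by
  have h1 : ContDiffOn ℝ ∞ (fun y => q ν y ^ 2) O :=
    (((H.smooth_metric.clm_apply (L.smooth_N ν)).clm_apply (L.smooth_N ν)).congr
      fun y hy => (L.inner_NN_self y hy ν).symm)
  exact h1.inv fun y hy => (pow_pos (L.q_pos y hy ν) 2).ne'

theorem smooth_dualGrad (H : LocalPKY O g A Γ z) (L : LocalFrame O g A z x q N F) (ν : Fin n) :
    ContDiffOn ℝ ∞ (dualGrad q N ν) O :=
  (L.smooth_q_sq_inv H ν).smul (L.smooth_N ν)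

theorem inner_N_dualGrad (L : LocalFrame O g A z x q N F) {y : E} (hy : y ∈ O) (μ ν : Fin n) :
    g y (N μ y) (dualGrad q N ν y) = if μ = ν then 1 else 0 := by
  rw [dualGrad, map_smul, smul_eq_mul]
  split_ifs with h
  · subst h
    rw [L.inner_NN_self y hy, inv_mul_cancel₀ (pow_pos (L.q_pos y hy μ) 2).ne']
  · rw [L.inner_NN y hy _ _ h, mul_zero]

/-- The rescaling leaves a coefficient depending only on the `x μ`, hence constant along all hatted
fields; the derivative of the scale factor drops out because it multiplies `N ν`. -/
theorem inner_F_lieBracket_dualGrad [FiniteDimensional ℝ E] (H : LocalPKY O g A Γ z)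
    (L : LocalFrame O g A z x q N F) {y : E} (hy : y ∈ O) (ν : Fin n) {k : Fin n ⊕ Fin ε}
    (hk : k ≠ .inl ν) (i : Fin n ⊕ Fin ε) :
    g y (F i y) (lieBracket ℝ (dualGrad q N ν) (F k) y) =
      if i = k then x ν y / (eigSq x k y - x ν y ^ 2) else 0 := by
  have h1 : lieBracket ℝ (dualGrad q N ν) (F k) y = _ :=
    lieBracket_smul_left (V := N ν) (W := F k)
      (((L.smooth_q_sq_inv H ν).contDiffAt (H.isOpen.mem_nhds hy)).differentiableAt (by simp))
      (L.differentiableAt_N H hy ν)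
  have := (L.q_pos y hy ν).ne'
  rw [h1, map_add, map_smul, map_smul, L.inner_F_lieBracket_N H hy ν hk, H.symm y hy,
    L.inner_NF y hy, smul_zero, zero_add]
  split_ifs with h
  · rw [smul_eq_mul, mul_div_assoc', ← mul_assoc, mul_comm (_ ^ 2)⁻¹, mul_assoc,
      inv_mul_cancel₀ (pow_ne_zero 2 this), mul_one]
  · rw [smul_zero]

theorem inner_N_lieBracket_dualGrad [FiniteDimensional ℝ E] (H : LocalPKY O g A Γ z)
    (L : LocalFrame O g A z x q N F) {y : E} (hy : y ∈ O) (ν μ : Fin n) (k : Fin n ⊕ Fin ε) :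
    g y (N μ y) (lieBracket ℝ (dualGrad q N ν) (F k) y) = 0 :=
  L.inner_N_lieBracket H hy μ
    (((L.smooth_dualGrad H ν).contDiffAt (H.isOpen.mem_nhds hy)).differentiableAt (by simp))
    (L.differentiableAt_F H hy k) (fun _ hy => L.inner_N_dualGrad hy μ ν)
    (fun y hy => L.inner_NF y hy μ k)

section Structure

/-- The structure functions `g(F_k, [F_i, F_j])`. -/
noncomputable def structFun (g : E → E →L[ℝ] E →L[ℝ] ℝ) (F : Fin n ⊕ Fin ε → E → E)
    (i j k : Fin n ⊕ Fin ε) (y : E) : ℝ := g y (F k y) (lieBracket ℝ (F i) (F j) y)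

theorem structFun_swap_left (i j k : Fin n ⊕ Fin ε) (y : E) :
    structFun g F i j k y = -structFun g F j i k y := by
  rw [structFun, structFun, lieBracket_swap, map_neg]

theorem structFun_swap_right (H : LocalPKY O g A Γ z) (L : LocalFrame O g A z x q N F) {y : E}
    (hy : y ∈ O) (i j k : Fin n ⊕ Fin ε) : structFun g F i j k y = -structFun g F i k j y := by
  rw [structFun, structFun, L.inner_F_lieBracket H hy, L.inner_F_lieBracket H hy,
    H.torsion_swap hy]

theorem structFun_self_right (H : LocalPKY O g A Γ z) (L : LocalFrame O g A z x q N F) {y : E}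
    (hy : y ∈ O) (i j : Fin n ⊕ Fin ε) : structFun g F i j j y = 0 := by
  have := L.structFun_swap_right H hy i j j
  linarith

theorem structFun_self_outer (H : LocalPKY O g A Γ z) (L : LocalFrame O g A z x q N F) {y : E}
    (hy : y ∈ O) (i j : Fin n ⊕ Fin ε) : structFun g F i j i y = 0 := by
  rw [structFun_swap_left, L.structFun_self_right H hy, neg_zero]

theorem differentiableAt_lieBracket (H : LocalPKY O g A Γ z) {U V : E → E} {y : E} (hy : y ∈ O)
    (hU : ContDiffOn ℝ ∞ U O) (hV : ContDiffOn ℝ ∞ V O) :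
    DifferentiableAt ℝ (lieBracket ℝ U V) y :=
  ((hU.contDiffAt (H.isOpen.mem_nhds hy)).lieBracket_vectorField (m := 1)
    (hV.contDiffAt (H.isOpen.mem_nhds hy)) (by norm_num; exact ENat.LEInfty.out)).differentiableAt
    (by simp)

theorem differentiableAt_inner (H : LocalPKY O g A Γ z) {U V : E → E} {y : E} (hy : y ∈ O)
    (hU : DifferentiableAt ℝ U y) (hV : DifferentiableAt ℝ V y) :
    DifferentiableAt ℝ (fun y => g y (U y) (V y)) y :=
  ((H.differentiableAt_metric hy).clm_apply hU).clm_apply hV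

theorem jacobi (H : LocalPKY O g A Γ z) {U V W : E → E} {y : E} (hy : y ∈ O)
    (hU : ContDiffOn ℝ ∞ U O) (hV : ContDiffOn ℝ ∞ V O) (hW : ContDiffOn ℝ ∞ W O) (v : E) :
    g y v (lieBracket ℝ U (lieBracket ℝ V W) y) =
      g y v (lieBracket ℝ V (lieBracket ℝ U W) y) -
        g y v (lieBracket ℝ W (lieBracket ℝ U V) y) := by
  have hO := H.isOpen.mem_nhds hy
  rw [leibniz_identity_lieBracket minSmoothness_le_infty (hU.contDiffAt hO) (hV.contDiffAt hO)
    (hW.contDiffAt hO), map_add, lieBracket_swap (V := lieBracket ℝ U V), map_neg]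
  ring

variable [FiniteDimensional ℝ E]

/-- `g(F_i, [X, [Y, F_j]])`, where `[Y, F_j]` is a multiple of `F_j`. -/
theorem inner_lieBracket_dualGrad_of_ne (H : LocalPKY O g A Γ z)
    (L : LocalFrame O g A z x q N F) {y : E} (hy : y ∈ O) (ν : Fin n) {i j l : Fin n ⊕ Fin ε}
    (hj : j ≠ .inl ν) (hij : i ≠ j) :
    g y (F i y) (lieBracket ℝ (F l) (lieBracket ℝ (dualGrad q N ν) (F j)) y) =
      x ν y / (eigSq x j y - x ν y ^ 2) * structFun g F l j i y := by
  rw [L.inner_lieBracket_expand H hy (F l)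
    (differentiableAt_lieBracket H hy (L.smooth_dualGrad H ν) (L.smooth_F j))
    (fun y hy μ => L.inner_N_lieBracket_dualGrad H hy ν μ j),
    fderiv_eq_zero_of_eqOn H hy (c := 0) (fun y hy => by
      rw [L.inner_F_lieBracket_dualGrad H hy ν hj, if_neg hij]), zero_apply, zero_add]
  simp only [L.inner_F_lieBracket_dualGrad H hy ν hj, ite_mul, zero_mul]
  rw [Finset.sum_ite_eq' Finset.univ j, if_pos (Finset.mem_univ _)]
  rfl

/-- After expanding the inner bracket in hatted fields, `[Z, F k]` is a multiple of `F k` for every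
`k ≠ .inl ν`, `Z` being the rescaled gradient. Only `k = i` and the still unknown bracket with `F
(.inl ν)` contribute. -/
theorem inner_dualGrad_lieBracket (H : LocalPKY O g A Γ z)
    (L : LocalFrame O g A z x q N F) {y : E} (hy : y ∈ O) (ν : Fin n) {i j l : Fin n ⊕ Fin ε}
    (hi : i ≠ .inl ν) :
    g y (F i y) (lieBracket ℝ (dualGrad q N ν) (lieBracket ℝ (F l) (F j)) y) =
      fderiv ℝ (structFun g F l j i) y (dualGrad q N ν y) +
      (x ν y / (eigSq x i y - x ν y ^ 2) * structFun g F l j i y +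
        structFun g F l j (.inl ν) y *
          g y (F i y) (lieBracket ℝ (dualGrad q N ν) (F (.inl ν)) y)) := by
  rw [L.inner_lieBracket_expand H hy (dualGrad q N ν)
    (differentiableAt_lieBracket H hy (L.smooth_F l) (L.smooth_F j))
    (fun y hy μ => L.inner_N_lieBracket H hy μ (L.differentiableAt_F H hy l)
      (L.differentiableAt_F H hy j) (fun y hy => L.inner_NF y hy μ l)
      (fun y hy => L.inner_NF y hy μ j))]
  congr 1
  rw [Finset.sum_eq_add_of_mem i (.inl ν) (Finset.mem_univ _) (Finset.mem_univ _) hi]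
  · rw [L.inner_F_lieBracket_dualGrad H hy ν hi, if_pos rfl, mul_comm]
    rfl
  · rintro k - ⟨hki, hk⟩
    rw [L.inner_F_lieBracket_dualGrad H hy ν hk, if_neg (Ne.symm hki), mul_zero]

/-- Jacobi identity for the rescaled gradient, `F i` and `F j`, paired with `F i`. Every other term
contains a structure function with a repeated index or the derivative of an eigenvalue along a
hatted field. -/
theorem structFun_mul_eq_zero (H : LocalPKY O g A Γ z)
    (L : LocalFrame O g A z x q N F) {y : E} (hy : y ∈ O) (ν : Fin n) {i j : Fin n ⊕ Fin ε}
    (hi : i ≠ .inl ν) (hj : j ≠ .inl ν) (hij : i ≠ j) :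
    structFun g F i j (.inl ν) y *
      g y (F i y) (lieBracket ℝ (dualGrad q N ν) (F (.inl ν)) y) = 0 := by
  have h1 := jacobi H hy (L.smooth_dualGrad H ν) (L.smooth_F i) (L.smooth_F j) (F i y)
  rw [L.inner_dualGrad_lieBracket H hy ν hi, L.inner_lieBracket_dualGrad_of_ne H hy ν hj hij,
    L.structFun_self_outer H hy,
    fderiv_eq_zero_of_eqOn H hy (fun y hy => L.structFun_self_outer H hy i j)] at h1
  have h2 : g y (F i y) (lieBracket ℝ (F j) (lieBracket ℝ (dualGrad q N ν) (F i)) y) = 0 := by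
    rw [L.inner_lieBracket_expand H hy (F j)
      (differentiableAt_lieBracket H hy (L.smooth_dualGrad H ν) (L.smooth_F i))
      (fun y hy μ => L.inner_N_lieBracket_dualGrad H hy ν μ i)]
    have hd : ∀ y ∈ O, ∀ k, g y (F k y) (lieBracket ℝ (dualGrad q N ν) (F i) y) =
        if k = i then x ν y / (eigSq x i y - x ν y ^ 2) else 0 := fun y hy k =>
      L.inner_F_lieBracket_dualGrad H hy ν hi k
    -- The coefficient depends only on the `x μ`, whose gradients are orthogonal to `F j`.
    have h3 : fderiv ℝ (fun y => g y (F i y) (lieBracket ℝ (dualGrad q N ν) (F i) y)) y (F j y) =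
        0 := by
      have hxj : ∀ μ, HasFDerivAt (x μ) (fderiv ℝ (x μ) y) y := fun μ =>
        (L.differentiableAt_x H hy μ).hasFDerivAt
      have hx0 : ∀ μ, fderiv ℝ (x μ) y (F j y) = 0 := fun μ => by
        rw [L.grad y hy, L.inner_NF y hy]
      have he : fderiv ℝ (eigSq x i) y (F j y) = 0 := by
        rcases i with μ | a
        · have := (hxj μ).pow 2
          have e : eigSq x (.inl μ : Fin n ⊕ Fin ε) = fun y => x μ y ^ 2 := rfl
          rw [e, this.fderiv]
          simp [hx0]
        · have e : eigSq x (.inr a : Fin n ⊕ Fin ε) = fun _ => 0 := rfl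
          rw [e]; simp
      have hne : eigSq x i y - x ν y ^ 2 ≠ 0 := sub_ne_zero.2 fun h => hi (L.eig_inj y hy h)
      have hd1 := (L.differentiableAt_eigSq H hy i).hasFDerivAt.fun_sub ((hxj ν).pow 2)
      have hd2 := (hxj ν).fun_mul ((hasDerivAt_inv hne).comp_hasFDerivAt y hd1)
      have hd3 := hd2.congr_of_eventuallyEq
        (f₁ := fun y => g y (F i y) (lieBracket ℝ (dualGrad q N ν) (F i) y))
        (Filter.eventuallyEq_of_mem (H.isOpen.mem_nhds hy) fun p hp => by
          simp only [hd p hp, if_true, div_eq_mul_inv, Function.comp_apply])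
      rw [hd3.fderiv]
      simp [hx0, he]
    rw [h3, zero_add]
    simp only [hd y hy, ite_mul, zero_mul]
    rw [Finset.sum_ite_eq' Finset.univ i, if_pos (Finset.mem_univ _)]
    have := L.structFun_self_right H hy j i
    rw [structFun] at this
    rw [this, mul_zero]
  rw [h2] at h1
  simpa using h1

/-- Jacobi identity for the rescaled gradient, `F j` and `F (.inl ν)`, paired with `F i`. The
unknown components of the bracket of the gradient with `F (.inl ν)` are collected on the right. -/
theorem structFun_mul_sub (H : LocalPKY O g A Γ z)
    (L : LocalFrame O g A z x q N F) {y : E} (hy : y ∈ O) (ν : Fin n) {i j : Fin n ⊕ Fin ε}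
    (hi : i ≠ .inl ν) (hj : j ≠ .inl ν) (hij : i ≠ j) :
    fderiv ℝ (structFun g F j (.inl ν) i) y (dualGrad q N ν y) +
      structFun g F j (.inl ν) i y *
        (x ν y / (eigSq x i y - x ν y ^ 2) - x ν y / (eigSq x j y - x ν y ^ 2)) =
      fderiv ℝ (fun y => g y (F i y) (lieBracket ℝ (dualGrad q N ν) (F (.inl ν)) y)) y (F j y) +
      ∑ k, g y (F k y) (lieBracket ℝ (dualGrad q N ν) (F (.inl ν)) y) * structFun g F j k i y := by
  have h1 := jacobi H hy (L.smooth_dualGrad H ν) (L.smooth_F j) (L.smooth_F (.inl ν)) (F i y)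
  rw [L.inner_dualGrad_lieBracket H hy ν hi, L.inner_lieBracket_dualGrad_of_ne H hy ν hj hij,
    L.structFun_self_right H hy, zero_mul, add_zero,
    structFun_swap_left (.inl ν) j i] at h1
  rw [L.inner_lieBracket_expand H hy (F j)
    (differentiableAt_lieBracket H hy (L.smooth_dualGrad H ν) (L.smooth_F _))
    (fun y hy μ => L.inner_N_lieBracket_dualGrad H hy ν μ _)] at h1
  simp only [structFun] at h1 ⊢
  linear_combination h1

/-- The torsion has no component with three hatted vectors of different blocks. -/
theorem torsion_F (H : LocalPKY O g A Γ z)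
    (L : LocalFrame O g A z x q N F) {y : E} (hy : y ∈ O) (ν : Fin n) {i j : Fin n ⊕ Fin ε}
    (hi : i ≠ .inl ν) (hj : j ≠ .inl ν) (hij : i ≠ j) :
    g y (torsionVec (Γ y) (F i y) (F j y)) (F (.inl ν) y) = 0 := by
  set γ : Fin n ⊕ Fin ε → E → ℝ := fun i y =>
    g y (F i y) (lieBracket ℝ (dualGrad q N ν) (F (.inl ν)) y) with hγ
  set t : E → ℝ := structFun g F i j (.inl ν) with ht
  have hct : ∀ y ∈ O, structFun g F j (.inl ν) i y = t y := fun y hy => by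
    rw [ht, L.structFun_swap_right H hy, structFun_swap_left, neg_neg]
  have hct' : ∀ y ∈ O, structFun g F i (.inl ν) j y = -t y := fun y hy => by
    rw [ht, L.structFun_swap_right H hy]
  have htd : DifferentiableAt ℝ t y := differentiableAt_inner H hy (L.differentiableAt_F H hy _)
    (differentiableAt_lieBracket H hy (L.smooth_F i) (L.smooth_F j))
  have hγd : ∀ i, DifferentiableAt ℝ (γ i) y := fun i =>
    differentiableAt_inner H hy (L.differentiableAt_F H hy _)
      (differentiableAt_lieBracket H hy (L.smooth_dualGrad H ν) (L.smooth_F _))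
  have ht0 : ∀ y ∈ O, t y * γ i y = 0 := fun y hy => L.structFun_mul_eq_zero H hy ν hi hj hij
  have ht0' : ∀ y ∈ O, t y * γ j y = 0 := fun y hy => by
    have := L.structFun_mul_eq_zero H hy ν hj hi hij.symm
    rw [structFun_swap_left, neg_mul, neg_eq_zero] at this
    exact this
  -- Differentiating `t γ_k = 0` gives `t dγ_k + γ_k dt = 0`; multiplying by `t` removes the second
  -- term.
  have hsq : ∀ k, (∀ y ∈ O, t y * γ k y = 0) → ∀ v, t y ^ 2 * fderiv ℝ (γ k) y v = 0 := by
    intro k hk v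
    have h1 := fderiv_eq_zero_of_eqOn H hy hk
    rw [(htd.hasFDerivAt.fun_mul (hγd k).hasFDerivAt).fderiv] at h1
    have h2 := congrArg (fun f : E →L[ℝ] ℝ => f v) h1
    simp only [add_apply, smul_apply, smul_eq_mul, zero_apply] at h2
    linear_combination t y * h2 - fderiv ℝ t y v * hk y hy
  have e1 := L.structFun_mul_sub H hy ν hi hj hij
  have e2 := L.structFun_mul_sub H hy ν hj hi hij.symm
  have hf1 : fderiv ℝ (structFun g F j (.inl ν) i) y = fderiv ℝ t y :=
    (htd.hasFDerivAt.congr_of_eventuallyEq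
      (Filter.eventuallyEq_of_mem (H.isOpen.mem_nhds hy) hct)).fderiv
  have hf2 : fderiv ℝ (structFun g F i (.inl ν) j) y = -fderiv ℝ t y :=
    (htd.hasFDerivAt.fun_neg.congr_of_eventuallyEq
      (Filter.eventuallyEq_of_mem (H.isOpen.mem_nhds hy) hct')).fderiv
  rw [hct y hy, hf1] at e1
  rw [hct' y hy, hf2, neg_apply] at e2
  -- The sum over `k` changes sign under `i ↔ j` by total antisymmetry, so it disappears when `e1`
  -- and `e2` are added.
  have e3 : ∑ k, g y (F k y) (lieBracket ℝ (dualGrad q N ν) (F (.inl ν)) y) *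
      structFun g F j k i y = -∑ k, g y (F k y)
        (lieBracket ℝ (dualGrad q N ν) (F (.inl ν)) y) * structFun g F i k j y := by
    rw [← Finset.sum_neg_distrib]
    refine Finset.sum_congr rfl fun k _ => ?_
    rw [L.structFun_swap_right H hy j k i, structFun_swap_left, neg_neg,
      L.structFun_swap_right H hy i j k, mul_neg]
  rw [e3] at e1
  -- Adding `e1` and `e2` eliminates the derivative of `t` and leaves `2 t (…) = F_j(γ_i) +
  -- F_i(γ_j)`; the factor `t²` kills the right side by `hsq`.
  have e4 : t y ^ 3 * (x ν y / (eigSq x i y - x ν y ^ 2) - x ν y / (eigSq x j y - x ν y ^ 2)) =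
      0 := by
    have s1 := hsq i ht0 (F j y)
    have s2 := hsq j ht0' (F i y)
    simp only [hγ] at s1 s2
    linear_combination t y ^ 2 * (e1 + e2) / 2 + s1 / 2 + s2 / 2
  have hne : ∀ i, i ≠ .inl ν → eigSq x i y - x ν y ^ 2 ≠ 0 := fun i hi =>
    sub_ne_zero.2 fun h => hi (L.eig_inj y hy h)
  have e5 : x ν y / (eigSq x i y - x ν y ^ 2) - x ν y / (eigSq x j y - x ν y ^ 2) ≠ 0 := by
    rw [div_sub_div _ _ (hne i hi) (hne j hj), ← mul_comm (x ν y), ← mul_sub]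
    refine div_ne_zero (mul_ne_zero (L.x_ne y hy ν) ?_) (mul_ne_zero (hne i hi) (hne j hj))
    rw [sub_sub_sub_cancel_right]
    exact sub_ne_zero.2 fun h => hij (L.eig_inj y hy h).symm
  have e6 : t y = 0 := by
    simpa using (mul_eq_zero.1 e4).resolve_right e5
  rw [ht, structFun, L.inner_F_lieBracket H hy, neg_eq_zero] at e6
  exact e6

end Structure

end LocalFrame

end TorsionKY

/-! ### Vanishing of the torsion across three eigenspaces -/

namespace TorsionKY

namespace LocalFrame

variable {E : Type*} [NormedAddCommGroup E] [NormedSpace ℝ E]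
  {O : Set E} {g : E → E →L[ℝ] E →L[ℝ] ℝ} {A : E → E →L[ℝ] E}
  {Γ : E → E →L[ℝ] E →L[ℝ] E} {z : E → E}
  {n ε : ℕ} {x q : Fin n → E → ℝ} {N : Fin n → E → E} {F : Fin n ⊕ Fin ε → E → E}

/-- The eigenspace of `A²` to which a frame vector belongs. -/
def block : Fin n ⊕ (Fin n ⊕ Fin ε) → Fin n ⊕ Fin ε := Sum.elim Sum.inl id

theorem endo_endo_frame (L : LocalFrame O g A z x q N F) {y : E} (hy : y ∈ O)
    (a : Fin n ⊕ (Fin n ⊕ Fin ε)) :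
    A y (A y (Sum.elim N F a y)) = -eigSq x (block a) y • Sum.elim N F a y := by
  rcases a with μ | i
  · exact L.endo_endo_N hy μ
  · exact L.endo_endo_F hy i

theorem differentiableAt_frame (H : LocalPKY O g A Γ z) (L : LocalFrame O g A z x q N F) {y : E}
    (hy : y ∈ O) (a : Fin n ⊕ (Fin n ⊕ Fin ε)) : DifferentiableAt ℝ (Sum.elim N F a) y := by
  rcases a with μ | i
  · exact L.differentiableAt_N H hy μ
  · exact L.differentiableAt_F H hy i

theorem inner_eq_zero_of_eigen (H : LocalPKY O g A Γ z) {y : E} (hy : y ∈ O) {u v : E} {e f : ℝ}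
    (hu : A y (A y u) = -e • u) (hv : A y (A y v) = -f • v) (h : e ≠ f) : g y u v = 0 := by
  have h1 : g y (A y (A y u)) v = g y u (A y (A y v)) := by
    rw [H.skew y hy, H.skew y hy, neg_neg]
  rw [hu, hv, map_smul, map_smul, smul_apply, smul_eq_mul, smul_eq_mul] at h1
  have h2 : (e - f) * g y u v = 0 := by linear_combination -h1
  exact (mul_eq_zero.1 h2).resolve_left (sub_ne_zero.2 h)

theorem eigSq_block_ne (L : LocalFrame O g A z x q N F) {y : E} (hy : y ∈ O)
    {a b : Fin n ⊕ (Fin n ⊕ Fin ε)} (h : block a ≠ block b) :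
    eigSq x (block a) y ≠ eigSq x (block b) y := fun e => h (L.eig_inj y hy e)

theorem inner_frame_of_block_ne (H : LocalPKY O g A Γ z) (L : LocalFrame O g A z x q N F) {y : E}
    (hy : y ∈ O) {a b : Fin n ⊕ (Fin n ⊕ Fin ε)} (h : block a ≠ block b) :
    g y (Sum.elim N F a y) (Sum.elim N F b y) = 0 :=
  inner_eq_zero_of_eigen H hy (L.endo_endo_frame hy a) (L.endo_endo_frame hy b)
    (L.eigSq_block_ne hy h)

theorem inner_frame_endo_of_block_ne (H : LocalPKY O g A Γ z) (L : LocalFrame O g A z x q N F)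
    {y : E} (hy : y ∈ O) {a b : Fin n ⊕ (Fin n ⊕ Fin ε)} (h : block a ≠ block b) :
    g y (Sum.elim N F a y) (A y (Sum.elim N F b y)) = 0 :=
  inner_eq_zero_of_eigen H hy (L.endo_endo_frame hy a)
    (by rw [L.endo_endo_frame hy b, map_smul]) (L.eigSq_block_ne hy h)

theorem eq_sum_frame_vec (H : LocalPKY O g A Γ z) (L : LocalFrame O g A z x q N F) {y : E} (hy : y ∈ O) (u : E) :
    ∃ c : Fin n ⊕ (Fin n ⊕ Fin ε) → ℝ, u = ∑ a, c a • Sum.elim N F a y := by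
  refine ⟨Sum.elim (fun μ => (q μ y ^ 2)⁻¹ * g y (N μ y) u) (fun i => g y (F i y) u), ?_⟩
  rw [← sub_eq_zero]
  refine L.complete y hy _ (fun i => ?_) (fun μ => ?_)
  · rw [Fintype.sum_sum_type]
    simp only [map_sub, map_add, map_sum, Sum.elim_inl, Sum.elim_inr, map_smul, smul_eq_mul,
      L.inner_FF y hy, mul_ite, mul_one, mul_zero, Finset.sum_ite_eq, Finset.mem_univ, if_true]
    rw [Finset.sum_eq_zero, zero_add, sub_self]
    intro μ _
    rw [H.symm y hy (F i y), L.inner_NF y hy, mul_zero]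
  · rw [Fintype.sum_sum_type]
    simp only [map_sub, map_add, map_sum, Sum.elim_inl, Sum.elim_inr, map_smul, smul_eq_mul,
      L.inner_NF y hy, mul_zero, Finset.sum_const_zero, add_zero]
    rw [Finset.sum_eq_single μ, L.inner_NN_self y hy]
    · have := (L.q_pos y hy μ).ne'
      field_simp
      ring
    · intro ν _ h
      rw [L.inner_NN y hy _ _ h.symm, mul_zero]
    · simp

variable [FiniteDimensional ℝ E]

theorem torsion_frame_N (H : LocalPKY O g A Γ z) (L : LocalFrame O g A z x q N F) {y : E}
    (hy : y ∈ O) {a b : Fin n ⊕ (Fin n ⊕ Fin ε)} (μ : Fin n) (hab : block a ≠ block b)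
    (ha : block a ≠ .inl μ) (hb : block b ≠ .inl μ) :
    g y (torsionVec (Γ y) (Sum.elim N F a y) (Sum.elim N F b y)) (N μ y) = 0 := by
  have hN : ∀ {c : Fin n ⊕ (Fin n ⊕ Fin ε)}, block c ≠ .inl μ →
      ∀ y ∈ O, g y (N μ y) (Sum.elim N F c y) = 0 := fun {c} hc y hy =>
    L.inner_frame_of_block_ne H hy (a := .inl μ) (b := c) (Ne.symm hc)
  have hE : ∀ {c : Fin n ⊕ (Fin n ⊕ Fin ε)}, block c ≠ .inl μ →
      x μ y ^ 2 ≠ eigSq x (block c) y := fun {c} hc =>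
    L.eigSq_block_ne hy (a := .inl μ) (b := c) (Ne.symm hc)
  exact L.torsion_N H hy μ (L.differentiableAt_frame H hy a) (L.differentiableAt_frame H hy b)
    (L.differentiableAt_eigSq H hy _) (L.differentiableAt_eigSq H hy _)
    (fun y hy => L.endo_endo_frame hy a) (fun y hy => L.endo_endo_frame hy b)
    (hE ha) (hE hb) (hN ha) (hN hb) (L.inner_frame_of_block_ne H hy hab)
    (L.inner_frame_endo_of_block_ne H hy hab)
    (L.inner_frame_endo_of_block_ne H hy (b := .inl μ) ha)
    (L.inner_frame_endo_of_block_ne H hy (b := .inl μ) hb)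

/-- The torsion has no component with vectors of three different blocks. -/
theorem torsion_frame (H : LocalPKY O g A Γ z) (L : LocalFrame O g A z x q N F) {y : E}
    (hy : y ∈ O) {a b c : Fin n ⊕ (Fin n ⊕ Fin ε)} (hab : block a ≠ block b)
    (hbc : block b ≠ block c) (hac : block a ≠ block c) :
    g y (torsionVec (Γ y) (Sum.elim N F a y) (Sum.elim N F b y)) (Sum.elim N F c y) = 0 := by
  rcases c with μ | k
  · exact L.torsion_frame_N H hy μ hab hac hbc
  rcases b with μ | j
  · rw [H.torsion_swap hy]
    exact neg_eq_zero.2 (L.torsion_frame_N H hy μ hac hab hbc.symm)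
  rcases a with μ | i
  · rw [torsion_cyclic H hy]
    exact neg_eq_zero.2 (L.torsion_frame_N H hy μ hbc.symm hac.symm hab.symm)
  -- Only hatted vectors remain. Two of them cannot both lie in the kernel of `A`, because `eig_inj`
  -- allows the eigenvalue zero of `A²` for one index only; so some index is of the form `.inl ν`.
  rcases k with ν | d
  · exact L.torsion_F H hy ν hac hbc hab
  rcases j with ν | d'
  · rw [H.torsion_swap hy]
    exact neg_eq_zero.2 (L.torsion_F H hy ν hab hbc.symm hac)
  · exact absurd (L.eig_inj y hy (a₁ := .inr d') (a₂ := .inr d) rfl) hbc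

/-- Let `X i` be the component of `u` in the eigenspace `i` of `A²`. Resolvents act on it by
scalars, so the expression is a combination of `τ(X i, X j, X k)`. If two indices coincide, the same
vector is repeated and antisymmetry applies; otherwise `torsion_frame` does. -/
theorem torsion_resolvent (H : LocalPKY O g A Γ z) (L : LocalFrame O g A z x q N F) {y : E}
    (hy : y ∈ O) (s r : ℝ) (u : E) :
    g y (torsionVec (Γ y) (resolvent (A y) s u) u) (resolvent (A y) r u) = 0 := by
  obtain ⟨c, hc⟩ := L.eq_sum_frame_vec H hy u
  set X : Fin n ⊕ Fin ε → E := fun i =>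
    ∑ a with block a = i, c a • Sum.elim N F a y with hX
  have hu : u = ∑ i, X i := by
    rw [hc, hX, Finset.sum_fiberwise]
  have hA : ∀ i, A y (A y (X i)) = -eigSq x i y • X i := by
    intro i
    simp only [hX, map_sum, map_smul, Finset.smul_sum]
    refine Finset.sum_congr rfl fun a ha => ?_
    rw [L.endo_endo_frame hy, (Finset.mem_filter.1 ha).2, smul_comm]
  have hpos : ∀ (s : ℝ) (i : Fin n ⊕ Fin ε), 1 + s ^ 2 * eigSq x i y ≠ 0 := by
    intro s i
    have : 0 ≤ eigSq x i y := by
      rcases i with μ | a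
      · exact sq_nonneg _
      · exact le_rfl
    positivity
  have hB : ∀ s i, resolvent (A y) s (X i) = (1 + s ^ 2 * eigSq x i y)⁻¹ • X i := by
    intro s i
    have h1 := H.resolvent_resolventArg hy s (X i)
    have h2 : X i - s ^ 2 • A y (A y (X i)) = (1 + s ^ 2 * eigSq x i y) • X i := by
      rw [hA, smul_smul, add_smul, one_smul, mul_neg, neg_smul, sub_neg_eq_add]
    rw [h2, map_smul] at h1
    rw [eq_inv_smul_iff₀ (hpos s i), h1]
  have hτ : ∀ i j k, g y (torsionVec (Γ y) (X i) (X j)) (X k) = 0 := by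
    have hself : ∀ v w, g y (torsionVec (Γ y) v w) w = 0 := fun v w => by
      have := H.torsion_swap hy v w w
      linarith
    intro i j k
    by_cases hij : i = j
    · subst hij
      simp [torsionVec]
    by_cases hjk : j = k
    · subst hjk
      exact hself _ _
    by_cases hik : i = k
    · subst hik
      rw [torsionVec_swap, map_neg, neg_apply, hself, neg_zero]
    have e : torsionVec (Γ y) (X i) (X j) =
        ∑ a with block a = i, ∑ b with block b = j,
          (c a * c b) • torsionVec (Γ y) (Sum.elim N F a y) (Sum.elim N F b y) := by
      simp only [torsionVec, hX, map_sum, map_smul, sum_apply, smul_apply, smul_sub,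
        Finset.sum_sub_distrib, Finset.smul_sum, smul_smul]
      rw [Finset.sum_comm]
      congr 1
      exact Finset.sum_congr rfl fun a _ => Finset.sum_congr rfl fun b _ => by rw [mul_comm]
    rw [e]
    simp only [hX, map_sum, sum_apply, map_smul, smul_apply, smul_eq_mul]
    refine Finset.sum_eq_zero fun d hd => mul_eq_zero_of_right _ ?_
    refine Finset.sum_eq_zero fun a ha => Finset.sum_eq_zero fun b hb => mul_eq_zero_of_right _ ?_
    rw [Finset.mem_filter] at hd ha hb
    exact L.torsion_frame H hy (by rw [ha.2, hb.2]; exact hij) (by rw [hb.2, hd.2]; exact hjk)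
      (by rw [ha.2, hd.2]; exact hik)
  have hlin : ∀ v, torsionVec (Γ y) v u = ∑ j, torsionVec (Γ y) v (X j) := by
    intro v
    conv_lhs => rw [hu]
    simp [torsionVec, map_sum, sum_apply]
  have hlin' : torsionVec (Γ y) (resolvent (A y) s u) u =
      ∑ j, ∑ i, (1 + s ^ 2 * eigSq x i y)⁻¹ • torsionVec (Γ y) (X i) (X j) := by
    rw [hlin]
    refine Finset.sum_congr rfl fun j _ => ?_
    conv_lhs => rw [hu]
    simp only [torsionVec, map_sum, sum_apply, hB, map_smul, smul_apply, smul_sub,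
      Finset.sum_sub_distrib]
  rw [hlin']
  conv_lhs => enter [2]; rw [hu]
  simp only [map_sum, sum_apply, map_smul, smul_apply, hB, hτ, smul_zero, Finset.sum_const_zero]

end LocalFrame

end TorsionKY

/-! ### Differentiating the characteristic polynomial -/

namespace TorsionKY

/-- Both sides are polynomials in `t`, so the identity for `t > 0`, which suffices for `t = s²`,
extends to all `t`. At `t = -1 / e μ` every summand except the one for `μ` vanishes, as does the
right side; `t = 0` gives the sum. -/
theorem coeff_eq_of_rational_identity {n : ℕ} {e a b : Fin n → ℝ} {c : ℝ} (he : ∀ μ, 0 < e μ)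
    (hinj : Function.Injective e)
    (h : ∀ t : ℝ, 0 < t → ∑ μ, (∏ ν ∈ Finset.univ.erase μ, (1 + t * e ν)) * (a μ - t * b μ) =
      c * ∏ ν, (1 + t * e ν)) :
    (∀ μ, b μ = -(e μ * a μ)) ∧ ∑ μ, a μ = c := by
  set L : Fin n → Polynomial ℝ := fun ν => 1 + Polynomial.X * Polynomial.C (e ν) with hL
  set p : Polynomial ℝ := ∑ μ, (∏ ν ∈ Finset.univ.erase μ, L ν) *
    (Polynomial.C (a μ) - Polynomial.X * Polynomial.C (b μ)) with hp
  set q : Polynomial ℝ := Polynomial.C c * ∏ ν, L ν with hq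
  have hpe : ∀ t, p.eval t =
      ∑ μ, (∏ ν ∈ Finset.univ.erase μ, (1 + t * e ν)) * (a μ - t * b μ) := fun t => by
    simp only [hp, hL, Polynomial.eval_finsetSum, Polynomial.eval_prod, Polynomial.eval_mul,
      Polynomial.eval_add, Polynomial.eval_sub, Polynomial.eval_one, Polynomial.eval_X,
      Polynomial.eval_C]
  have hqe : ∀ t, q.eval t = c * ∏ ν, (1 + t * e ν) := fun t => by
    simp only [hq, hL, Polynomial.eval_prod, Polynomial.eval_mul, Polynomial.eval_add,
      Polynomial.eval_one, Polynomial.eval_X, Polynomial.eval_C]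
  have hpq : p = q := Polynomial.eq_of_infinite_eval_eq p q
    ((Set.Ioi_infinite (0 : ℝ)).mono fun t ht => by
      rw [Set.mem_ofPred_eq, hpe, hqe, h t ht])
  have key : ∀ t, ∑ μ, (∏ ν ∈ Finset.univ.erase μ, (1 + t * e ν)) * (a μ - t * b μ) =
      c * ∏ ν, (1 + t * e ν) := fun t => by rw [← hpe, ← hqe, hpq]
  refine ⟨fun μ => ?_, by simpa using key 0⟩
  have h1 := key (-(e μ)⁻¹)
  have h0 : 1 + -(e μ)⁻¹ * e μ = 0 := by rw [neg_mul, inv_mul_cancel₀ (he μ).ne', add_neg_cancel]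
  rw [Finset.prod_eq_zero (Finset.mem_univ μ) h0, mul_zero, Finset.sum_eq_single μ] at h1
  · have h2 : ∏ ν ∈ Finset.univ.erase μ, (1 + -(e μ)⁻¹ * e ν) ≠ 0 := by
      refine Finset.prod_ne_zero_iff.2 fun ν hν => ?_
      have hne : e ν ≠ e μ := fun h => (Finset.mem_erase.1 hν).1 (hinj h)
      have := (he μ).ne'
      intro h3
      apply hne
      field_simp at h3
      linarith
    have h3 := (mul_eq_zero.1 h1).resolve_left h2
    have := (he μ).ne'
    field_simp at h3
    linarith
  · intro ν _ hνμ
    rw [Finset.prod_eq_zero (Finset.mem_erase.2 ⟨hνμ.symm, Finset.mem_univ μ⟩) h0, zero_mul]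
  · simp

variable {E : Type*} [NormedAddCommGroup E] [NormedSpace ℝ E]

/-- Functions whose differentials vanish nowhere are simultaneously non-zero at some points of
every non-empty open set. -/
theorem exists_open_forall_ne {ι : Type*} {O : Set E} (f : ι → E → ℝ)
    (hf : ∀ i, ContDiffOn ℝ ∞ (f i) O) (hd : ∀ i, ∀ y ∈ O, fderiv ℝ (f i) y ≠ 0) (s : Finset ι)
    {U : Set E} (hU : IsOpen U) (hUO : U ⊆ O) (hne : U.Nonempty) :
    ∃ V ⊆ U, IsOpen V ∧ V.Nonempty ∧ ∀ i ∈ s, ∀ y ∈ V, f i y ≠ 0 := by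
  classical
  induction s using Finset.induction_on with
  | empty => exact ⟨U, subset_rfl, hU, hne, by simp⟩
  | insert i s _ ih =>
    obtain ⟨V, hVU, hV, hVne, hVs⟩ := ih
    have hex : ∃ y ∈ V, f i y ≠ 0 := by
      by_contra! hcon
      obtain ⟨y, hy⟩ := hVne
      refine hd i y (hUO (hVU hy)) ?_
      exact ((hasFDerivAt_const (0 : ℝ) y).congr_of_eventuallyEq
        (Filter.eventuallyEq_of_mem (hV.mem_nhds hy) hcon)).fderiv
    obtain ⟨y, hy, hyi⟩ := hex
    refine ⟨V ∩ f i ⁻¹' {0}ᶜ, Set.inter_subset_left.trans hVU,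
      (((hf i).continuousOn.mono (hVU.trans hUO)).isOpen_inter_preimage hV isOpen_compl_singleton),
      ⟨y, hy, hyi⟩, ?_⟩
    intro j hj z hz
    rcases Finset.mem_insert.1 hj with rfl | hj
    · exact hz.2
    · exact hVs j hj z hz.1

/-- The eigenvalues `x_μ` of the principal tensor on a coordinate domain. -/
structure LocalEigen {n : ℕ} (O : Set E) (A : E → E →L[ℝ] E) (x : Fin n → E → ℝ) : Prop where
  smooth_x : ∀ μ, ContDiffOn ℝ ∞ (x μ) O
  x_ne : ∀ y ∈ O, ∀ μ, x μ y ≠ 0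
  det : ∀ y ∈ O, ∀ s, detW (A y) s = ∏ μ, (1 + s ^ 2 * x μ y ^ 2)
  indep : ∀ y ∈ O, LinearIndependent ℝ fun μ => fderiv ℝ (x μ) y

/-- The gradient of `f` with respect to the metric `g`. -/
noncomputable def metricGrad (g : E → E →L[ℝ] E →L[ℝ] ℝ) (f : E → ℝ) (y : E) : E :=
  ContinuousLinearMap.inverse (g y) (fderiv ℝ f y)

variable {O : Set E} {g : E → E →L[ℝ] E →L[ℝ] ℝ} {A : E → E →L[ℝ] E}
  {Γ : E → E →L[ℝ] E →L[ℝ] E} {z : E → E}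

namespace LocalEigen

variable {n : ℕ} {x : Fin n → E → ℝ}

theorem differentiableAt_x (H : LocalPKY O g A Γ z) (X : LocalEigen O A x) {y : E} (hy : y ∈ O)
    (μ : Fin n) : DifferentiableAt ℝ (x μ) y :=
  ((X.smooth_x μ).contDiffAt (H.isOpen.mem_nhds hy)).differentiableAt (by simp)

/-- The set where `a ≠ b` is open. If it were non-empty it would contain a point where all the `x μ
^ 2` are distinct: the differences of these squares have nowhere vanishing differentials, because
the `x μ` are non-zero and their differentials independent. -/
theorem eqOn_of_injective (H : LocalPKY O g A Γ z) (X : LocalEigen O A x) {G : Type*}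
    [TopologicalSpace G] [T2Space G] {a b : E → G} (ha : ContinuousOn a O) (hb : ContinuousOn b O)
    (hab : ∀ y ∈ O, (Function.Injective fun μ => x μ y ^ 2) → a y = b y) {y : E} (hy : y ∈ O) :
    a y = b y := by
  by_contra hyne
  have hpre := (ha.prodMk hb).isOpen_inter_preimage H.isOpen
    (isOpen_compl_iff.2 (isClosed_diagonal (X := G)))
  have hne : ∀ μ ν, μ ≠ ν → ∀ y ∈ O, fderiv ℝ (fun y => x μ y ^ 2 - x ν y ^ 2) y ≠ 0 := by
    intro μ ν hμν y hy h0
    have h1 := ((X.differentiableAt_x H hy μ).hasFDerivAt.pow 2).fun_sub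
      ((X.differentiableAt_x H hy ν).hasFDerivAt.pow 2)
    rw [h1.fderiv] at h0
    have h2 := Fintype.linearIndependent_iff.1 (X.indep y hy)
      (Pi.single μ (2 * x μ y) - Pi.single ν (2 * x ν y)) (by
        simp only [Pi.sub_apply, sub_smul, Finset.sum_sub_distrib, Pi.single_apply, ite_smul,
          zero_smul, Finset.sum_ite_eq', Finset.mem_univ, if_true]
        simpa using h0) μ
    have := X.x_ne y hy μ
    simp [hμν, this] at h2
  obtain ⟨V, hVU, hV, ⟨w, hw⟩, hVs⟩ := exists_open_forall_ne (O := O)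
    (fun (p : {p : Fin n × Fin n // p.1 ≠ p.2}) y => x p.1.1 y ^ 2 - x p.1.2 y ^ 2)
    (fun p => ((X.smooth_x _).pow 2).sub ((X.smooth_x _).pow 2))
    (fun p => hne _ _ p.2)
    Finset.univ hpre Set.inter_subset_left ⟨y, hy, hyne⟩
  refine (hVU hw).2 (hab w (hVU hw).1 fun μ ν h => ?_)
  by_contra hμν
  exact hVs ⟨(μ, ν), hμν⟩ (Finset.mem_univ _) w hw (sub_eq_zero.2 h)

end LocalEigen

variable [FiniteDimensional ℝ E]

theorem exists_equiv_of_pos {g₀ : E →L[ℝ] E →L[ℝ] ℝ} (h : ∀ v, v ≠ 0 → 0 < g₀ v v) :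
    ∃ e : E ≃L[ℝ] (E →L[ℝ] ℝ), (e : E →L[ℝ] E →L[ℝ] ℝ) = g₀ := by
  have hinj : Function.Injective g₀ := by
    refine (injective_iff_map_eq_zero g₀).2 fun v hv => ?_
    by_contra hne
    have := h v hne
    rw [hv] at this
    exact lt_irrefl _ this
  have hdim : Module.finrank ℝ E = Module.finrank ℝ (E →L[ℝ] ℝ) := by
    rw [← (LinearMap.toContinuousLinearMap : (E →ₗ[ℝ] ℝ) ≃ₗ[ℝ] (E →L[ℝ] ℝ)).finrank_eq]
    exact Subspace.dual_finrank_eq.symm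
  refine ⟨(LinearMap.linearEquivOfInjective (g₀ : E →ₗ[ℝ] E →L[ℝ] ℝ) hinj
    hdim).toContinuousLinearEquiv, ?_⟩
  ext v w
  rfl

theorem LocalPKY.exists_equiv (H : LocalPKY O g A Γ z) {y : E} (hy : y ∈ O) :
    ∃ e : E ≃L[ℝ] (E →L[ℝ] ℝ), (e : E →L[ℝ] E →L[ℝ] ℝ) = g y :=
  exists_equiv_of_pos (H.pos y hy)

theorem LocalPKY.inner_metricGrad (H : LocalPKY O g A Γ z) {y : E} (hy : y ∈ O) (f : E → ℝ)
    (v : E) : g y (metricGrad g f y) v = fderiv ℝ f y v := by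
  obtain ⟨e, he⟩ := H.exists_equiv hy
  rw [metricGrad, ← he, ContinuousLinearMap.inverse_equiv]
  simp

theorem LocalPKY.smooth_metricGrad (H : LocalPKY O g A Γ z) {f : E → ℝ}
    (hf : ContDiffOn ℝ ∞ f O) : ContDiffOn ℝ ∞ (metricGrad g f) O := by
  have := FiniteDimensional.complete ℝ E
  intro y hy
  obtain ⟨e, he⟩ := H.exists_equiv hy
  have h1 := contDiffAt_map_inverse (n := ∞) e
  rw [he] at h1
  have h2 := h1.comp_contDiffWithinAt y (H.smooth_metric y hy)
  exact h2.clm_apply ((hf.fderiv_of_isOpen H.isOpen (m := ∞) (by simp)) y hy)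

namespace LocalEigen

variable {n : ℕ} {x : Fin n → E → ℝ}

/-- The differentiated characteristic polynomial, at points with distinct eigenvalues. -/
theorem fderiv_x_of_injective (H : LocalPKY O g A Γ z) (X : LocalEigen O A x) {y : E} (hy : y ∈ O)
    (hinj : Function.Injective fun μ => x μ y ^ 2) (w : E) :
    (∀ μ, fderiv ℝ (x μ) y (A y (A y w)) = -(x μ y ^ 2 * fderiv ℝ (x μ) y w)) ∧
      ∑ μ, x μ y * fderiv ℝ (x μ) y w = -g y (z y) (A y w) := by
  have hd : ∀ (s : ℝ) v, fderiv ℝ (fun y => detW (A y) s) y v =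
      ∑ μ, (∏ ν ∈ Finset.univ.erase μ, (1 + s ^ 2 * x ν y ^ 2)) *
        (s ^ 2 * (2 * x μ y * fderiv ℝ (x μ) y v)) := by
    intro s v
    have h1 : HasFDerivAt (fun y => ∏ μ, (1 + s ^ 2 * x μ y ^ 2)) _ y :=
      HasFDerivAt.finsetProd fun μ _ =>
        (((X.differentiableAt_x H hy μ).hasFDerivAt.pow 2).const_mul (s ^ 2)).const_add 1
    have h2 := h1.congr_of_eventuallyEq (f₁ := fun y => detW (A y) s)
      (Filter.eventuallyEq_of_mem (H.isOpen.mem_nhds hy) fun p hp => X.det p hp s)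
    rw [h2.fderiv]
    simp [sum_apply, smul_apply]
  obtain ⟨h1, h2⟩ := coeff_eq_of_rational_identity (e := fun μ => x μ y ^ 2)
    (a := fun μ => x μ y * fderiv ℝ (x μ) y w)
    (b := fun μ => x μ y * fderiv ℝ (x μ) y (A y (A y w))) (c := -g y (z y) (A y w))
    (fun μ => sq_pos_of_ne_zero (X.x_ne y hy μ)) hinj (by
      intro t ht
      have hs : √t ^ 2 = t := Real.sq_sqrt ht.le
      -- In the direction `w - s² A² w` the resolvent disappears from the derivative of `W_s`, and
      -- the identity becomes polynomial in `t = s²` after division by `2 t`.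
      have h1 := H.fderiv_detW hy (√t) (w - √t ^ 2 • A y (A y w))
      rw [H.resolvent_resolventArg hy, hd, X.det y hy, hs] at h1
      have h2 : (2 * t) ≠ 0 := by positivity
      apply mul_left_cancel₀ h2
      rw [Finset.mul_sum]
      refine Eq.trans (Finset.sum_congr rfl fun μ _ => ?_) (h1.trans ?_)
      · rw [map_sub, map_smul, smul_eq_mul]; ring
      · ring)
  refine ⟨fun μ => mul_left_cancel₀ (X.x_ne y hy μ) ?_, h2⟩
  rw [h1 μ]; ring

end LocalEigen

end TorsionKY

/-! ### Construction of the adapted frame -/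

namespace TorsionKY

variable {E : Type*} [NormedAddCommGroup E] [NormedSpace ℝ E]
  {O : Set E} {g : E → E →L[ℝ] E →L[ℝ] ℝ} {A : E → E →L[ℝ] E}
  {Γ : E → E →L[ℝ] E →L[ℝ] E} {z : E → E}

namespace LocalEigen

variable {n : ℕ} {x : Fin n → E → ℝ}

/-- The norm of the gradient of `x_μ`. -/
noncomputable def gradNorm (g : E → E →L[ℝ] E →L[ℝ] ℝ) (x : Fin n → E → ℝ) (μ : Fin n) (y : E) :
    ℝ := √(g y (metricGrad g (x μ) y) (metricGrad g (x μ) y))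

theorem inner_grad_self (H : LocalPKY O g A Γ z) {y : E} (hy : y ∈ O)
    (μ : Fin n) : g y (metricGrad g (x μ) y) (metricGrad g (x μ) y) = gradNorm g x μ y ^ 2 :=
  (Real.sq_sqrt (H.nonneg hy _)).symm

end LocalEigen

theorem LocalPKY.mono (H : LocalPKY O g A Γ z) {O' : Set E} (hO' : O' ⊆ O) (h : IsOpen O') :
    LocalPKY O' g A Γ z :=
  ⟨h, H.smooth_metric.mono hO', H.smooth_endo.mono hO', H.continuousOn_conn.mono hO',
    H.continuousOn_z.mono hO', fun y hy => H.symm y (hO' hy), fun y hy => H.pos y (hO' hy),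
    fun y hy => H.skew y (hO' hy), fun y hy => H.compat y (hO' hy),
    fun y hy => H.torsion y (hO' hy), fun y hy => H.deriv_endo y (hO' hy)⟩

theorem LocalEigen.mono {n : ℕ} {x : Fin n → E → ℝ} (X : LocalEigen O A x) {O' : Set E}
    (hO' : O' ⊆ O) : LocalEigen O' A x :=
  ⟨fun μ => (X.smooth_x μ).mono hO', fun y hy => X.x_ne y (hO' hy),
    fun y hy => X.det y (hO' hy), fun y hy => X.indep y (hO' hy)⟩

variable [FiniteDimensional ℝ E]

/-- A vector orthogonal to `dim E` pairwise orthogonal non-zero vectors vanishes. -/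
theorem LocalPKY.eq_zero_of_orthogonal (H : LocalPKY O g A Γ z) {y : E} (hy : y ∈ O) {ι : Type*}
    [Fintype ι] (hι : Module.finrank ℝ E ≤ Fintype.card ι) {e : ι → E} (he : ∀ i, e i ≠ 0)
    (hort : ∀ i j, i ≠ j → g y (e i) (e j) = 0) {v : E} (hv : ∀ i, g y (e i) v = 0) : v = 0 := by
  classical
  by_contra hne
  let f : Option ι → E := fun o => o.elim v e
  have hf0 : ∀ o, f o ≠ 0 := by rintro (_ | i); exacts [hne, he i]
  have hfo : ∀ o o', o ≠ o' → g y (f o) (f o') = 0 := by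
    rintro (_ | i) (_ | j) h
    · exact absurd rfl h
    · rw [H.symm y hy]; exact hv j
    · exact hv i
    · exact hort i j fun e => h (by rw [e])
  have hli : LinearIndependent ℝ f := by
    refine Fintype.linearIndependent_iff.2 fun c hc o => ?_
    have h1 := congrArg (g y (f o)) hc
    rw [map_sum, map_zero, Finset.sum_eq_single o] at h1
    · rw [map_smul, smul_eq_mul] at h1
      exact (mul_eq_zero.1 h1).resolve_right (H.pos y hy _ (hf0 o)).ne'
    · intro o' _ h
      rw [map_smul, hfo o o' h.symm, smul_zero]
    · simp
  have := hli.fintype_card_le_finrank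
  rw [Fintype.card_option] at this
  omega

theorem LocalPKY.exists_orthogonal (g₀ : E →L[ℝ] E →L[ℝ] ℝ) {ι : Type*}
    [Fintype ι] (hι : Fintype.card ι < Module.finrank ℝ E) (e : ι → E) :
    ∃ v, v ≠ 0 ∧ ∀ i, g₀ (e i) v = 0 := by
  have h := LinearMap.ker_ne_bot_of_finrank_lt
    (f := LinearMap.pi fun i => (g₀ (e i) : E →ₗ[ℝ] ℝ)) (by simpa using hι)
  obtain ⟨v, hv, hv0⟩ := Submodule.exists_mem_ne_zero_of_ne_bot h
  exact ⟨v, hv0, fun i => congrFun (LinearMap.mem_ker.1 hv) i⟩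

namespace LocalEigen

variable {n : ℕ} {x : Fin n → E → ℝ}

/-- The gradient form of `fderiv_x_of_injective`, extended by continuity to points where eigenvalues
coincide. -/
theorem endo_endo_grad (H : LocalPKY O g A Γ z) (X : LocalEigen O A x) {y : E} (hy : y ∈ O)
    (μ : Fin n) : A y (A y (metricGrad g (x μ) y)) = -(x μ y ^ 2) • metricGrad g (x μ) y := by
  have hN := (H.smooth_metricGrad (X.smooth_x μ)).continuousOn
  have hA := H.smooth_endo.continuousOn
  refine X.eqOn_of_injective H (hA.clm_apply (hA.clm_apply hN))
    ((((X.smooth_x μ).continuousOn.pow 2).neg).smul hN) (fun y hy hinj => ?_) hy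
  refine H.ext_inner hy fun w => ?_
  change _ = g y w (-(x μ y ^ 2) • metricGrad g (x μ) y)
  rw [map_smul, H.symm y hy, H.skew y hy, H.skew y hy, neg_neg, H.inner_metricGrad hy,
    (X.fderiv_x_of_injective H hy hinj w).1 μ, H.symm y hy, H.inner_metricGrad hy, smul_eq_mul]
  ring

theorem endo_z (H : LocalPKY O g A Γ z) (X : LocalEigen O A x) {y : E} (hy : y ∈ O) :
    A y (z y) = ∑ μ, x μ y • metricGrad g (x μ) y := by
  have hN := fun μ => (H.smooth_metricGrad (X.smooth_x μ)).continuousOn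
  have hA := H.smooth_endo.continuousOn
  refine X.eqOn_of_injective H (hA.clm_apply H.continuousOn_z)
    (continuousOn_finsetSum _ fun μ _ => (X.smooth_x μ).continuousOn.smul (hN μ))
    (fun y hy hinj => ?_) hy
  refine H.ext_inner hy fun w => ?_
  rw [map_sum, H.symm y hy, H.skew y hy, ← (X.fderiv_x_of_injective H hy hinj w).2]
  refine Finset.sum_congr rfl fun μ _ => ?_
  change _ = g y w (x μ y • metricGrad g (x μ) y)
  rw [map_smul, H.symm y hy, H.inner_metricGrad hy, smul_eq_mul]

theorem inner_grad_grad (H : LocalPKY O g A Γ z) (X : LocalEigen O A x) {y : E} (hy : y ∈ O)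
    {μ ν : Fin n} (h : μ ≠ ν) : g y (metricGrad g (x μ) y) (metricGrad g (x ν) y) = 0 := by
  have hN := fun μ => (H.smooth_metricGrad (X.smooth_x μ)).continuousOn
  refine X.eqOn_of_injective H ((H.smooth_metric.continuousOn.clm_apply (hN μ)).clm_apply (hN ν))
    continuousOn_const (fun y hy hinj => ?_) hy
  exact LocalFrame.inner_eq_zero_of_eigen H hy (X.endo_endo_grad H hy μ) (X.endo_endo_grad H hy ν)
    fun e => h (hinj e)

/-- For `μ = ν` this is skewness of `A`. Otherwise the vectors belong to different eigenspaces of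
`A²` when the eigenvalues are distinct, and continuity does the rest. -/
theorem inner_grad_endo_grad (H : LocalPKY O g A Γ z) (X : LocalEigen O A x) {y : E} (hy : y ∈ O)
    (μ ν : Fin n) : g y (metricGrad g (x μ) y) (A y (metricGrad g (x ν) y)) = 0 := by
  by_cases h : μ = ν
  · rw [h, H.inner_endo_self hy]
  have hN := fun μ => (H.smooth_metricGrad (X.smooth_x μ)).continuousOn
  have hA := H.smooth_endo.continuousOn
  refine X.eqOn_of_injective H ((H.smooth_metric.continuousOn.clm_apply (hN μ)).clm_apply
    (hA.clm_apply (hN ν))) continuousOn_const (fun y hy hinj => ?_) hy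
  exact LocalFrame.inner_eq_zero_of_eigen H hy (X.endo_endo_grad H hy μ)
    (by rw [X.endo_endo_grad H hy ν, map_smul]) fun e => h (hinj e)

/-- The unit vector proportional to `-x_μ A grad x_μ`. -/
noncomputable def hatVec (g : E → E →L[ℝ] E →L[ℝ] ℝ) (A : E → E →L[ℝ] E) (x : Fin n → E → ℝ)
    (μ : Fin n) (y : E) : E :=
  -(x μ y * gradNorm g x μ y)⁻¹ • A y (metricGrad g (x μ) y)

theorem grad_ne_zero (H : LocalPKY O g A Γ z) (X : LocalEigen O A x) {y : E} (hy : y ∈ O)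
    (μ : Fin n) : metricGrad g (x μ) y ≠ 0 := by
  intro h
  refine (X.indep y hy).ne_zero μ ?_
  ext v
  rw [← H.inner_metricGrad hy, h]
  simp

theorem gradNorm_pos (H : LocalPKY O g A Γ z) (X : LocalEigen O A x) {y : E} (hy : y ∈ O)
    (μ : Fin n) : 0 < gradNorm g x μ y :=
  Real.sqrt_pos.2 (H.pos y hy _ (X.grad_ne_zero H hy μ))

theorem smooth_gradNorm (H : LocalPKY O g A Γ z) (X : LocalEigen O A x) (μ : Fin n) :
    ContDiffOn ℝ ∞ (gradNorm g x μ) O := by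
  have hN := H.smooth_metricGrad (X.smooth_x μ)
  exact ((H.smooth_metric.clm_apply hN).clm_apply hN).sqrt
    fun y hy => (H.pos y hy _ (X.grad_ne_zero H hy μ)).ne'

theorem x_mul_gradNorm_ne (H : LocalPKY O g A Γ z) (X : LocalEigen O A x) {y : E} (hy : y ∈ O)
    (μ : Fin n) : x μ y * gradNorm g x μ y ≠ 0 :=
  mul_ne_zero (X.x_ne y hy μ) (X.gradNorm_pos H hy μ).ne'

theorem smooth_hatVec (H : LocalPKY O g A Γ z) (X : LocalEigen O A x) (μ : Fin n) :
    ContDiffOn ℝ ∞ (hatVec g A x μ) O :=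
  (((X.smooth_x μ).mul (X.smooth_gradNorm H μ)).inv
    fun _ hy => X.x_mul_gradNorm_ne H hy μ).neg.smul
    (H.smooth_endo.clm_apply (H.smooth_metricGrad (X.smooth_x μ)))

theorem endo_grad (H : LocalPKY O g A Γ z) (X : LocalEigen O A x) {y : E} (hy : y ∈ O)
    (μ : Fin n) : A y (metricGrad g (x μ) y) =
      -(x μ y * gradNorm g x μ y) • hatVec g A x μ y := by
  rw [hatVec, smul_smul, neg_mul_neg, mul_inv_cancel₀ (X.x_mul_gradNorm_ne H hy μ), one_smul]

theorem endo_hatVec (H : LocalPKY O g A Γ z) (X : LocalEigen O A x) {y : E} (hy : y ∈ O)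
    (μ : Fin n) : A y (hatVec g A x μ y) =
      (x μ y / gradNorm g x μ y) • metricGrad g (x μ) y := by
  rw [hatVec, map_smul, X.endo_endo_grad H hy, smul_smul, neg_mul_neg]
  congr 1
  have := X.x_ne y hy μ
  have := (X.gradNorm_pos H hy μ).ne'
  field_simp

theorem inner_grad_hatVec (H : LocalPKY O g A Γ z) (X : LocalEigen O A x) {y : E} (hy : y ∈ O)
    (μ ν : Fin n) : g y (metricGrad g (x μ) y) (hatVec g A x ν y) = 0 := by
  rw [hatVec, map_smul, X.inner_grad_endo_grad H hy, smul_zero]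

theorem inner_hatVec_hatVec (H : LocalPKY O g A Γ z) (X : LocalEigen O A x) {y : E} (hy : y ∈ O)
    (μ ν : Fin n) : g y (hatVec g A x μ y) (hatVec g A x ν y) = if μ = ν then 1 else 0 := by
  have h1 : g y (hatVec g A x μ y) (hatVec g A x ν y) =
      (x μ y * gradNorm g x μ y)⁻¹ * (x ν y / gradNorm g x ν y *
        g y (metricGrad g (x μ) y) (metricGrad g (x ν) y)) := by
    conv_lhs => rw [hatVec]
    rw [map_smul, smul_apply, H.skew y hy, X.endo_hatVec H hy, map_smul, smul_eq_mul, smul_eq_mul]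
    ring
  rw [h1]
  split_ifs with h
  · subst h
    have := X.x_ne y hy μ
    have := (X.gradNorm_pos H hy μ).ne'
    rw [inner_grad_self H hy]
    field_simp
  · rw [X.inner_grad_grad H hy h, mul_zero, mul_zero]

/-- Pairing `A z = ∑ x_ν grad x_ν` with `A grad x_μ` gives zero by `inner_grad_endo_grad`, whereas
skewness turns the same pairing into `x_μ² g(z, grad x_μ)`. -/
theorem inner_z_grad (H : LocalPKY O g A Γ z) (X : LocalEigen O A x) {y : E} (hy : y ∈ O)
    (μ : Fin n) : g y (z y) (metricGrad g (x μ) y) = 0 := by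
  have h1 := H.skew y hy (z y) (A y (metricGrad g (x μ) y))
  rw [X.endo_z H hy, X.endo_endo_grad H hy, map_smul, smul_eq_mul, map_sum, sum_apply,
    Finset.sum_eq_zero fun ν _ => by
      rw [map_smul, smul_apply, X.inner_grad_endo_grad H hy, smul_zero]] at h1
  have := pow_ne_zero 2 (X.x_ne y hy μ)
  simpa [this] using h1

/-- The sign in `hatVec` is chosen for this: the component of `ξ`, later `√Q_μ`, is positive
whatever the sign of `x μ`. -/
theorem inner_z_hatVec (H : LocalPKY O g A Γ z) (X : LocalEigen O A x) {y : E} (hy : y ∈ O)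
    (μ : Fin n) : g y (z y) (hatVec g A x μ y) = gradNorm g x μ y := by
  have h1 : g y (z y) (A y (metricGrad g (x μ) y)) = -(x μ y * gradNorm g x μ y ^ 2) := by
    have h2 := H.skew y hy (z y) (metricGrad g (x μ) y)
    rw [X.endo_z H hy, map_sum, sum_apply, Finset.sum_eq_single μ] at h2
    · rw [map_smul, smul_apply, inner_grad_self H hy, smul_eq_mul] at h2
      linarith
    · intro ν _ h
      rw [map_smul, smul_apply, X.inner_grad_grad H hy h, smul_zero]
    · simp
  rw [hatVec, map_smul, h1, smul_eq_mul]
  have := X.x_ne y hy μ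
  have := (X.gradNorm_pos H hy μ).ne'
  field_simp

variable {ε : ℕ}

/-- Unit vector fields spanning the kernel of `A`. -/
theorem exists_kernel_frame (H : LocalPKY O g A Γ z) (X : LocalEigen O A x)
    (hdim : Module.finrank ℝ E = 2 * n + ε) (hε : ε ≤ 1) {p : E} (hp : p ∈ O) :
    ∃ O' ⊆ O, IsOpen O' ∧ p ∈ O' ∧ ∃ G : Fin ε → E → E, (∀ a, ContDiffOn ℝ ∞ (G a) O') ∧
      ∀ y ∈ O', (∀ a, g y (G a y) (G a y) = 1) ∧
        (∀ a μ, g y (metricGrad g (x μ) y) (G a y) = 0) ∧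
        ∀ a μ, g y (hatVec g A x μ y) (G a y) = 0 := by
  interval_cases ε
  · exact ⟨O, subset_rfl, H.isOpen, hp, fun a => a.elim0, fun a => a.elim0,
      fun y _ => ⟨fun a => a.elim0, fun a => a.elim0, fun a => a.elim0⟩⟩
  obtain ⟨v, hv0, hv⟩ := LocalPKY.exists_orthogonal (g p) (ι := Fin n ⊕ Fin n)
    (by rw [hdim]; simp; omega)
    (Sum.elim (fun μ => metricGrad g (x μ) p) fun μ => hatVec g A x μ p)
  have hN := fun μ => H.smooth_metricGrad (X.smooth_x μ)
  have hF := X.smooth_hatVec H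
  -- `v` is projected off the `2n` known fields. At `p` nothing is subtracted, so `W` is non-zero
  -- near `p` and can be normalised there.
  set W : E → E := fun y => v -
    (∑ μ, ((gradNorm g x μ y ^ 2)⁻¹ * g y (metricGrad g (x μ) y) v) • metricGrad g (x μ) y +
      ∑ μ, g y (hatVec g A x μ y) v • hatVec g A x μ y) with hW
  have hWs : ContDiffOn ℝ ∞ W O := by
    refine contDiffOn_const.sub ((ContDiffOn.sum fun μ _ => ?_).add (ContDiffOn.sum fun μ _ => ?_))
    · exact ((((X.smooth_gradNorm H μ).pow 2).inv fun y hy =>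
        pow_ne_zero 2 (X.gradNorm_pos H hy μ).ne').mul
          ((H.smooth_metric.clm_apply (hN μ)).clm_apply contDiffOn_const)).smul (hN μ)
    · exact ((H.smooth_metric.clm_apply (hF μ)).clm_apply contDiffOn_const).smul (hF μ)
  have hWp : W p = v := by
    have h1 : ∀ μ, g p (metricGrad g (x μ) p) v = 0 := fun μ => hv (.inl μ)
    have h2 : ∀ μ, g p (hatVec g A x μ p) v = 0 := fun μ => hv (.inr μ)
    simp [hW, h1, h2]
  have hWN : ∀ y ∈ O, ∀ μ, g y (metricGrad g (x μ) y) (W y) = 0 := by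
    intro y hy μ
    simp only [hW, map_sub, map_add, map_sum, map_smul, smul_eq_mul, X.inner_grad_hatVec H hy,
      mul_zero, Finset.sum_const_zero, add_zero]
    rw [Finset.sum_eq_single μ, inner_grad_self H hy]
    · have := (X.gradNorm_pos H hy μ).ne'
      field_simp
      ring
    · intro ν _ h
      rw [X.inner_grad_grad H hy h.symm, mul_zero]
    · simp
  have hWF : ∀ y ∈ O, ∀ μ, g y (hatVec g A x μ y) (W y) = 0 := by
    intro y hy μ
    have h1 : ∀ ν, g y (hatVec g A x μ y) (metricGrad g (x ν) y) = 0 := fun ν => by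
      rw [H.symm y hy, X.inner_grad_hatVec H hy]
    simp [hW, h1, X.inner_hatVec_hatVec H hy]
  refine ⟨O ∩ W ⁻¹' {0}ᶜ, Set.inter_subset_left,
    hWs.continuousOn.isOpen_inter_preimage H.isOpen isOpen_compl_singleton,
    ⟨hp, by simpa [hWp] using hv0⟩, fun _ y => (√(g y (W y) (W y)))⁻¹ • W y, fun _ => ?_, ?_⟩
  · have hWs' := hWs.mono (Set.inter_subset_left (t := W ⁻¹' {0}ᶜ))
    have hg := H.smooth_metric.mono (Set.inter_subset_left (t := W ⁻¹' {0}ᶜ))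
    have hpos : ∀ y ∈ O ∩ W ⁻¹' {0}ᶜ, 0 < g y (W y) (W y) := fun y hy => H.pos y hy.1 _ hy.2
    exact ((((hg.clm_apply hWs').clm_apply hWs').sqrt fun y hy => (hpos y hy).ne').inv
      fun y hy => (Real.sqrt_pos.2 (hpos y hy)).ne').smul hWs'
  · rintro y ⟨hy, hy0⟩
    refine ⟨fun _ => ?_, fun _ μ => ?_, fun _ μ => ?_⟩
    · have h1 := H.pos y hy _ hy0
      have h2 := Real.sq_sqrt h1.le
      have h3 := (Real.sqrt_pos.2 h1).ne'
      rw [map_smul, map_smul, smul_apply, smul_eq_mul, smul_eq_mul]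
      field_simp
      exact h2.symm
    · rw [map_smul, hWN y hy, smul_zero]
    · rw [map_smul, hWF y hy, smul_zero]

/-- Distinct eigenvalues are not required, so canonical frames arise at every point; only
`LocalFrame` asks for distinctness. -/
theorem exists_adaptedFrame (H : LocalPKY O g A Γ z) (X : LocalEigen O A x)
    (hdim : Module.finrank ℝ E = 2 * n + ε) (hε : ε ≤ 1) {p : E} (hp : p ∈ O) :
    ∃ O' ⊆ O, IsOpen O' ∧ p ∈ O' ∧ ∃ (q : Fin n → E → ℝ) (N : Fin n → E → E)
      (F : Fin n ⊕ Fin ε → E → E), AdaptedFrame O' g A z x q N F := by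
  obtain ⟨O', hO', hopen, hp', G, hGs, hG⟩ := X.exists_kernel_frame H hdim hε hp
  refine ⟨O', hO', hopen, hp', gradNorm g x, fun μ => metricGrad g (x μ),
    Sum.elim (hatVec g A x) G, ?_⟩
  have hGG : ∀ y ∈ O', ∀ a b, g y (G a y) (G b y) = if a = b then 1 else 0 := by
    intro y hy a b
    have : a = b := Fin.ext (by omega)
    rw [this, if_pos rfl, (hG y hy).1]
  have hFF : ∀ y ∈ O', ∀ i j, g y (Sum.elim (hatVec g A x) G i y)
      (Sum.elim (hatVec g A x) G j y) = if i = j then 1 else 0 := by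
    rintro y hy (μ | a) (ν | b)
    · simpa using X.inner_hatVec_hatVec H (hO' hy) μ ν
    · simpa using (hG y hy).2.2 b μ
    · rw [H.symm y (hO' hy)]
      simpa using (hG y hy).2.2 a ν
    · simpa using hGG y hy a b
  have hNF : ∀ y ∈ O', ∀ μ i, g y (metricGrad g (x μ) y)
      (Sum.elim (hatVec g A x) G i y) = 0 := by
    rintro y hy μ (ν | a)
    · exact X.inner_grad_hatVec H (hO' hy) μ ν
    · exact (hG y hy).2.1 a μ
  have hcomp : ∀ y ∈ O', ∀ v, (∀ i, g y (Sum.elim (hatVec g A x) G i y) v = 0) →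
      (∀ μ, g y (metricGrad g (x μ) y) v = 0) → v = 0 := by
    intro y hy v hF hN
    refine H.eq_zero_of_orthogonal (hO' hy) (ι := Fin n ⊕ (Fin n ⊕ Fin ε))
      (e := Sum.elim (fun μ => metricGrad g (x μ) y) fun i => Sum.elim (hatVec g A x) G i y)
      (by rw [hdim]; simp; omega) ?_ ?_ ?_
    · rintro (μ | i) h
      · exact X.grad_ne_zero H (hO' hy) μ h
      · have := hFF y hy i i
        rw [if_pos rfl] at this
        simp only [Sum.elim_inr] at h
        rw [h] at this
        simp at this
    · rintro (μ | i) (ν | j) h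
      · exact X.inner_grad_grad H (hO' hy) fun e => h (by rw [e])
      · exact hNF y hy μ j
      · rw [H.symm y (hO' hy)]
        exact hNF y hy ν i
      · exact (hFF y hy i j).trans (if_neg fun e => h (by rw [e]))
    · rintro (μ | i)
      · exact hN μ
      · exact hF i
  refine ⟨fun μ => (X.smooth_x μ).mono hO',
    fun μ => (H.smooth_metricGrad (X.smooth_x μ)).mono hO', ?_, fun y hy => X.x_ne y (hO' hy),
    fun y hy => X.gradNorm_pos H (hO' hy), fun y hy => inner_grad_self H (hO' hy),
    fun y hy μ v => (H.inner_metricGrad (hO' hy) _ v).symm,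
    fun y hy μ ν => X.inner_grad_grad H (hO' hy), hFF, hNF,
    fun y hy => X.inner_z_grad H (hO' hy), fun y hy => X.inner_z_hatVec H (hO' hy),
    fun y hy => X.endo_grad H (hO' hy), fun y hy => X.endo_hatVec H (hO' hy), ?_, hcomp⟩
  · rintro (μ | a)
    · exact (X.smooth_hatVec H μ).mono hO'
    · exact hGs a
  -- The image under `A` of the kernel field is orthogonal to the whole frame: skewness moves `A`
  -- onto the gradients and hatted fields, which it exchanges up to scalars, and `ε ≤ 1` leaves no
  -- other kernel field.
  · intro y hy a
    refine hcomp y hy _ ?_ fun μ => ?_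
    · rintro (μ | b)
      · rw [← neg_eq_zero, ← H.skew y (hO' hy), Sum.elim_inl, X.endo_hatVec H (hO' hy), map_smul,
          smul_apply, hNF y hy, smul_zero]
      · have : a = b := Fin.ext (by omega)
        rw [this, H.inner_endo_self (hO' hy)]
    · rw [← neg_eq_zero, ← H.skew y (hO' hy), X.endo_grad H (hO' hy), map_smul,
        smul_apply, Sum.elim_inr, (hG y hy).2.2, smul_zero]

end LocalEigen

/-- The generating functions of the Killing tensors commute under the Schouten–Nijenhuis
bracket. -/
theorem LocalEigen.bracketTerm_comm {n ε : ℕ} {x : Fin n → E → ℝ} (H : LocalPKY O g A Γ z)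
    (X : LocalEigen O A x) (hdim : Module.finrank ℝ E = 2 * n + ε) (hε : ε ≤ 1) {y : E}
    (hy : y ∈ O) (s r : ℝ) (u : E) :
    LocalPKY.bracketTerm g A Γ y s r u = LocalPKY.bracketTerm g A Γ y r s u := by
  rw [← sub_eq_zero, H.bracketTerm_sub hy]
  suffices h : g y (torsionVec (Γ y) (resolvent (A y) s u) u) (resolvent (A y) r u) = 0 by
    rw [h, mul_zero, mul_zero]
  have hB := fun s => (H.smooth_resolvent s).continuousOn
  have hBu : ∀ s, ContinuousOn (fun y => resolvent (A y) s u) O := fun s =>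
    (hB s).clm_apply continuousOn_const
  have hτ : ContinuousOn (fun y => torsionVec (Γ y) (resolvent (A y) s u) u) O :=
    ((H.continuousOn_conn.clm_apply (hBu s)).clm_apply continuousOn_const).sub
      ((H.continuousOn_conn.clm_apply continuousOn_const).clm_apply (hBu s))
  -- Continuity reduces the claim to points with distinct eigenvalues. Distinctness persists nearby,
  -- and this makes the adapted frame a `LocalFrame`.
  refine X.eqOn_of_injective H ((H.smooth_metric.continuousOn.clm_apply hτ).clm_apply (hBu r))
    continuousOn_const (fun y hy hinj => ?_) hy
  obtain ⟨V, hVO, hV, hyV, hVinj⟩ : ∃ V ⊆ O, IsOpen V ∧ y ∈ V ∧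
      ∀ w ∈ V, Function.Injective fun μ => x μ w ^ 2 := by
    have h1 : ∀ᶠ w in nhds y, ∀ μ ν, μ ≠ ν → x μ w ^ 2 ≠ x ν w ^ 2 := by
      refine Filter.eventually_all.2 fun μ => Filter.eventually_all.2 fun ν => ?_
      by_cases h : μ = ν
      · simp [h]
      · have hc := fun μ => ((X.differentiableAt_x H hy μ).continuousAt.pow 2)
        exact (((hc μ).sub (hc ν)).eventually_ne (sub_ne_zero.2 fun e => h (hinj e))).mono
          fun _ e _ => sub_ne_zero.1 e
    obtain ⟨V, hV, hVo, hyV⟩ := eventually_nhds_iff.1 (h1.and (H.isOpen.mem_nhds hy))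
    refine ⟨V, fun w hw => (hV w hw).2, hVo, hyV, fun w hw μ ν e => ?_⟩
    by_contra hne
    exact (hV w hw).1 μ ν hne e
  obtain ⟨O', hO', hopen, hp', q, N, F, L⟩ :=
    (X.mono hVO).exists_adaptedFrame (H.mono hVO hV) hdim hε hyV
  have L' : LocalFrame O' g A z x q N F := by
    refine ⟨L, fun w hw => ?_⟩
    rintro (μ | a) (ν | b) h
    · exact congrArg Sum.inl (hVinj w (hO' hw) h)
    · exact absurd h (pow_ne_zero 2 (L.x_ne w hw μ))
    · exact absurd h.symm (pow_ne_zero 2 (L.x_ne w hw ν))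
    · exact congrArg Sum.inr (Fin.ext (by omega))
  exact L'.torsion_resolvent (H.mono (hO'.trans hVO) hopen) hp' s r u

end TorsionKY

/-! ### Metric and forms in a chart -/

namespace TorsionKY

section ChartTransport

variable {D : ℕ} {M : Type*} [TopologicalSpace M] [ChartedSpace (EuclideanSpace ℝ (Fin D)) M]
  {φ : OpenPartialHomeomorph M (EuclideanSpace ℝ (Fin D))}

/-- The differential of the inverse of the chart `φ`. -/
noncomputable def chartDiff (φ : OpenPartialHomeomorph M (EuclideanSpace ℝ (Fin D)))
    (y : EuclideanSpace ℝ (Fin D)) :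
    EuclideanSpace ℝ (Fin D) →L[ℝ] TangentSpace (𝓡 D) (φ.symm y) :=
  mfderiv (𝓡 D) (𝓡 D) φ.symm y

theorem coordVec_eq (y : EuclideanSpace ℝ (Fin D)) (i : Fin D) :
    coordVec φ y i = chartDiff φ y (EuclideanSpace.single i 1) := rfl

theorem euclidean_eq_sum (u : EuclideanSpace ℝ (Fin D)) :
    u = ∑ i, u i • EuclideanSpace.single i (1 : ℝ) := by
  ext j
  simp [Finset.sum_apply, Pi.single_apply]

theorem chartDiff_eq_sum (y u : EuclideanSpace ℝ (Fin D)) :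
    chartDiff φ y u = ∑ i, u i • coordVec φ y i := by
  conv_lhs => rw [euclidean_eq_sum u]
  simp only [map_sum, map_smul, coordVec_eq]

variable [IsManifold (𝓡 D) ∞ M]

theorem exists_chartDiff_equiv (hφ : φ ∈ atlas (EuclideanSpace ℝ (Fin D)) M)
    {y : EuclideanSpace ℝ (Fin D)} (hy : y ∈ φ.target) :
    ∃ e : EuclideanSpace ℝ (Fin D) ≃L[ℝ] TangentSpace (𝓡 D) (φ.symm y),
      ∀ u, e u = chartDiff φ y u := by
  have : IsManifold (𝓡 D) 1 M := IsManifold.of_le (n := ∞) (by simp)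
  have h := (mdifferentiable_of_mem_atlas (I := 𝓡 D) hφ).symm
  exact ⟨h.mfderiv hy, fun u => rfl⟩

theorem contMDiffOn_chart_symm (hφ : φ ∈ atlas (EuclideanSpace ℝ (Fin D)) M) :
    ContMDiffOn (𝓡 D) (𝓡 D) ∞ φ.symm φ.target :=
  contMDiffOn_symm_of_mem_maximalAtlas (IsManifold.subset_maximalAtlas hφ)

theorem contMDiffOn_coordVec (hφ : φ ∈ atlas (EuclideanSpace ℝ (Fin D)) M) (i : Fin D) :
    ContMDiffOn (𝓡 D) (𝓡 D).tangent ∞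
      (fun y => (⟨φ.symm y, coordVec φ y i⟩ : TangentBundle (𝓡 D) M)) φ.target := by
  have h1 := (contMDiffOn_chart_symm hφ).contMDiffOn_tangentMapWithin (m := ∞) (by simp)
    φ.open_target.uniqueMDiffOn
  have h2 : ContMDiff (𝓡 D) (𝓡 D).tangent ∞ (fun y : EuclideanSpace ℝ (Fin D) =>
      (⟨y, EuclideanSpace.single i (1 : ℝ)⟩ : TangentBundle (𝓡 D) (EuclideanSpace ℝ (Fin D)))) :=
    contMDiff_vectorSpace_iff_contDiff.2 contDiff_const
  refine (h1.comp h2.contMDiffOn (s := φ.target) fun y hy => hy).congr fun y hy => ?_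
  simp only [Function.comp_apply, tangentMapWithin]
  rw [mfderivWithin_of_isOpen φ.open_target hy]
  rfl

theorem contDiffOn_metricComp (g : Metric D M) (hφ : φ ∈ atlas (EuclideanSpace ℝ (Fin D)) M)
    (i j : Fin D) : ContDiffOn ℝ ∞ (fun y => metricComp g φ y i j) φ.target := by
  rw [← contMDiffOn_iff_contDiffOn]
  have h1 : ContMDiffOn (𝓡 D) ((𝓡 D).prod 𝓘(ℝ, ℝ)) ∞
      (fun y => Bundle.TotalSpace.mk' ℝ (E := Bundle.Trivial M ℝ) (φ.symm y)
        (g.inner (φ.symm y) (coordVec φ y i) (coordVec φ y j))) φ.target := by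
    refine ContMDiffOn.clm_bundle_apply₂ (F₁ := EuclideanSpace ℝ (Fin D))
      (F₂ := EuclideanSpace ℝ (Fin D)) ?_ (contMDiffOn_coordVec hφ i) (contMDiffOn_coordVec hφ j)
    exact g.contMDiff.comp_contMDiffOn (contMDiffOn_chart_symm hφ)
  intro y hy
  have h2 := h1 y hy
  simp only [Bundle.contMDiffWithinAt_totalSpace] at h2
  exact h2.2

theorem inner_chartDiff (g : Metric D M) (y u v : EuclideanSpace ℝ (Fin D)) :
    g.inner (φ.symm y) (chartDiff φ y u) (chartDiff φ y v) =
      ∑ i, ∑ j, metricComp g φ y i j * (u i * v j) := by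
  simp only [chartDiff_eq_sum, map_sum, map_smul, sum_apply,
    smul_apply, smul_eq_mul, metricComp, Matrix.of_apply]
  rw [Finset.sum_comm]
  refine Finset.sum_congr rfl fun j _ => ?_
  rw [Finset.mul_sum]
  exact Finset.sum_congr rfl fun i _ => by rw [metric_symm]; ring

end ChartTransport

section TwoForm

variable {V : Type*} [AddCommGroup V] [Module ℝ V]

theorem twoForm_swap (h : V [⋀^Fin 2]→ₗ[ℝ] ℝ) (u v : V) : h ![u, v] = -h ![v, u] := by
  have := h.map_swap ![v, u] (i := 0) (j := 1) (by simp)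
  rw [← this]
  congr 1
  ext k
  fin_cases k <;> simp

/-- A 2-form as a bilinear form. -/
noncomputable def twoFormBilin (h : V [⋀^Fin 2]→ₗ[ℝ] ℝ) : V →ₗ[ℝ] V →ₗ[ℝ] ℝ :=
  LinearMap.mk₂ ℝ (fun u v => h ![u, v])
    (fun u u' v => h.map_vecCons_add _ u u') (fun c u v => h.map_vecCons_smul _ c u)
    (fun u v v' => by
      rw [twoForm_swap, twoForm_swap h u v, twoForm_swap h u v', h.map_vecCons_add, neg_add])
    (fun c u v => by
      rw [twoForm_swap, twoForm_swap h u v, h.map_vecCons_smul, smul_neg])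

@[simp]
theorem twoFormBilin_apply (h : V [⋀^Fin 2]→ₗ[ℝ] ℝ) (u v : V) : twoFormBilin h u v = h ![u, v] :=
  rfl

theorem threeForm_swap_left (T : V [⋀^Fin 3]→ₗ[ℝ] ℝ) (u v w : V) :
    T ![u, v, w] = -T ![v, u, w] := by
  have := T.map_swap ![v, u, w] (i := 0) (j := 1) (by simp)
  rw [← this]
  congr 1
  ext k
  fin_cases k <;> simp [Equiv.swap_apply_def]

theorem threeForm_swap_right (T : V [⋀^Fin 3]→ₗ[ℝ] ℝ) (u v w : V) :
    T ![u, v, w] = -T ![u, w, v] := by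
  have := T.map_swap ![u, w, v] (i := 1) (j := 2) (by simp)
  rw [← this]
  congr 1
  ext k
  fin_cases k <;> simp [Equiv.swap_apply_def]

end TwoForm

section FormComponents

variable {D : ℕ} {M : Type*} [TopologicalSpace M] [ChartedSpace (EuclideanSpace ℝ (Fin D)) M]
  {φ : OpenPartialHomeomorph M (EuclideanSpace ℝ (Fin D))}

theorem comp_two_eq (S : TensorField D M 2) (y : EuclideanSpace ℝ (Fin D)) (i j : Fin D) :
    comp S φ y ![i, j] = S (φ.symm y) ![coordVec φ y i, coordVec φ y j] := by
  rw [comp]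
  congr 1
  ext k
  fin_cases k <;> rfl

theorem comp_three_eq (S : TensorField D M 3) (y : EuclideanSpace ℝ (Fin D)) (i j k : Fin D) :
    comp S φ y ![i, j, k] =
      S (φ.symm y) ![coordVec φ y i, coordVec φ y j, coordVec φ y k] := by
  rw [comp]
  congr 1
  ext l
  fin_cases l <;> rfl

theorem form_chartDiff (h : FormField D M 2) (y u v : EuclideanSpace ℝ (Fin D)) :
    h (φ.symm y) ![chartDiff φ y u, chartDiff φ y v] =
      ∑ i, ∑ j, comp (toTensor h) φ y ![i, j] * (u i * v j) := by
  rw [← twoFormBilin_apply]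
  simp only [chartDiff_eq_sum, map_sum, map_smul, LinearMap.sum_apply,
    LinearMap.smul_apply, smul_eq_mul, comp_two_eq, toTensor, twoFormBilin_apply]
  rw [Finset.sum_comm]
  refine Finset.sum_congr rfl fun j _ => ?_
  rw [Finset.mul_sum]
  exact Finset.sum_congr rfl fun i _ => by ring

end FormComponents

end TorsionKY

/-! ### Coordinate data and the principal tensor equation -/

namespace TorsionKY

section Coordinates

variable {D : ℕ}

theorem eq_of_eq_single {F : Type*} [AddCommGroup F] [Module ℝ F]
    {f f' : EuclideanSpace ℝ (Fin D) → F} (hf : IsLinearMap ℝ f) (hf' : IsLinearMap ℝ f')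
    (h : ∀ i, f (EuclideanSpace.single i 1) = f' (EuclideanSpace.single i 1))
    (v : EuclideanSpace ℝ (Fin D)) : f v = f' v := by
  have e : ∀ {f : EuclideanSpace ℝ (Fin D) → F}, IsLinearMap ℝ f →
      f v = ∑ i, v i • f (EuclideanSpace.single i 1) := by
    intro f hf
    have := congrArg (hf.mk' f) (euclidean_eq_sum v)
    simpa only [map_sum, map_smul, IsLinearMap.mk'_apply] using this
  rw [e hf, e hf']
  exact Finset.sum_congr rfl fun i _ => by rw [h]

theorem contDiffOn_sum_sum_smul {E F ι κ : Type*} [NormedAddCommGroup E] [NormedSpace ℝ E]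
    [NormedAddCommGroup F] [NormedSpace ℝ F] [Fintype ι] [Fintype κ] {O : Set E} {k : WithTop ℕ∞}
    {S : E → ι → κ → ℝ} (hS : ∀ i j, ContDiffOn ℝ k (fun y => S y i j) O) (c : ι → κ → F) :
    ContDiffOn ℝ k (fun y => ∑ i, ∑ j, S y i j • c i j) O :=
  ContDiffOn.sum fun i _ => ContDiffOn.sum fun j _ => (hS i j).smul contDiffOn_const

theorem continuousOn_sum_sum_sum_smul {E F ι κ κ' : Type*} [TopologicalSpace E]
    [NormedAddCommGroup F] [NormedSpace ℝ F] [Fintype ι] [Fintype κ] [Fintype κ'] {O : Set E}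
    {S : E → ι → κ → κ' → ℝ} (hS : ∀ i j k, ContinuousOn (fun y => S y i j k) O)
    (c : ι → κ → κ' → F) : ContinuousOn (fun y => ∑ i, ∑ j, ∑ k, S y i j k • c i j k) O :=
  continuousOn_finsetSum _ fun i _ => continuousOn_finsetSum _ fun j _ =>
    continuousOn_finsetSum _ fun k _ => (hS i j k).smul continuousOn_const

theorem fderiv_apply_apply {E F : Type*} [NormedAddCommGroup E] [NormedSpace ℝ E]
    [NormedAddCommGroup F] [NormedSpace ℝ F] {B : E → E →L[ℝ] E →L[ℝ] F} {y : E}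
    (hB : DifferentiableAt ℝ B y) (w u v : E) :
    fderiv ℝ (fun y => B y u v) y w = fderiv ℝ B y w u v := by
  rw [((hB.hasFDerivAt.clm_apply (hasFDerivAt_const u y)).clm_apply
    (hasFDerivAt_const v y)).fderiv]
  simp

/-- The bilinear form with matrix `S`. -/
noncomputable def coordBilin (S : Matrix (Fin D) (Fin D) ℝ) :
    EuclideanSpace ℝ (Fin D) →L[ℝ] EuclideanSpace ℝ (Fin D) →L[ℝ] ℝ :=
  ∑ i, ∑ j, S i j • (EuclideanSpace.proj i : EuclideanSpace ℝ (Fin D) →L[ℝ] ℝ).smulRight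
    (EuclideanSpace.proj j : EuclideanSpace ℝ (Fin D) →L[ℝ] ℝ)

theorem coordBilin_apply (S : Matrix (Fin D) (Fin D) ℝ) (u v : EuclideanSpace ℝ (Fin D)) :
    coordBilin S u v = ∑ i, ∑ j, S i j * (u i * v j) := by
  simp [coordBilin, sum_apply, smul_apply]

theorem coordBilin_single (S : Matrix (Fin D) (Fin D) ℝ) (i j : Fin D) :
    coordBilin S (EuclideanSpace.single i 1) (EuclideanSpace.single j 1) = S i j := by
  simp [coordBilin_apply]

/-- The connection with coefficients `C`. -/
noncomputable def coordConn (C : Fin D → Fin D → Fin D → ℝ) :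
    EuclideanSpace ℝ (Fin D) →L[ℝ] EuclideanSpace ℝ (Fin D) →L[ℝ] EuclideanSpace ℝ (Fin D) :=
  ∑ l, ∑ m, ∑ i, C l m i • (EuclideanSpace.proj m : EuclideanSpace ℝ (Fin D) →L[ℝ] ℝ).smulRight
    ((EuclideanSpace.proj i : EuclideanSpace ℝ (Fin D) →L[ℝ] ℝ).smulRight
      (EuclideanSpace.single l (1 : ℝ)))

theorem coordConn_single (C : Fin D → Fin D → Fin D → ℝ) (m i : Fin D) :
    coordConn C (EuclideanSpace.single m 1) (EuclideanSpace.single i 1) =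
      ∑ l, C l m i • EuclideanSpace.single l (1 : ℝ) := by
  simp [coordConn, sum_apply, smul_apply]

variable {O : Set (EuclideanSpace ℝ (Fin D))}

theorem contDiffOn_coordBilin {S : MetricComp D} {k : WithTop ℕ∞}
    (hS : ∀ i j, ContDiffOn ℝ k (fun y => S y i j) O) :
    ContDiffOn ℝ k (fun y => coordBilin (S y)) O :=
  contDiffOn_sum_sum_smul hS _

theorem continuousOn_coordConn {C : ConnComp D}
    (hC : ∀ l m i, ContinuousOn (fun y => C y l m i) O) :
    ContinuousOn (fun y => coordConn (C y)) O :=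
  continuousOn_sum_sum_sum_smul (ι := Fin D) (κ := Fin D) (κ' := Fin D) (S := C) hC
    fun l m i => (EuclideanSpace.proj m : EuclideanSpace ℝ (Fin D) →L[ℝ] ℝ).smulRight
      ((EuclideanSpace.proj i : EuclideanSpace ℝ (Fin D) →L[ℝ] ℝ).smulRight
        (EuclideanSpace.single l (1 : ℝ)))

theorem fderiv_coordBilin {S : MetricComp D} {y : EuclideanSpace ℝ (Fin D)}
    (hS : DifferentiableAt ℝ (fun y => coordBilin (S y)) y) (w : EuclideanSpace ℝ (Fin D))
    (i j : Fin D) :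
    fderiv ℝ (fun y => coordBilin (S y)) y w (EuclideanSpace.single i 1)
      (EuclideanSpace.single j 1) = fderiv ℝ (fun y => S y i j) y w := by
  rw [← fderiv_apply_apply hS]
  simp only [coordBilin_single]

/-- Coordinate components of a metric, of a 2-form and of a torsion 3-form on an open set, for
which the 2-form is a closed conformal Killing–Yano form. -/
structure CoordPKY (O : Set (EuclideanSpace ℝ (Fin D))) (G : MetricComp D) (H : Comp D 2)
    (T : Comp D 3) : Prop where
  isOpen : IsOpen O
  smooth_G : ∀ i j, ContDiffOn ℝ ∞ (fun y => G y i j) O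
  smooth_H : ∀ i, ContDiffOn ℝ ∞ (fun y => H y i) O
  smooth_T : ∀ i, ContDiffOn ℝ ∞ (fun y => T y i) O
  symm : ∀ y i j, G y i j = G y j i
  pos : ∀ y ∈ O, ∀ v, v ≠ 0 → 0 < coordBilin (G y) v v
  H_swap : ∀ y i j, H y ![i, j] = -H y ![j, i]
  T_swap_left : ∀ y i j k, T y ![i, j, k] = -T y ![j, i, k]
  T_swap_right : ∀ y i j k, T y ![i, j, k] = -T y ![i, k, j]
  cky : ∀ y ∈ O, CKYEquation G (torsionConn G T) H y
  closed : ∀ y ∈ O, ∀ i, extD (torsionConn G T) H y i = 0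

namespace CoordPKY

variable {G : MetricComp D} {H : Comp D 2} {T : Comp D 3}

theorem isUnit_det (P : CoordPKY O G H T) {y : EuclideanSpace ℝ (Fin D)} (hy : y ∈ O) :
    IsUnit (G y).det := by
  rw [isUnit_iff_ne_zero]
  intro h0
  obtain ⟨v, hv, hGv⟩ := Matrix.exists_mulVec_eq_zero_iff.2 h0
  have hv' : (WithLp.toLp 2 v : EuclideanSpace ℝ (Fin D)) ≠ 0 := fun h => hv (by
    ext i
    exact congrArg (fun u : EuclideanSpace ℝ (Fin D) => u i) h)
  have h1 := P.pos y hy _ hv'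
  rw [coordBilin_apply] at h1
  have h2 : ∀ i, ∑ j, G y i j * v j = 0 := fun i => congrFun hGv i
  have h3 : ∑ i, ∑ j, G y i j * (v i * v j) = 0 :=
    Finset.sum_eq_zero fun i _ => by
      have : ∑ j, G y i j * (v i * v j) = v i * ∑ j, G y i j * v j := by
        rw [Finset.mul_sum]
        exact Finset.sum_congr rfl fun j _ => by ring
      rw [this, h2, mul_zero]
  exact h1.ne' h3

theorem sum_inv_mul (P : CoordPKY O G H T) {y : EuclideanSpace ℝ (Fin D)} (hy : y ∈ O)
    (r : Fin D) (f : Fin D → ℝ) : ∑ l, G y r l * ∑ k, (G y)⁻¹ l k * f k = f r := by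
  have h1 := Matrix.mul_nonsing_inv (G y) (P.isUnit_det hy)
  have h2 : (G y).mulVec ((G y)⁻¹.mulVec f) = f := by
    rw [Matrix.mulVec_mulVec, h1, Matrix.one_mulVec]
  exact congrFun h2 r

theorem lower_torsionConn (P : CoordPKY O G H T) {y : EuclideanSpace ℝ (Fin D)} (hy : y ∈ O)
    (r m i : Fin D) : ∑ l, G y r l * torsionConn G T y l m i =
      1 / 2 * (pderiv m (fun z => G z r i) y + pderiv i (fun z => G z r m) y -
        pderiv r (fun z => G z m i) y) + 1 / 2 * T y ![m, i, r] := by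
  have h1 := P.sum_inv_mul hy r fun k => 1 / 2 * (pderiv m (fun z => G z k i) y +
    pderiv i (fun z => G z k m) y - pderiv k (fun z => G z m i) y) + 1 / 2 * T y ![m, i, k]
  rw [← h1]
  refine Finset.sum_congr rfl fun l _ => ?_
  congr 1
  simp only [torsionConn, leviCivita, Finset.mul_sum, ← Finset.sum_add_distrib]
  exact Finset.sum_congr rfl fun k _ => by ring

variable (G) (H) (T) in
/-- The components of `ξ = -1/(D-1) δ^T h`. -/
noncomputable def xi (y : EuclideanSpace ℝ (Fin D)) (j : Fin D) : ℝ :=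
  -(1 / ((D : ℝ) - 1)) * codiff G (torsionConn G T) H y ![j]

/-- The principal tensor equation in components. -/
theorem covD_eq (P : CoordPKY O G H T) {y : EuclideanSpace ℝ (Fin D)} (hy : y ∈ O)
    (m i j : Fin D) : covD (torsionConn G T) H y m ![i, j] =
      G y m i * xi G H T y j - G y m j * xi G H T y i := by
  have h := P.cky y hy m ![i, j]
  rw [P.closed y hy, mul_zero, zero_sub] at h
  rw [h]
  have e0 : (fun a : Fin 1 => (![i, j] : Fin 2 → Fin D) ((0 : Fin 2).succAbove a)) = ![j] := by
    ext a; fin_cases a; rfl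
  have e1 : (fun a : Fin 1 => (![i, j] : Fin 2 → Fin D) ((1 : Fin 2).succAbove a)) = ![i] := by
    ext a; fin_cases a; rfl
  have e2 : flatWedge G (codiff G (torsionConn G T) H) y m ![i, j] =
      G y m i * codiff G (torsionConn G T) H y ![j] -
        G y m j * codiff G (torsionConn G T) H y ![i] := by
    rw [flatWedge, Fin.sum_univ_two, e0, e1]
    simp
    ring
  have e3 : (D : ℝ) - ((1 + 1 : ℕ) : ℝ) + 1 = D - 1 := by push_cast; ring
  rw [e2, e3, xi, xi]
  ring

theorem covD_two (Γ : ConnComp D) (S : Comp D 2) (y : EuclideanSpace ℝ (Fin D)) (m i j : Fin D) :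
    covD Γ S y m ![i, j] = pderiv m (fun z => S z ![i, j]) y -
      (∑ l, Γ y l m i * S y ![l, j] + ∑ l, Γ y l m j * S y ![i, l]) := by
  rw [covD, Fin.sum_univ_two]
  congr 2
  · refine Finset.sum_congr rfl fun l _ => ?_
    congr 2
    ext a; fin_cases a <;> rfl
  · refine Finset.sum_congr rfl fun l _ => ?_
    congr 2
    ext a; fin_cases a <;> rfl

variable (G) (H) (T) in
/-- The endomorphism field of the 2-form `H`. -/
noncomputable def endo (y : EuclideanSpace ℝ (Fin D)) :
    EuclideanSpace ℝ (Fin D) →L[ℝ] EuclideanSpace ℝ (Fin D) :=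
  (ContinuousLinearMap.inverse (coordBilin (G y))).comp
    (coordBilin (Matrix.of fun i j => H y ![j, i]))

variable (G) (H) (T) in
/-- The vector field dual to `ξ`. -/
noncomputable def xiVec (y : EuclideanSpace ℝ (Fin D)) : EuclideanSpace ℝ (Fin D) :=
  ContinuousLinearMap.inverse (coordBilin (G y))
    (∑ j, xi G H T y j • (EuclideanSpace.proj j : EuclideanSpace ℝ (Fin D) →L[ℝ] ℝ))

theorem inner_inverse (P : CoordPKY O G H T) {y : EuclideanSpace ℝ (Fin D)} (hy : y ∈ O)
    (f : EuclideanSpace ℝ (Fin D) →L[ℝ] ℝ) (v : EuclideanSpace ℝ (Fin D)) :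
    coordBilin (G y) (ContinuousLinearMap.inverse (coordBilin (G y)) f) v = f v := by
  obtain ⟨e, he⟩ := exists_equiv_of_pos (P.pos y hy)
  rw [← he, ContinuousLinearMap.inverse_equiv]
  simp

theorem smooth_inverse (P : CoordPKY O G H T) :
    ContDiffOn ℝ ∞ (fun y => ContinuousLinearMap.inverse (coordBilin (G y))) O := by
  intro y hy
  obtain ⟨e, he⟩ := exists_equiv_of_pos (P.pos y hy)
  have h1 := contDiffAt_map_inverse (n := ∞) e
  rw [he] at h1
  exact h1.comp_contDiffWithinAt y (contDiffOn_coordBilin P.smooth_G y hy)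

theorem coordBilin_symm (P : CoordPKY O G H T) (y u v : EuclideanSpace ℝ (Fin D)) :
    coordBilin (G y) u v = coordBilin (G y) v u := by
  rw [coordBilin_apply, coordBilin_apply, Finset.sum_comm]
  exact Finset.sum_congr rfl fun i _ => Finset.sum_congr rfl fun j _ => by
    rw [P.symm y j i]; ring

theorem inner_endo (P : CoordPKY O G H T) {y : EuclideanSpace ℝ (Fin D)} (hy : y ∈ O)
    (u v : EuclideanSpace ℝ (Fin D)) :
    coordBilin (G y) v (endo G H y u) = ∑ i, ∑ j, H y ![i, j] * (v i * u j) := by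
  rw [P.coordBilin_symm, endo, ContinuousLinearMap.comp_apply, P.inner_inverse hy,
    coordBilin_apply, Finset.sum_comm]
  exact Finset.sum_congr rfl fun i _ => Finset.sum_congr rfl fun j _ => by
    rw [Matrix.of_apply]; ring

theorem inner_xiVec (P : CoordPKY O G H T) {y : EuclideanSpace ℝ (Fin D)} (hy : y ∈ O)
    (v : EuclideanSpace ℝ (Fin D)) :
    coordBilin (G y) (xiVec G H T y) v = ∑ j, xi G H T y j * v j := by
  rw [xiVec, P.inner_inverse hy]
  simp [sum_apply, smul_apply]

theorem inner_conn_single (P : CoordPKY O G H T) {y : EuclideanSpace ℝ (Fin D)} (hy : y ∈ O)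
    (r m i : Fin D) :
    coordBilin (G y) (EuclideanSpace.single r 1) (coordConn (torsionConn G T y)
      (EuclideanSpace.single m 1) (EuclideanSpace.single i 1)) =
      1 / 2 * (pderiv m (fun z => G z r i) y + pderiv i (fun z => G z r m) y -
        pderiv r (fun z => G z m i) y) + 1 / 2 * T y ![m, i, r] := by
  rw [← P.lower_torsionConn hy, coordConn_single, map_sum]
  exact Finset.sum_congr rfl fun l _ => by
    rw [map_smul, coordBilin_single, smul_eq_mul, mul_comm]

end CoordPKY

end Coordinates

end TorsionKY

/-! ### Coordinate data satisfy `LocalPKY` -/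

namespace TorsionKY

section Multilinear

variable {E ι : Type*} [NormedAddCommGroup E] [NormedSpace ℝ E]

theorem eq_of_eq_basis (b : Module.Basis ι ℝ E) {f f' : E → ℝ} (hf : IsLinearMap ℝ f)
    (hf' : IsLinearMap ℝ f') (h : ∀ i, f (b i) = f' (b i)) (v : E) : f v = f' v := by
  have : hf.mk' f = hf'.mk' f' := b.ext fun i => by simpa using h i
  exact congrArg (fun k : E →ₗ[ℝ] ℝ => k v) this

theorem eq_of_eq_basis₃ (b : Module.Basis ι ℝ E) {f f' : E → E → E → ℝ}
    (hf₁ : ∀ u v, IsLinearMap ℝ fun w => f w u v) (hf₂ : ∀ w v, IsLinearMap ℝ fun u => f w u v)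
    (hf₃ : ∀ w u, IsLinearMap ℝ fun v => f w u v)
    (hf₁' : ∀ u v, IsLinearMap ℝ fun w => f' w u v)
    (hf₂' : ∀ w v, IsLinearMap ℝ fun u => f' w u v)
    (hf₃' : ∀ w u, IsLinearMap ℝ fun v => f' w u v)
    (h : ∀ i j k, f (b i) (b j) (b k) = f' (b i) (b j) (b k)) (w u v : E) : f w u v = f' w u v := by
  refine eq_of_eq_basis b (hf₁ u v) (hf₁' u v) (fun i => ?_) w
  refine eq_of_eq_basis b (hf₂ _ v) (hf₂' _ v) (fun j => ?_) u
  exact eq_of_eq_basis b (hf₃ _ _) (hf₃' _ _) (fun k => h i j k) v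

variable {g₀ : E →L[ℝ] E →L[ℝ] ℝ} {Γ₀ : E →L[ℝ] E →L[ℝ] E} {A₀ : E →L[ℝ] E} {z₀ : E}

theorem compat_of_basis (b : Module.Basis ι ℝ E) {B : E →L[ℝ] E →L[ℝ] E →L[ℝ] ℝ}
    (h : ∀ i j k, B (b i) (b j) (b k) =
      g₀ (Γ₀ (b i) (b j)) (b k) + g₀ (b j) (Γ₀ (b i) (b k))) (w u v : E) :
    B w u v = g₀ (Γ₀ w u) v + g₀ u (Γ₀ w v) := by
  refine eq_of_eq_basis₃ b (f := fun w u v => B w u v)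
    (f' := fun w u v => g₀ (Γ₀ w u) v + g₀ u (Γ₀ w v)) ?_ ?_ ?_ ?_ ?_ ?_ h w u v
  all_goals
    intro a c
    constructor
    · intro p q
      simp only [map_add, add_apply]
      try ring
    · intro p q
      simp only [map_smul, smul_apply, smul_eq_mul]
      try ring

theorem torsion_of_basis (b : Module.Basis ι ℝ E)
    (h : ∀ i j k, g₀ (Γ₀ (b i) (b j) - Γ₀ (b j) (b i)) (b k) =
      -g₀ (Γ₀ (b i) (b k) - Γ₀ (b k) (b i)) (b j)) (u v w : E) :
    g₀ (Γ₀ u v - Γ₀ v u) w = -g₀ (Γ₀ u w - Γ₀ w u) v := by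
  refine eq_of_eq_basis₃ b (f := fun u v w => g₀ (Γ₀ u v - Γ₀ v u) w)
    (f' := fun u v w => -g₀ (Γ₀ u w - Γ₀ w u) v) ?_ ?_ ?_ ?_ ?_ ?_ h u v w
  all_goals
    intro a c
    constructor
    · intro p q
      simp only [map_add, add_apply, map_sub, sub_apply]
      try ring
    · intro p q
      simp only [map_smul, smul_apply, map_sub, sub_apply, smul_eq_mul]
      try ring

theorem deriv_endo_of_basis (b : Module.Basis ι ℝ E) {B : E →L[ℝ] E →L[ℝ] E}
    (h : ∀ i j k, g₀ (b k) (B (b i) (b j)) = g₀ (b k) (A₀ (Γ₀ (b i) (b j)) -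
      Γ₀ (b i) (A₀ (b j)) + g₀ z₀ (b j) • b i - g₀ (b i) (b j) • z₀)) (w u v : E) :
    g₀ v (B w u) = g₀ v (A₀ (Γ₀ w u) - Γ₀ w (A₀ u) + g₀ z₀ u • w - g₀ w u • z₀) := by
  refine eq_of_eq_basis₃ b (f := fun w u v => g₀ v (B w u))
    (f' := fun w u v => g₀ v (A₀ (Γ₀ w u) - Γ₀ w (A₀ u) + g₀ z₀ u • w - g₀ w u • z₀))
    ?_ ?_ ?_ ?_ ?_ ?_ h w u v
  all_goals
    intro a c
    constructor
    · intro p q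
      simp only [map_add, add_apply, map_sub, map_smul, smul_eq_mul]
      try ring
    · intro p q
      simp only [map_smul, smul_apply, map_sub, map_add, smul_eq_mul]
      try ring

theorem fderiv_metric_endo {g : E → E →L[ℝ] E →L[ℝ] ℝ} {A : E → E →L[ℝ] E} {y : E}
    (hg : DifferentiableAt ℝ g y) (hA : DifferentiableAt ℝ A y) (w u v : E) :
    fderiv ℝ (fun y => g y v (A y u)) y w = fderiv ℝ g y w v (A y u) +
      g y v (fderiv ℝ A y w u) := by
  rw [((hg.hasFDerivAt.clm_apply (hasFDerivAt_const v y)).clm_apply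
    (hA.hasFDerivAt.clm_apply (hasFDerivAt_const u y))).fderiv]
  simp [add_comm]

end Multilinear

section Coordinates

variable {D : ℕ} {O : Set (EuclideanSpace ℝ (Fin D))}

/-- The standard basis of the coordinate space. -/
noncomputable def stdBasis (D : ℕ) : Module.Basis (Fin D) ℝ (EuclideanSpace ℝ (Fin D)) :=
  (EuclideanSpace.basisFun (Fin D) ℝ).toBasis

theorem stdBasis_apply (i : Fin D) : stdBasis D i = EuclideanSpace.single i 1 := by
  simp [stdBasis]

namespace CoordPKY

variable {G : MetricComp D} {H : Comp D 2} {T : Comp D 3}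

theorem continuousOn_inv (P : CoordPKY O G H T) (i j : Fin D) :
    ContinuousOn (fun y => (G y)⁻¹ i j) O := by
  have hG : ContinuousOn G O := continuousOn_pi.2 fun i => continuousOn_pi.2 fun j =>
    (P.smooth_G i j).continuousOn
  have h1 : ContinuousOn (fun y => (G y).det) O :=
    (Continuous.matrix_det continuous_id).comp_continuousOn hG
  have h2 : ContinuousOn (fun y => (G y).adjugate) O :=
    (Continuous.matrix_adjugate continuous_id).comp_continuousOn hG
  have h3 : ContinuousOn (fun y => (G y).det⁻¹ * (G y).adjugate i j) O :=
    (h1.inv₀ fun y hy => (P.isUnit_det hy).ne_zero).mul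
      (continuousOn_pi.1 (continuousOn_pi.1 h2 i) j)
  refine h3.congr fun y _ => ?_
  rw [Matrix.inv_def, Ring.inverse_eq_inv', Matrix.smul_apply, smul_eq_mul]

theorem continuousOn_pderiv (hO : IsOpen O) {f : EuclideanSpace ℝ (Fin D) → ℝ}
    (hf : ContDiffOn ℝ ∞ f O) (m : Fin D) : ContinuousOn (fun y => pderiv m f y) O :=
  (hf.continuousOn_fderiv_of_isOpen hO (by simp)).clm_apply continuousOn_const

theorem continuousOn_torsionConn (P : CoordPKY O G H T) (l m i : Fin D) :
    ContinuousOn (fun y => torsionConn G T y l m i) O := by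
  have hp := fun m i j => continuousOn_pderiv P.isOpen (P.smooth_G i j) m
  refine (continuousOn_const.mul (continuousOn_finsetSum _ fun r _ =>
    (P.continuousOn_inv l r).mul (((hp m r i).add (hp i r m)).sub (hp r m i)))).add
    (continuousOn_const.mul (continuousOn_finsetSum _ fun r _ =>
      (P.continuousOn_inv l r).mul (P.smooth_T _).continuousOn))

theorem continuousOn_xi (P : CoordPKY O G H T) (j : Fin D) :
    ContinuousOn (fun y => xi G H T y j) O := by
  refine continuousOn_const.mul (ContinuousOn.neg (continuousOn_finsetSum _ fun a _ =>
    continuousOn_finsetSum _ fun b _ => (P.continuousOn_inv a b).mul ?_))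
  exact (continuousOn_pderiv P.isOpen (P.smooth_H _) a).sub (continuousOn_finsetSum _ fun c _ =>
    continuousOn_finsetSum _ fun l _ => (P.continuousOn_torsionConn _ _ _).mul
      (P.smooth_H _).continuousOn)

theorem inner_endo_single (P : CoordPKY O G H T) {y : EuclideanSpace ℝ (Fin D)} (hy : y ∈ O)
    (i j : Fin D) : coordBilin (G y) (EuclideanSpace.single i 1)
      (endo G H y (EuclideanSpace.single j 1)) = H y ![i, j] := by
  rw [P.inner_endo hy]
  simp

theorem smooth_endo (P : CoordPKY O G H T) : ContDiffOn ℝ ∞ (endo G H) O :=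
  P.smooth_inverse.clm_comp (contDiffOn_coordBilin fun i j => P.smooth_H ![j, i])

/-- The Christoffel part is compatible with the metric, and the two torsion contributions cancel
because `T` is antisymmetric in its last two indices. -/
theorem compat (P : CoordPKY O G H T) {y : EuclideanSpace ℝ (Fin D)} (hy : y ∈ O)
    (w u v : EuclideanSpace ℝ (Fin D)) :
    fderiv ℝ (fun y => coordBilin (G y)) y w u v =
      coordBilin (G y) (coordConn (torsionConn G T y) w u) v +
        coordBilin (G y) u (coordConn (torsionConn G T y) w v) := by
  have hd : DifferentiableAt ℝ (fun y => coordBilin (G y)) y :=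
    ((contDiffOn_coordBilin P.smooth_G).contDiffAt (P.isOpen.mem_nhds hy)).differentiableAt
      (by simp)
  refine compat_of_basis (stdBasis D) (fun m i j => ?_) w u v
  rw [stdBasis_apply, stdBasis_apply, stdBasis_apply, fderiv_coordBilin hd, P.coordBilin_symm,
    P.inner_conn_single hy, P.inner_conn_single hy, P.T_swap_right y m j i]
  have h1 : (fun y => G y i j) = fun y => G y j i := funext fun y => P.symm y i j
  have h2 : (fun y => G y m i) = fun y => G y i m := funext fun y => P.symm y m i
  have h3 : (fun y => G y m j) = fun y => G y j m := funext fun y => P.symm y m j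
  rw [h1, h2, h3]
  simp only [pderiv]
  ring

/-- The Christoffel part is symmetric and the two halves of `T` add up, so the lowered torsion is
`T` itself, which alternates. -/
theorem torsion (P : CoordPKY O G H T) {y : EuclideanSpace ℝ (Fin D)} (hy : y ∈ O)
    (u v w : EuclideanSpace ℝ (Fin D)) :
    coordBilin (G y) (coordConn (torsionConn G T y) u v - coordConn (torsionConn G T y) v u) w =
      -coordBilin (G y)
        (coordConn (torsionConn G T y) u w - coordConn (torsionConn G T y) w u) v := by
  have key : ∀ m i r : Fin D, coordBilin (G y)
      (coordConn (torsionConn G T y) (EuclideanSpace.single m 1) (EuclideanSpace.single i 1) -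
        coordConn (torsionConn G T y) (EuclideanSpace.single i 1) (EuclideanSpace.single m 1))
      (EuclideanSpace.single r 1) = T y ![m, i, r] := by
    intro m i r
    rw [P.coordBilin_symm, map_sub, P.inner_conn_single hy, P.inner_conn_single hy,
      P.T_swap_left y i m r]
    have h2 : (fun y => G y m i) = fun y => G y i m := funext fun y => P.symm y m i
    rw [h2]
    ring
  refine torsion_of_basis (stdBasis D) (fun m i j => ?_) u v w
  rw [stdBasis_apply, stdBasis_apply, stdBasis_apply, key, key, P.T_swap_right]

/-- `covD_eq` translated from the 2-form to its endomorphism: the product rule is applied to `g(∂_i,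
A ∂_j) = h_{ij}`, and `compat` rewrites the derivative of the metric. -/
theorem deriv_endo (P : CoordPKY O G H T) {y : EuclideanSpace ℝ (Fin D)} (hy : y ∈ O)
    (w u v : EuclideanSpace ℝ (Fin D)) :
    coordBilin (G y) v (fderiv ℝ (endo G H) y w u) =
      coordBilin (G y) v (endo G H y (coordConn (torsionConn G T y) w u) -
        coordConn (torsionConn G T y) w (endo G H y u) +
        coordBilin (G y) (xiVec G H T y) u • w - coordBilin (G y) w u • xiVec G H T y) := by
  have hd : DifferentiableAt ℝ (fun y => coordBilin (G y)) y :=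
    ((contDiffOn_coordBilin P.smooth_G).contDiffAt (P.isOpen.mem_nhds hy)).differentiableAt
      (by simp)
  have hA : DifferentiableAt ℝ (endo G H) y :=
    (P.smooth_endo.contDiffAt (P.isOpen.mem_nhds hy)).differentiableAt (by simp)
  refine deriv_endo_of_basis (stdBasis D) (fun m j i => ?_) w u v
  rw [stdBasis_apply, stdBasis_apply, stdBasis_apply]
  have h1 := fderiv_metric_endo hd hA (EuclideanSpace.single m 1) (EuclideanSpace.single j 1)
    (EuclideanSpace.single i 1)
  have h2 : fderiv ℝ (fun y => coordBilin (G y) (EuclideanSpace.single i 1)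
      (endo G H y (EuclideanSpace.single j 1))) y (EuclideanSpace.single m 1) =
      pderiv m (fun y => H y ![i, j]) y := by
    have h3 : (fun y => coordBilin (G y) (EuclideanSpace.single i 1)
      (endo G H y (EuclideanSpace.single j 1))) =ᶠ[nhds y] fun y => H y ![i, j] :=
      Filter.eventuallyEq_of_mem (P.isOpen.mem_nhds hy) fun p hp => P.inner_endo_single hp i j
    rw [h3.fderiv_eq, pderiv]
  rw [h2, P.compat hy] at h1
  have h4 := P.covD_eq hy m i j
  rw [covD_two] at h4
  have h5 : ∑ l, torsionConn G T y l m i * H y ![l, j] =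
      coordBilin (G y) (coordConn (torsionConn G T y) (EuclideanSpace.single m 1)
        (EuclideanSpace.single i 1)) (endo G H y (EuclideanSpace.single j 1)) := by
    rw [coordConn_single, map_sum, sum_apply]
    exact Finset.sum_congr rfl fun l _ => by
      rw [map_smul, smul_apply, P.inner_endo_single hy, smul_eq_mul]
  have h6 : ∑ l, torsionConn G T y l m j * H y ![i, l] =
      coordBilin (G y) (EuclideanSpace.single i 1) (endo G H y
        (coordConn (torsionConn G T y) (EuclideanSpace.single m 1)
          (EuclideanSpace.single j 1))) := by
    rw [coordConn_single, map_sum, map_sum]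
    exact Finset.sum_congr rfl fun l _ => by
      rw [map_smul, map_smul, P.inner_endo_single hy, smul_eq_mul]
  have h7 : ∀ k, coordBilin (G y) (xiVec G H T y) (EuclideanSpace.single k 1) = xi G H T y k :=
    fun k => by rw [P.inner_xiVec hy]; simp
  rw [h5, h6] at h4
  rw [map_sub, map_add, map_sub, map_smul, map_smul, h7,
    P.coordBilin_symm y (EuclideanSpace.single i 1) (xiVec G H T y), h7, coordBilin_single,
    coordBilin_single, smul_eq_mul, smul_eq_mul, P.symm y i m]
  linear_combination h4 - h1

theorem localPKY (P : CoordPKY O G H T) :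
    LocalPKY O (fun y => coordBilin (G y)) (endo G H) (fun y => coordConn (torsionConn G T y))
      (xiVec G H T) where
  isOpen := P.isOpen
  smooth_metric := contDiffOn_coordBilin P.smooth_G
  smooth_endo := P.smooth_endo
  continuousOn_conn := continuousOn_coordConn P.continuousOn_torsionConn
  continuousOn_z := P.smooth_inverse.continuousOn.clm_apply
    (continuousOn_finsetSum _ fun j _ => (P.continuousOn_xi j).smul continuousOn_const)
  symm := fun y _ u v => P.coordBilin_symm y u v
  pos := P.pos
  skew := fun y hy u v => by
    rw [P.coordBilin_symm, P.inner_endo hy, P.inner_endo hy, Finset.sum_comm,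
      ← Finset.sum_neg_distrib]
    refine Finset.sum_congr rfl fun i _ => ?_
    rw [← Finset.sum_neg_distrib]
    exact Finset.sum_congr rfl fun j _ => by rw [P.H_swap y j i]; ring
  compat := fun y hy => P.compat hy
  torsion := fun y hy => P.torsion hy
  deriv_endo := fun y hy w u => by
    have h1 := P.deriv_endo hy w u
    rw [← sub_eq_zero]
    by_contra hne
    refine (P.pos y hy _ hne).ne' ?_
    rw [map_sub, h1, sub_self]

end CoordPKY

end Coordinates

end TorsionKY

/-! ### Consequences of non-degeneracy -/

namespace TorsionKY

section Skew

variable {V : Type*} [AddCommGroup V] [Module ℝ V] [FiniteDimensional ℝ V]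

/-- The kernel of a skew endomorphism is its generalized eigenspace for the eigenvalue `0`. -/
theorem finrank_ker_of_skew {b : V → V → ℝ} (hb : ∀ v, b v v = 0 → v = 0) (hb0 : ∀ v, b v 0 = 0)
    {f : V →ₗ[ℝ] V} (hf : ∀ u v, b (f u) v = -b u (f v)) :
    Module.finrank ℝ (LinearMap.ker f) = f.charpoly.rootMultiplicity 0 := by
  have h1 : ∀ v, f (f v) = 0 → f v = 0 := fun v hv => by
    refine hb _ ?_
    rw [hf, hv, hb0, neg_zero]
  have h2 : ∀ k v, (f ^ (k + 1)) v = 0 → f v = 0 := by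
    intro k
    induction k with
    | zero => intro v hv; simpa using hv
    | succ k ih =>
      intro v hv
      have : (f ^ (k + 1)) (f v) = 0 := by rwa [pow_succ] at hv
      exact h1 v (ih _ this)
  rw [← LinearMap.finrank_maxGenEigenspace_eq]
  suffices hker : LinearMap.ker f = Module.End.maxGenEigenspace f 0 by rw [hker]
  ext v
  rw [LinearMap.mem_ker, Module.End.mem_maxGenEigenspace]
  refine ⟨fun hv => ⟨1, by simpa using hv⟩, fun ⟨k, hk⟩ => ?_⟩
  rw [zero_smul, sub_zero] at hk
  refine h2 k v ?_
  rw [pow_succ', Module.End.mul_apply, hk, map_zero]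

/-- A vanishing `x μ` would make `X ^ (ε + 2)` divide the characteristic polynomial. For a skew map
the multiplicity of zero is the dimension of the kernel, which is `ε` by the rank condition. -/
theorem eigenvalue_ne_zero {b : V → V → ℝ} (hb : ∀ v, b v v = 0 → v = 0) (hb0 : ∀ v, b v 0 = 0)
    {f : V →ₗ[ℝ] V} (hf : ∀ u v, b (f u) v = -b u (f v)) {n ε : ℕ}
    (hV : Module.finrank ℝ V = 2 * n + ε)
    (hrank : Module.finrank ℝ (LinearMap.range f) = 2 * n) {x : Fin n → ℝ}
    (hx : f.charpoly = Polynomial.X ^ ε *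
      ∏ μ : Fin n, (Polynomial.X ^ 2 + Polynomial.C (x μ ^ 2))) (μ : Fin n) : x μ ≠ 0 := by
  intro h0
  have h1 := finrank_ker_of_skew hb hb0 hf
  have h2 := f.finrank_range_add_finrank_ker
  have h3 : ε + 2 ≤ f.charpoly.rootMultiplicity 0 := by
    rw [Polynomial.le_rootMultiplicity_iff f.charpoly_monic.ne_zero, hx, Polynomial.C_0, sub_zero,
      pow_add, ← Finset.mul_prod_erase _ _ (Finset.mem_univ μ), h0]
    simp only [ne_eq, OfNat.ofNat_ne_zero, not_false_eq_true, zero_pow, Polynomial.C_0, add_zero]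
    exact mul_dvd_mul_left _ (dvd_mul_right _ _)
  omega

end Skew

theorem finrank_range_conj {V : Type*} [AddCommGroup V] [Module ℝ V] (e : V ≃ₗ[ℝ] V)
    (f : V →ₗ[ℝ] V) :
    Module.finrank ℝ (LinearMap.range (e.conj f)) = Module.finrank ℝ (LinearMap.range f) := by
  have h : LinearMap.range (e.conj f) = (LinearMap.range f).map (e : V →ₗ[ℝ] V) := by
    ext v
    simp only [LinearMap.mem_range, Submodule.mem_map]
    constructor
    · rintro ⟨u, rfl⟩
      exact ⟨f (e.symm u), ⟨_, rfl⟩, rfl⟩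
    · rintro ⟨_, ⟨u, rfl⟩, rfl⟩
      exact ⟨e u, by simp [LinearEquiv.conj_apply]⟩
  rw [h]
  exact LinearEquiv.finrank_map_eq e _

theorem linearIndependent_comp_of_surjective {E ι : Type*} [NormedAddCommGroup E]
    [NormedSpace ℝ E] [Fintype ι] {a : ι → E →L[ℝ] ℝ} (ha : LinearIndependent ℝ a)
    {L : E →L[ℝ] E} (hL : Function.Surjective L) :
    LinearIndependent ℝ fun i => (a i).comp L := by
  refine Fintype.linearIndependent_iff.2 fun c hc => Fintype.linearIndependent_iff.1 ha c ?_
  ext v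
  obtain ⟨u, rfl⟩ := hL v
  have h := congrArg (fun f : E →L[ℝ] ℝ => f u) hc
  simpa [sum_apply] using h

section DetCharpoly

variable {E : Type*} [NormedAddCommGroup E] [NormedSpace ℝ E] [FiniteDimensional ℝ E]

/-- For `s ≠ 0`, `det (1 - s A)` is `s` to the power `dim E` times the characteristic polynomial at
`1 / s`; the factors `s^ε` cancel. -/
theorem detW_eq_prod {A : E →L[ℝ] E} {n ε : ℕ} (hE : Module.finrank ℝ E = 2 * n + ε)
    {x : Fin n → ℝ} (hx : (A : E →ₗ[ℝ] E).charpoly = Polynomial.X ^ ε *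
      ∏ μ : Fin n, (Polynomial.X ^ 2 + Polynomial.C (x μ ^ 2))) (s : ℝ) :
    detW A s = ∏ μ, (1 + s ^ 2 * x μ ^ 2) := by
  by_cases hs : s = 0
  · subst hs
    simp only [detW, zero_smul, sub_zero, ne_eq, OfNat.ofNat_ne_zero, not_false_eq_true, zero_pow,
      zero_mul, add_zero, Finset.prod_const_one]
    exact LinearMap.det_id
  have h1 : ((1 - s • A : E →L[ℝ] E) : E →ₗ[ℝ] E) =
      s • (algebraMap ℝ (E →ₗ[ℝ] E) s⁻¹ - (A : E →ₗ[ℝ] E)) := by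
    ext v
    simp [Module.algebraMap_end_apply, smul_sub, smul_smul, hs]
  rw [detW, h1, LinearMap.det_smul, ← LinearMap.eval_charpoly, hx, hE, Polynomial.eval_mul,
    Polynomial.eval_prod, Polynomial.eval_pow, Polynomial.eval_X]
  simp only [Polynomial.eval_add, Polynomial.eval_pow, Polynomial.eval_X, Polynomial.eval_C]
  have h2 : ∏ μ, (1 + s ^ 2 * x μ ^ 2) = (s ^ 2) ^ n * ∏ μ, (s⁻¹ ^ 2 + x μ ^ 2) := by
    have : (s ^ 2) ^ n = ∏ _μ : Fin n, s ^ 2 := by simp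
    rw [this, ← Finset.prod_mul_distrib]
    exact Finset.prod_congr rfl fun μ _ => by field_simp
  rw [h2, pow_add, pow_mul]
  have h3 : s ^ ε * s⁻¹ ^ ε = 1 := by rw [← mul_pow, mul_inv_cancel₀ hs, one_pow]
  linear_combination ((s ^ 2) ^ n * ∏ μ, (s⁻¹ ^ 2 + x μ ^ 2)) * h3

end DetCharpoly

section Manifold

variable {D : ℕ} {M : Type*} [TopologicalSpace M] [ChartedSpace (EuclideanSpace ℝ (Fin D)) M]
  [IsManifold (𝓡 D) ∞ M] {g : Metric D M} {T : FormField D M 3} {h : FormField D M 2} {n ε : ℕ}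
  {φ : OpenPartialHomeomorph M (EuclideanSpace ℝ (Fin D))}

theorem coordBilin_metricComp (g : Metric D M) (y u v : EuclideanSpace ℝ (Fin D)) :
    coordBilin (metricComp g φ y) u v = g.inner (φ.symm y) (chartDiff φ y u) (chartDiff φ y v) := by
  rw [coordBilin_apply, inner_chartDiff]

theorem coordPKY (hT : IsSmooth (toTensor T)) (hh : IsPKY g T h n ε)
    (hφ : φ ∈ atlas (EuclideanSpace ℝ (Fin D)) M) :
    CoordPKY φ.target (metricComp g φ) (comp (toTensor h) φ) (comp (toTensor T) φ) where
  isOpen := φ.open_target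
  smooth_G := contDiffOn_metricComp g hφ
  smooth_H := hh.gcky.1 φ hφ
  smooth_T := hT φ hφ
  symm := fun y i j => metric_symm g _ _ _
  pos := fun y hy v hv => by
    obtain ⟨e, he⟩ := exists_chartDiff_equiv hφ hy
    rw [coordBilin_metricComp, ← he]
    exact g.pos _ _ ((map_ne_zero_iff e e.injective).2 hv)
  H_swap := fun y i j => by
    rw [comp_two_eq, comp_two_eq]
    exact twoForm_swap _ _ _
  T_swap_left := fun y i j k => by
    rw [comp_three_eq, comp_three_eq]
    exact threeForm_swap_left _ _ _ _
  T_swap_right := fun y i j k => by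
    rw [comp_three_eq, comp_three_eq]
    exact threeForm_swap_right _ _ _ _
  cky := hh.gcky.2 φ hφ
  closed := hh.closed φ hφ

/-- The endomorphism of the tangent space corresponding to `h`, computed in the chart `φ`. -/
theorem exists_isEndomorphismOf (hT : IsSmooth (toTensor T)) (hh : IsPKY g T h n ε)
    (hφ : φ ∈ atlas (EuclideanSpace ℝ (Fin D)) M) {y : EuclideanSpace ℝ (Fin D)}
    (hy : y ∈ φ.target) :
    ∃ (e : EuclideanSpace ℝ (Fin D) ≃ₗ[ℝ] EuclideanSpace ℝ (Fin D)),
      (∀ u, e u = chartDiff φ y u) ∧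
      IsEndomorphismOf g h (φ.symm y) (e.conj
        (CoordPKY.endo (metricComp g φ) (comp (toTensor h) φ) y :
          EuclideanSpace ℝ (Fin D) →ₗ[ℝ] EuclideanSpace ℝ (Fin D))) := by
  obtain ⟨e, he⟩ := exists_chartDiff_equiv hφ hy
  refine ⟨e.toLinearEquiv, he, fun u v => ?_⟩
  obtain ⟨u, rfl⟩ := e.surjective u
  obtain ⟨v, rfl⟩ := e.surjective v
  have h1 : e.toLinearEquiv.conj (CoordPKY.endo (metricComp g φ) (comp (toTensor h) φ) y :
        EuclideanSpace ℝ (Fin D) →ₗ[ℝ] EuclideanSpace ℝ (Fin D)) (e u) =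
      e (CoordPKY.endo (metricComp g φ) (comp (toTensor h) φ) y u) := by
    simp [LinearEquiv.conj_apply]
  refine (congrArg (fun w => g.inner (φ.symm y) (e v) w) h1).trans ?_
  rw [he, he, he, ← coordBilin_metricComp, (coordPKY hT hh hφ).inner_endo hy, form_chartDiff]

/-- The differential of the chart conjugates the coordinate endomorphism to the one on the tangent
space, so rank and characteristic polynomial agree; its bijectivity preserves independence of the
differentials. -/
theorem localEigen (hD : D = 2 * n + ε) (hT : IsSmooth (toTensor T)) (hh : IsPKY g T h n ε)
    (hφ : φ ∈ atlas (EuclideanSpace ℝ (Fin D)) M) {y₀ : EuclideanSpace ℝ (Fin D)}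
    (hy₀ : y₀ ∈ φ.target) :
    ∃ O ⊆ φ.target, IsOpen O ∧ y₀ ∈ O ∧ ∃ x : Fin n → EuclideanSpace ℝ (Fin D) → ℝ,
      LocalEigen O (CoordPKY.endo (metricComp g φ) (comp (toTensor h) φ)) x := by
  obtain ⟨U, x, hU, hpU, hxs, hx⟩ := hh.nonDegenerate.2 (φ.symm y₀)
  have P := (coordPKY hT hh hφ).localPKY
  have hE : Module.finrank ℝ (EuclideanSpace ℝ (Fin D)) = 2 * n + ε := by simp [hD]
  have hcp : ∀ y ∈ φ.target ∩ φ.symm ⁻¹' U,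
      (CoordPKY.endo (metricComp g φ) (comp (toTensor h) φ) y :
          EuclideanSpace ℝ (Fin D) →ₗ[ℝ] EuclideanSpace ℝ (Fin D)).charpoly =
      Polynomial.X ^ ε * ∏ μ : Fin n, (Polynomial.X ^ 2 + Polynomial.C (x μ (φ.symm y) ^ 2)) := by
    intro y hy
    obtain ⟨e, -, he⟩ := exists_isEndomorphismOf hT hh hφ hy.1
    rw [← e.charpoly_conj]
    exact (hx _ hy.2).1 _ he
  refine ⟨φ.target ∩ φ.symm ⁻¹' U, Set.inter_subset_left,
    φ.isOpen_inter_preimage_symm hU, ⟨hy₀, hpU⟩, fun μ => x μ ∘ φ.symm, ?_, ?_, ?_, ?_⟩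
  · intro μ
    rw [← contMDiffOn_iff_contDiffOn]
    exact (hxs μ).comp ((contMDiffOn_chart_symm hφ).mono Set.inter_subset_left) fun y hy => hy.2
  · intro y hy μ
    refine eigenvalue_ne_zero (b := fun u v => coordBilin (metricComp g φ y) u v)
      (f := (CoordPKY.endo (metricComp g φ) (comp (toTensor h) φ) y :
          EuclideanSpace ℝ (Fin D) →ₗ[ℝ] EuclideanSpace ℝ (Fin D)))
      (fun v hv => ?_) (fun v => map_zero _) (P.skew y hy.1) hE ?_ (hcp y hy) μ
    · by_contra hne
      exact (P.pos y hy.1 v hne).ne' hv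
    · obtain ⟨e, -, he⟩ := exists_isEndomorphismOf hT hh hφ hy.1
      have h1 := hh.nonDegenerate.1 _ _ he
      rw [← h1]
      exact (finrank_range_conj e _).symm
  · intro y hy s
    exact detW_eq_prod hE (hcp y hy) s
  · intro y hy
    obtain ⟨e, he⟩ := exists_chartDiff_equiv hφ hy.1
    have h1 := (hx _ hy.2).2
    have h2 : ∀ μ, fderiv ℝ (x μ ∘ φ.symm) y = (show EuclideanSpace ℝ (Fin D) →L[ℝ] ℝ from
        mfderiv (𝓡 D) 𝓘(ℝ, ℝ) (x μ) (φ.symm y)).comp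
          (show EuclideanSpace ℝ (Fin D) →L[ℝ] EuclideanSpace ℝ (Fin D) from chartDiff φ y) := by
      intro μ
      rw [← mfderiv_eq_fderiv]
      exact mfderiv_comp (I' := 𝓡 D) y
        (((hxs μ).contMDiffAt (hU.mem_nhds hy.2)).mdifferentiableAt (by simp))
        (((contMDiffOn_chart_symm hφ).contMDiffAt
          (φ.open_target.mem_nhds hy.1)).mdifferentiableAt (by simp))
    rw [show (fun μ => fderiv ℝ (x μ ∘ φ.symm) y) = _ from funext h2]
    refine linearIndependent_comp_of_surjective h1 (fun v => ?_)
    obtain ⟨u, rfl⟩ := e.surjective v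
    exact ⟨u, (he u).symm⟩

end Manifold

end TorsionKY

/-! ### Expansion of the generating function in powers of `s²` -/

namespace TorsionKY

/-- Degrees above the number of variables give empty sums, so the truncation at `N` loses nothing.
-/
theorem sum_pow_mul_elemSymm {n : ℕ} (x : Fin n → ℝ) (s : Finset (Fin n)) (t : ℝ) {N : ℕ}
    (hN : s.card < N) :
    ∑ j : Fin N, t ^ (j : ℕ) * elemSymm x s j = ∏ ν ∈ s, (1 + t * x ν ^ 2) := by
  rw [Finset.prod_one_add, Fin.sum_univ_eq_sum_range (fun j => t ^ j * elemSymm x s j) N,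
    Finset.sum_powerset]
  have h1 : ∀ j, t ^ j * elemSymm x s j = ∑ u ∈ s.powersetCard j, ∏ ν ∈ u, (t * x ν ^ 2) := by
    intro j
    rw [elemSymm, Finset.mul_sum]
    refine Finset.sum_congr rfl fun u hu => ?_
    rw [Finset.prod_mul_distrib, Finset.prod_const, (Finset.mem_powersetCard.1 hu).2]
  simp only [h1]
  refine (Finset.sum_subset (Finset.range_subset_range.2 hN) fun j _ hj => ?_).symm
  rw [Finset.powersetCard_eq_empty.2, Finset.sum_empty]
  simpa using hj

section Interpolation

/-- The nodes `0, 1, …, N - 1` have distinct squares, so their Vandermonde matrix is invertible; the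
rows of the inverse extract the coefficients of a polynomial in `s²` of degree less than `N`. -/
theorem exists_interpolation (N : ℕ) : ∃ (s : Fin N → ℝ) (c : Fin N → Fin N → ℝ),
    ∀ i j : Fin N, ∑ k, c j k * (s k ^ 2) ^ (i : ℕ) = if i = j then 1 else 0 := by
  set v : Fin N → ℝ := fun k => ((k : ℕ) : ℝ) ^ 2 with hv
  have hinj : Function.Injective v := fun a b h => by
    have h1 := (sq_eq_sq₀ (Nat.cast_nonneg (a : ℕ)) (Nat.cast_nonneg (b : ℕ))).1 h
    exact Fin.ext (Nat.cast_injective h1)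
  have hdet : IsUnit (Matrix.vandermonde v).det :=
    isUnit_iff_ne_zero.2 (Matrix.det_vandermonde_ne_zero_iff.2 hinj)
  refine ⟨fun k => ((k : ℕ) : ℝ), fun j k => (Matrix.vandermonde v)⁻¹ j k, fun i j => ?_⟩
  have h := congrFun (congrFun (Matrix.nonsing_inv_mul _ hdet) j) i
  rw [Matrix.mul_apply, Matrix.one_apply] at h
  simp only [Matrix.vandermonde_apply] at h
  rw [h]
  simp [eq_comm]

end Interpolation

theorem offBlock_inl {n ε : ℕ} (μ : Fin n) :
    offBlock (.inl μ : FrameIdx n ε) = Finset.univ.erase μ := by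
  ext ν; simp [offBlock, eq_comm]

theorem offBlock_inr_inl {n ε : ℕ} (μ : Fin n) :
    offBlock (.inr (.inl μ) : FrameIdx n ε) = Finset.univ.erase μ := by
  ext ν; simp [offBlock, eq_comm]

theorem offBlock_inr_inr {n ε : ℕ} (a : Fin ε) :
    offBlock (.inr (.inr a) : FrameIdx n ε) = Finset.univ := by
  ext ν; simp [offBlock]

theorem card_offBlock_lt {n ε : ℕ} (a : FrameIdx n ε) : (offBlock a).card < n + ε := by
  rcases a with μ | μ | a
  · rw [offBlock_inl, Finset.card_erase_of_mem (Finset.mem_univ _), Finset.card_fin]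
    have := μ.pos; omega
  · rw [offBlock_inr_inl, Finset.card_erase_of_mem (Finset.mem_univ _), Finset.card_fin]
    have := μ.pos; omega
  · rw [offBlock_inr_inr, Finset.card_fin]
    have := a.pos; omega

namespace AdaptedFrame

variable {E : Type*} [NormedAddCommGroup E] [NormedSpace ℝ E]
  {O : Set E} {g : E → E →L[ℝ] E →L[ℝ] ℝ} {A : E → E →L[ℝ] E}
  {Γ : E → E →L[ℝ] E →L[ℝ] E} {z : E → E}
  {n ε : ℕ} {x q : Fin n → E → ℝ} {N : Fin n → E → E} {F : Fin n ⊕ Fin ε → E → E}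

/-- The orthonormal frame obtained by normalising the gradients. -/
noncomputable def unitFrame (q : Fin n → E → ℝ) (N : Fin n → E → E) (F : Fin n ⊕ Fin ε → E → E)
    (y : E) : FrameIdx n ε → E :=
  Sum.elim (fun μ => (q μ y)⁻¹ • N μ y) fun i => F i y

theorem inner_unitFrame (H : LocalPKY O g A Γ z) (L : AdaptedFrame O g A z x q N F) {y : E}
    (hy : y ∈ O) (a b : FrameIdx n ε) :
    g y (unitFrame q N F y a) (unitFrame q N F y b) = if a = b then 1 else 0 := by
  rcases a with μ | i <;> rcases b with ν | j
  · simp only [unitFrame, Sum.elim_inl, map_smul, smul_apply, smul_eq_mul]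
    by_cases h : μ = ν
    · subst h
      have := (L.q_pos y hy μ).ne'
      rw [L.inner_NN_self y hy, if_pos rfl]
      field_simp
    · rw [L.inner_NN y hy _ _ h, if_neg fun e => h (Sum.inl_injective e), mul_zero, mul_zero]
  · simp [unitFrame, L.inner_NF y hy]
  · simp only [unitFrame, Sum.elim_inl, Sum.elim_inr, map_smul, smul_eq_mul]
    rw [H.symm y hy, L.inner_NF y hy]
    simp
  · simp [unitFrame, L.inner_FF y hy]

theorem eq_sum_unitFrame (H : LocalPKY O g A Γ z) (L : AdaptedFrame O g A z x q N F) {y : E}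
    (hy : y ∈ O) (v : E) :
    v = ∑ a, g y (unitFrame q N F y a) v • unitFrame q N F y a := by
  rw [← sub_eq_zero]
  have h : ∀ a, g y (unitFrame q N F y a)
      (v - ∑ a, g y (unitFrame q N F y a) v • unitFrame q N F y a) = 0 := by
    intro a
    rw [map_sub, map_sum]
    simp only [map_smul, smul_eq_mul, L.inner_unitFrame H hy, mul_ite, mul_one, mul_zero,
      Finset.sum_ite_eq, Finset.mem_univ, if_true, sub_self]
  refine L.complete y hy _ (fun i => h (.inr i)) fun μ => ?_
  have h1 := h (.inl μ)
  simp only [unitFrame, Sum.elim_inl, map_smul, smul_apply, smul_eq_mul] at h1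
  exact (mul_eq_zero.1 h1).resolve_left (inv_ne_zero (L.q_pos y hy μ).ne')

theorem inner_eq_sum (H : LocalPKY O g A Γ z) (L : AdaptedFrame O g A z x q N F) {y : E}
    (hy : y ∈ O) (u v : E) : g y u v =
      ∑ a, g y (unitFrame q N F y a) u * g y (unitFrame q N F y a) v := by
  conv_lhs => rw [L.eq_sum_unitFrame H hy v, map_sum]
  refine Finset.sum_congr rfl fun a _ => ?_
  rw [map_smul, smul_eq_mul, H.symm y hy u, mul_comm]

theorem endo_unit_inl (L : AdaptedFrame O g A z x q N F) {y : E} (hy : y ∈ O) (μ : Fin n) :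
    A y (unitFrame q N F y (.inl μ)) = -x μ y • unitFrame q N F y (.inr (.inl μ)) := by
  have := (L.q_pos y hy μ).ne'
  simp only [unitFrame, Sum.elim_inl, Sum.elim_inr, map_smul, L.endo_N y hy, smul_smul]
  congr 1
  field_simp

theorem endo_unit_inr_inl (L : AdaptedFrame O g A z x q N F) {y : E} (hy : y ∈ O) (μ : Fin n) :
    A y (unitFrame q N F y (.inr (.inl μ))) = x μ y • unitFrame q N F y (.inl μ) := by
  simp only [unitFrame, Sum.elim_inl, Sum.elim_inr, L.endo_F y hy, smul_smul, div_eq_mul_inv]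

theorem endo_unit_inr_inr (L : AdaptedFrame O g A z x q N F) {y : E} (hy : y ∈ O) (a : Fin ε) :
    A y (unitFrame q N F y (.inr (.inr a))) = 0 := L.endo_F_inr y hy a

/-- The canonical form of the principal tensor. -/
theorem inner_endo_eq_sum (H : LocalPKY O g A Γ z) (L : AdaptedFrame O g A z x q N F) {y : E}
    (hy : y ∈ O) (u v : E) : g y u (A y v) = ∑ μ, x μ y *
      (g y (unitFrame q N F y (.inl μ)) u * g y (unitFrame q N F y (.inr (.inl μ))) v -
        g y (unitFrame q N F y (.inr (.inl μ))) u * g y (unitFrame q N F y (.inl μ)) v) := by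
  have key : ∀ w, g y w (A y v) = -g y (A y w) v := fun w => by rw [H.skew y hy, neg_neg]
  rw [L.inner_eq_sum H hy, Fintype.sum_sum_type, Fintype.sum_sum_type]
  simp only [key, L.endo_unit_inl hy, L.endo_unit_inr_inl hy, L.endo_unit_inr_inr hy, map_smul,
    smul_apply, map_zero, zero_apply, neg_zero, mul_zero, Finset.sum_const_zero, add_zero]
  rw [← Finset.sum_add_distrib]
  refine Finset.sum_congr rfl fun μ _ => ?_
  simp only [smul_eq_mul]
  ring

/-- On a block the resolvent divides by `1 + s² x_μ²`, which removes exactly that factor from `W_s`;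
on the kernel it acts as the identity. -/
theorem genK_eq_sum [FiniteDimensional ℝ E] (H : LocalPKY O g A Γ z)
    (L : AdaptedFrame O g A z x q N F) {y : E} (hy : y ∈ O) {s : ℝ}
    (hdet : detW (A y) s = ∏ μ, (1 + s ^ 2 * x μ y ^ 2)) (u v : E) :
    genK (g y) (A y) s u v = ∑ a, (∏ ν ∈ offBlock a, (1 + s ^ 2 * x ν y ^ 2)) *
      (g y (unitFrame q N F y a) u * g y (unitFrame q N F y a) v) := by
  have key : ∀ w v, g y w (A y (A y v)) = g y (A y (A y w)) v := fun w v => by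
    rw [H.skew y hy, H.skew y hy, neg_neg]
  -- With `v = (1 - s² A²) B_s v` the resolvent never has to be evaluated on frame vectors; only
  -- `A²` does.
  rw [← H.resolvent_apply hy s v, H.genK_resolventArg hy, hdet, L.inner_eq_sum H hy,
    Finset.mul_sum]
  refine Finset.sum_congr rfl fun a _ => ?_
  rw [map_sub, map_smul, key, smul_eq_mul]
  rcases a with μ | μ | a
  · rw [offBlock_inl, L.endo_unit_inl hy, map_smul, L.endo_unit_inr_inl hy, smul_smul, map_smul,
      smul_apply, smul_eq_mul, ← Finset.mul_prod_erase _ _ (Finset.mem_univ μ)]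
    ring
  · rw [offBlock_inr_inl, L.endo_unit_inr_inl hy, map_smul, L.endo_unit_inl hy, smul_smul, map_smul,
      smul_apply, smul_eq_mul, ← Finset.mul_prod_erase _ _ (Finset.mem_univ μ)]
    ring
  · rw [offBlock_inr_inr, L.endo_unit_inr_inr hy, map_zero, map_zero, zero_apply]
    ring

end AdaptedFrame

section CubicForms

variable {D : ℕ}

theorem apply_eq_sum_single {f : EuclideanSpace ℝ (Fin D) → ℝ} (hf : IsLinearMap ℝ f)
    (v : EuclideanSpace ℝ (Fin D)) : f v = ∑ i, v i * f (EuclideanSpace.single i 1) := by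
  have := congrArg (hf.mk' f) (euclidean_eq_sum v)
  simpa only [map_sum, map_smul, IsLinearMap.mk'_apply, smul_eq_mul] using this

theorem apply_eq_sum_single₃ {f : EuclideanSpace ℝ (Fin D) → EuclideanSpace ℝ (Fin D) →
      EuclideanSpace ℝ (Fin D) → ℝ}
    (hf₁ : ∀ u v, IsLinearMap ℝ fun w => f w u v) (hf₂ : ∀ w v, IsLinearMap ℝ fun u => f w u v)
    (hf₃ : ∀ w u, IsLinearMap ℝ fun v => f w u v) (w u v : EuclideanSpace ℝ (Fin D)) :
    f w u v = ∑ i, ∑ j, ∑ k, f (EuclideanSpace.single i 1) (EuclideanSpace.single j 1)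
      (EuclideanSpace.single k 1) * (w i * u j * v k) := by
  rw [apply_eq_sum_single (hf₁ u v) w]
  refine Finset.sum_congr rfl fun i _ => ?_
  rw [apply_eq_sum_single (hf₂ _ v) u, Finset.mul_sum]
  refine Finset.sum_congr rfl fun j _ => ?_
  rw [apply_eq_sum_single (hf₃ _ _) v, Finset.mul_sum, Finset.mul_sum]
  exact Finset.sum_congr rfl fun k _ => by ring

/-- A cubic form vanishes only if its coefficients have no totally symmetric part. -/
theorem sym3_eq_zero_of_cubic {S : Fin D → Fin D → Fin D → ℝ}
    (h : ∀ u : EuclideanSpace ℝ (Fin D), ∑ i, ∑ j, ∑ k, S i j k * (u i * u j * u k) = 0)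
    (a b c : Fin D) : sym3 S a b c = 0 := by
  set f : EuclideanSpace ℝ (Fin D) → EuclideanSpace ℝ (Fin D) → EuclideanSpace ℝ (Fin D) → ℝ :=
    fun w u v => ∑ i, ∑ j, ∑ k, S i j k * (w i * u j * v k) with hf
  have hadd₁ : ∀ w w' u v, f (w + w') u v = f w u v + f w' u v := fun w w' u v => by
    simp only [hf, PiLp.add_apply, add_mul, mul_add, Finset.sum_add_distrib]
  have hadd₂ : ∀ w u u' v, f w (u + u') v = f w u v + f w u' v := fun w u u' v => by
    simp only [hf, PiLp.add_apply, add_mul, mul_add, Finset.sum_add_distrib]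
  have hadd₃ : ∀ w u v v', f w u (v + v') = f w u v + f w u v' := fun w u v v' => by
    simp only [hf, PiLp.add_apply, mul_add, Finset.sum_add_distrib]
  have hs : ∀ i j k, f (EuclideanSpace.single i 1) (EuclideanSpace.single j 1)
      (EuclideanSpace.single k 1) = S i j k := fun i j k => by simp [hf]
  have h0 : ∀ u, f u u u = 0 := h
  -- Polarisation: the cubic form vanishes at `u + v + w` and at the partial sums, and
  -- inclusion–exclusion isolates the mixed terms.
  have pol : ∀ u v w, f u v w + f u w v + f v u w + f v w u + f w u v + f w v u = 0 := by
    intro u v w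
    have h1 := h0 (u + v + w)
    have h2 := h0 (u + v)
    have h3 := h0 (u + w)
    have h4 := h0 (v + w)
    simp only [hadd₁, hadd₂, hadd₃, h0] at h1 h2 h3 h4
    linarith
  have := pol (EuclideanSpace.single a 1) (EuclideanSpace.single b 1) (EuclideanSpace.single c 1)
  simp only [hs] at this
  rw [sym3, this, mul_zero]

end CubicForms

end TorsionKY

/-! ### The `K^{(j)}` as combinations of the generating function -/

namespace TorsionKY

section Manifold

variable {D : ℕ} {M : Type*} [TopologicalSpace M] [ChartedSpace (EuclideanSpace ℝ (Fin D)) M]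
  [IsManifold (𝓡 D) ∞ M] {g : Metric D M} {T : FormField D M 3} {h : FormField D M 2}
  {vol : FormField D M D} {n ε : ℕ}
  {φ : OpenPartialHomeomorph M (EuclideanSpace ℝ (Fin D))}

/-- The endomorphism field of `h` in the chart `φ`. -/
noncomputable abbrev chartEndo (g : Metric D M) (h : FormField D M 2)
    (φ : OpenPartialHomeomorph M (EuclideanSpace ℝ (Fin D))) :
    EuclideanSpace ℝ (Fin D) → EuclideanSpace ℝ (Fin D) →L[ℝ] EuclideanSpace ℝ (Fin D) :=
  CoordPKY.endo (metricComp g φ) (comp (toTensor h) φ)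

/-- The vector field dual to `ξ` in the chart `φ`. -/
noncomputable abbrev chartXi (g : Metric D M) (T : FormField D M 3) (h : FormField D M 2)
    (φ : OpenPartialHomeomorph M (EuclideanSpace ℝ (Fin D))) :
    EuclideanSpace ℝ (Fin D) → EuclideanSpace ℝ (Fin D) :=
  CoordPKY.xiVec (metricComp g φ) (comp (toTensor h) φ) (comp (toTensor T) φ)

/-- The generating function of the Killing tensors in the chart `φ`. -/
noncomputable abbrev chartGenK (g : Metric D M) (h : FormField D M 2)
    (φ : OpenPartialHomeomorph M (EuclideanSpace ℝ (Fin D))) (s : ℝ)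
    (y u v : EuclideanSpace ℝ (Fin D)) : ℝ :=
  genK (coordBilin (metricComp g φ y)) (chartEndo g h φ y) s u v

theorem exists_frame_at (hε : ε ≤ 1) (hD : D = 2 * n + ε) (hT : IsSmooth (toTensor T))
    (hh : IsPKY g T h n ε) (hφ : φ ∈ atlas (EuclideanSpace ℝ (Fin D)) M)
    {y : EuclideanSpace ℝ (Fin D)} (hy : y ∈ φ.target) :
    ∃ (x q : Fin n → ℝ) (e : FrameIdx n ε → EuclideanSpace ℝ (Fin D)),
      (∀ a b, coordBilin (metricComp g φ y) (e a) (e b) = if a = b then 1 else 0) ∧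
      (∀ u v, coordBilin (metricComp g φ y) u v = ∑ a,
        coordBilin (metricComp g φ y) (e a) u * coordBilin (metricComp g φ y) (e a) v) ∧
      (∀ u v, coordBilin (metricComp g φ y) u (chartEndo g h φ y v) = ∑ μ, x μ *
        (coordBilin (metricComp g φ y) (e (.inl μ)) u *
          coordBilin (metricComp g φ y) (e (.inr (.inl μ))) v -
        coordBilin (metricComp g φ y) (e (.inr (.inl μ))) u *
          coordBilin (metricComp g φ y) (e (.inl μ)) v)) ∧
      (∀ s u v, chartGenK g h φ s y u v = ∑ a, (∏ ν ∈ offBlock a, (1 + s ^ 2 * x ν ^ 2)) *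
        (coordBilin (metricComp g φ y) (e a) u * coordBilin (metricComp g φ y) (e a) v)) ∧
      (∀ μ, coordBilin (metricComp g φ y) (chartXi g T h φ y) (e (.inl μ)) = 0) ∧
      (∀ μ, coordBilin (metricComp g φ y) (chartXi g T h φ y) (e (.inr (.inl μ))) = q μ) ∧
      ∀ μ, 0 < q μ := by
  obtain ⟨O, hO, hOo, hyO, x, X⟩ := localEigen hD hT hh hφ hy
  have H := (coordPKY hT hh hφ).localPKY.mono hO hOo
  have hE : Module.finrank ℝ (EuclideanSpace ℝ (Fin D)) = 2 * n + ε := by simp [hD]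
  obtain ⟨O', hO', hOo', hyO', q, N, F, L⟩ := X.exists_adaptedFrame H hE hε hyO
  have H' := H.mono hO' hOo'
  refine ⟨fun μ => x μ y, fun μ => q μ y, AdaptedFrame.unitFrame q N F y,
    L.inner_unitFrame H' hyO', L.inner_eq_sum H' hyO', L.inner_endo_eq_sum H' hyO',
    fun s => L.genK_eq_sum H' hyO' (X.det y hyO s), fun μ => ?_, L.inner_zF y hyO',
    L.q_pos y hyO'⟩
  simp only [AdaptedFrame.unitFrame, Sum.elim_inl, map_smul]
  rw [L.inner_zN y hyO', smul_zero]

/-- Both sides are diagonal in the same frame, with entries matched by `sum_pow_mul_elemSymm`. The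
result mentions no frame, so it passes from pointwise algebra to smooth fields. -/
theorem sum_killingTensor (hε : ε ≤ 1) (hD : D = 2 * n + ε) (hT : IsSmooth (toTensor T))
    (hvol : IsVolumeElement g vol) (hh : IsPKY g T h n ε)
    (hφ : φ ∈ atlas (EuclideanSpace ℝ (Fin D)) M)
    {y : EuclideanSpace ℝ (Fin D)} (hy : y ∈ φ.target) (s : ℝ)
    (u v : EuclideanSpace ℝ (Fin D)) :
    ∑ j : Fin (n + ε), (s ^ 2) ^ (j : ℕ) * killingTensor g vol h j (by omega) (φ.symm y)
      ![chartDiff φ y u, chartDiff φ y v] = chartGenK g h φ s y u v := by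
  obtain ⟨x, q, e, hort, -, hform, hgen, -⟩ := exists_frame_at hε hD hT hh hφ hy
  obtain ⟨L, hL⟩ := exists_chartDiff_equiv hφ hy
  have hE : IsOrthonormal g (φ.symm y) fun a => chartDiff φ y (e a) := fun a b => by
    rw [← coordBilin_metricComp, hort]
  have hx : ∀ u v : TangentSpace (𝓡 D) (φ.symm y), h (φ.symm y) ![u, v] = ∑ μ, x μ *
      (g.inner (φ.symm y) (chartDiff φ y (e (.inl μ))) u *
        g.inner (φ.symm y) (chartDiff φ y (e (.inr (.inl μ)))) v -
      g.inner (φ.symm y) (chartDiff φ y (e (.inr (.inl μ)))) u *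
        g.inner (φ.symm y) (chartDiff φ y (e (.inl μ))) v) := by
    intro u v
    obtain ⟨u, rfl⟩ := L.surjective u
    obtain ⟨v, rfl⟩ := L.surjective v
    rw [hL, hL, form_chartDiff, ← (coordPKY hT hh hφ).inner_endo hy, hform]
    simp only [coordBilin_metricComp]
  simp only [killingTensor_frame g hvol h (φ.symm y) hD hE hx, hgen, Finset.mul_sum]
  rw [Finset.sum_comm]
  refine Finset.sum_congr rfl fun a _ => ?_
  rw [← sum_pow_mul_elemSymm x (offBlock a) (s ^ 2) (card_offBlock_lt a), Finset.sum_mul]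
  refine Finset.sum_congr rfl fun j _ => ?_
  rw [coordBilin_metricComp, coordBilin_metricComp, mul_assoc]

/-- Each `K^{(j)}` is a linear combination of values of the generating function. -/
theorem exists_killingTensor_eq_sum (hε : ε ≤ 1) (hD : D = 2 * n + ε)
    (hT : IsSmooth (toTensor T)) (hvol : IsVolumeElement g vol) (hh : IsPKY g T h n ε) (j : ℕ)
    (hj : 2 * j < D) : ∃ (s c : Fin (n + ε) → ℝ),
      ∀ φ ∈ atlas (EuclideanSpace ℝ (Fin D)) M, ∀ y ∈ φ.target, ∀ u v,
        killingTensor g vol h j hj (φ.symm y) ![chartDiff φ y u, chartDiff φ y v] =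
          ∑ k, c k * chartGenK g h φ (s k) y u v := by
  obtain ⟨s, c, hsc⟩ := exists_interpolation (n + ε)
  -- Since `D = 2n + ε` with `ε ≤ 1`, the condition `2j < D` means `j < n + ε`.
  refine ⟨s, c ⟨j, by omega⟩, fun φ hφ y hy u v => ?_⟩
  simp only [← sum_killingTensor hε hD hT hvol hh hφ hy, Finset.mul_sum]
  rw [Finset.sum_comm]
  simp only [← mul_assoc]
  simp only [← Finset.sum_mul, hsc, ite_mul, one_mul, zero_mul, Finset.sum_ite_eq',
    Finset.mem_univ, if_true]

end Manifold

section Cubic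

variable {D : ℕ} {O : Set (EuclideanSpace ℝ (Fin D))} {G : MetricComp D} {H : Comp D 2}
  {T : Comp D 3}

theorem CoordPKY.coordConn_leviCivita (P : CoordPKY O G H T) (y w u : EuclideanSpace ℝ (Fin D)) :
    coordConn (leviCivita G y) w u = symConn (coordConn (torsionConn G T y)) w u := by
  refine eq_of_eq_single (f := fun w => coordConn (leviCivita G y) w u)
    (f' := fun w => symConn (coordConn (torsionConn G T y)) w u) ?_ ?_ (fun m => ?_) w
  · exact ⟨fun a b => by simp, fun a b => by simp⟩
  · exact ⟨fun a b => by simp only [symConn, map_add, add_apply]; module,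
      fun a b => by simp only [symConn, map_smul, smul_apply]; module⟩
  refine eq_of_eq_single (f := fun u => coordConn (leviCivita G y) (EuclideanSpace.single m 1) u)
    (f' := fun u => symConn (coordConn (torsionConn G T y)) (EuclideanSpace.single m 1) u)
    ?_ ?_ (fun i => ?_) u
  · exact ⟨fun a b => by simp, fun a b => by simp⟩
  · exact ⟨fun a b => by simp only [symConn, map_add, add_apply]; module,
      fun a b => by simp only [symConn, map_smul, smul_apply]; module⟩
  rw [symConn, coordConn_single, coordConn_single, coordConn_single, ← Finset.sum_add_distrib,
    Finset.smul_sum]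
  refine Finset.sum_congr rfl fun l _ => ?_
  rw [← add_smul, smul_smul]
  congr 1
  have h1 : (fun y => G y i m) = fun y => G y m i := funext fun y => P.symm y i m
  have h2 : ∀ r, T y ![i, m, r] = -T y ![m, i, r] := fun r => P.T_swap_left y i m r
  simp only [torsionConn, leviCivita, h1, h2, mul_neg, Finset.sum_neg_distrib]
  have h3 : ∑ r, (G y)⁻¹ l r * (pderiv i (fun z => G z r m) y + pderiv m (fun z => G z r i) y -
      pderiv r (fun z => G z m i) y) = ∑ r, (G y)⁻¹ l r * (pderiv m (fun z => G z r i) y +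
        pderiv i (fun z => G z r m) y - pderiv r (fun z => G z m i) y) :=
    Finset.sum_congr rfl fun r _ => by ring
  rw [h3]
  ring

theorem differentiableAt_sum_sum_smul {E F ι κ : Type*} [NormedAddCommGroup E]
    [NormedSpace ℝ E] [NormedAddCommGroup F] [NormedSpace ℝ F] [Fintype ι] [Fintype κ] {y : E}
    {S : E → ι → κ → ℝ} (hS : ∀ i j, DifferentiableAt ℝ (fun y => S y i j) y) (c : ι → κ → F) :
    DifferentiableAt ℝ (fun y => ∑ i, ∑ j, S y i j • c i j) y :=
  DifferentiableAt.fun_sum fun i _ => DifferentiableAt.fun_sum fun j _ =>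
    (hS i j).smul (differentiableAt_const _)

theorem differentiableAt_coordBilin {S : MetricComp D} {y : EuclideanSpace ℝ (Fin D)}
    (hS : ∀ i j, DifferentiableAt ℝ (fun y => S y i j) y) :
    DifferentiableAt ℝ (fun y => coordBilin (S y)) y :=
  differentiableAt_sum_sum_smul (S := S) hS fun i j =>
    (EuclideanSpace.proj i : EuclideanSpace ℝ (Fin D) →L[ℝ] ℝ).smulRight
      (EuclideanSpace.proj j : EuclideanSpace ℝ (Fin D) →L[ℝ] ℝ)

theorem sum_covD {C : ConnComp D} {S : Comp D 2} {y : EuclideanSpace ℝ (Fin D)}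
    (hS : ∀ i j, DifferentiableAt ℝ (fun y => S y ![i, j]) y) (w u v : EuclideanSpace ℝ (Fin D)) :
    ∑ m, ∑ i, ∑ j, covD C S y m ![i, j] * (w m * u i * v j) =
      fderiv ℝ (fun y => coordBilin (Matrix.of fun i j => S y ![i, j]) u v) y w -
        (coordBilin (Matrix.of fun i j => S y ![i, j]) (coordConn (C y) w u) v +
          coordBilin (Matrix.of fun i j => S y ![i, j]) u (coordConn (C y) w v)) := by
  have hd := differentiableAt_coordBilin (S := fun y => Matrix.of fun i j => S y ![i, j]) hS
  rw [fderiv_apply_apply hd]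
  set B := fderiv ℝ (fun y => coordBilin (Matrix.of fun i j => S y ![i, j])) y
  set K := coordBilin (Matrix.of fun i j => S y ![i, j]) with hK
  rw [apply_eq_sum_single₃ (f := fun w u v => B w u v - (K (coordConn (C y) w u) v +
    K u (coordConn (C y) w v)))]
  · refine Finset.sum_congr rfl fun m _ => Finset.sum_congr rfl fun i _ =>
      Finset.sum_congr rfl fun j _ => ?_
    congr 1
    rw [fderiv_coordBilin hd, CoordPKY.covD_two, coordConn_single, coordConn_single, hK]
    simp only [map_sum, map_smul, sum_apply, smul_apply, coordBilin_single, smul_eq_mul,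
      Matrix.of_apply, pderiv]
  all_goals
    intro a c
    constructor
    · intro p q
      simp only [map_add, add_apply]
      ring
    · intro p q
      simp only [map_smul, smul_apply, smul_eq_mul]
      ring

end Cubic

end TorsionKY

/-! ### Killing equation and Schouten–Nijenhuis bracket in coordinates -/

namespace TorsionKY

namespace CoordPKY

variable {D : ℕ} {O : Set (EuclideanSpace ℝ (Fin D))} {G : MetricComp D} {H : Comp D 2}
  {T : Comp D 3} {ι κ : Type*} [Fintype ι] [Fintype κ]

/-- The tensor `K` is a linear combination of values of the generating function. -/
def IsGenComb (O : Set (EuclideanSpace ℝ (Fin D))) (G : MetricComp D) (H : Comp D 2)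
    (s c : ι → ℝ) (K : Comp D 2) : Prop :=
  ∀ y ∈ O, ∀ u v, coordBilin (Matrix.of fun i j => K y ![i, j]) u v =
    ∑ k, c k * genK (coordBilin (G y)) (endo G H y) (s k) u v

theorem contDiffOn_of_isGenComb (P : CoordPKY O G H T) {s c : ι → ℝ} {K : Comp D 2}
    (hK : IsGenComb O G H s c K) (i j : Fin D) : ContDiffOn ℝ ∞ (fun y => K y ![i, j]) O := by
  refine ContDiffOn.congr (f := fun y => ∑ k, c k * genK (coordBilin (G y)) (endo G H y) (s k)
    (EuclideanSpace.single i 1) (EuclideanSpace.single j 1)) ?_ fun y hy => ?_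
  · exact ContDiffOn.sum fun k _ => contDiffOn_const.mul (P.localPKY.smooth_genK _ _ _)
  · rw [← hK y hy, coordBilin_single, Matrix.of_apply]

theorem sum_covD_of_isGenComb (P : CoordPKY O G H T) {s c : ι → ℝ} {K : Comp D 2}
    (hK : IsGenComb O G H s c K) {y : EuclideanSpace ℝ (Fin D)} (hy : y ∈ O)
    (w u : EuclideanSpace ℝ (Fin D)) :
    ∑ m, ∑ i, ∑ j, covD (leviCivita G) K y m ![i, j] * (w m * u i * u j) =
      ∑ k, c k * (fderiv ℝ (fun y => genK (coordBilin (G y)) (endo G H y) (s k) u u) y w -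
        2 * genK (coordBilin (G y)) (endo G H y) (s k)
          (symConn (coordConn (torsionConn G T y)) w u) u) := by
  have hO : O ∈ nhds y := P.isOpen.mem_nhds hy
  rw [sum_covD fun i j => ((P.contDiffOn_of_isGenComb hK i j).contDiffAt hO).differentiableAt
    (by simp)]
  have h1 : fderiv ℝ (fun y => coordBilin (Matrix.of fun i j => K y ![i, j]) u u) y w =
      ∑ k, c k * fderiv ℝ (fun y => genK (coordBilin (G y)) (endo G H y) (s k) u u) y w := by
    have hd : ∀ k, DifferentiableAt ℝ
        (fun y => genK (coordBilin (G y)) (endo G H y) (s k) u u) y := fun k =>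
      ((P.localPKY.smooth_genK (s k) u u).contDiffAt hO).differentiableAt (by simp)
    have e : (fun y => coordBilin (Matrix.of fun i j => K y ![i, j]) u u) =ᶠ[nhds y]
        fun y => ∑ k, c k * genK (coordBilin (G y)) (endo G H y) (s k) u u := by
      filter_upwards [hO] with x hx using hK x hx u u
    rw [e.fderiv_eq, fderiv_fun_sum fun k _ => (hd k).const_mul (c k), sum_apply]
    exact Finset.sum_congr rfl fun k _ => by
      rw [fderiv_const_mul (hd k), smul_apply, smul_eq_mul]
  rw [h1, hK y hy, hK y hy, ← Finset.sum_add_distrib, ← Finset.sum_sub_distrib]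
  refine Finset.sum_congr rfl fun k _ => ?_
  rw [P.localPKY.genK_symm hy _ u, P.coordConn_leviCivita]
  ring

theorem sym3_covD (P : CoordPKY O G H T) {s c : ι → ℝ} {K : Comp D 2}
    (hK : IsGenComb O G H s c K) {y : EuclideanSpace ℝ (Fin D)} (hy : y ∈ O) (i j k : Fin D) :
    sym3 (fun a b c => covD (leviCivita G) K y a ![b, c]) i j k = 0 := by
  refine sym3_eq_zero_of_cubic (fun u => ?_) i j k
  rw [P.sum_covD_of_isGenComb hK hy]
  refine Finset.sum_eq_zero fun k _ => ?_
  rw [P.localPKY.fderiv_genK_self hy, sub_self, mul_zero]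

/-- Raising an index of `K_s` gives the vector `W_s B_s u`. This is the direction of differentiation
in `bracketTerm`. -/
theorem sum_inv_mul_sum (P : CoordPKY O G H T) {s c : ι → ℝ} {K : Comp D 2}
    (hK : IsGenComb O G H s c K) {y : EuclideanSpace ℝ (Fin D)} (hy : y ∈ O)
    (u : EuclideanSpace ℝ (Fin D)) (f : Fin D) :
    ∑ a, ∑ e, K y ![e, a] * (G y)⁻¹ e f * u a =
      (∑ k, c k • detW (endo G H y) (s k) • resolvent (endo G H y) (s k) u) f := by
  set w : EuclideanSpace ℝ (Fin D) := WithLp.toLp 2 fun f =>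
    ∑ a, ∑ e, K y ![e, a] * (G y)⁻¹ e f * u a with hw
  suffices h : w = ∑ k, c k • detW (endo G H y) (s k) • resolvent (endo G H y) (s k) u by
    rw [← h]
  have hsymm : ∀ e f, (G y)⁻¹ e f = (G y)⁻¹ f e := fun e f => by
    have : (G y).IsSymm := Matrix.IsSymm.ext fun i j => P.symm y j i
    exact congrFun (congrFun this.inv.eq f) e
  refine P.localPKY.ext_inner hy fun v => ?_
  refine eq_of_eq_single (f := fun v => coordBilin (G y) v w) (f' := fun v => coordBilin (G y) v
    (∑ k, c k • detW (endo G H y) (s k) • resolvent (endo G H y) (s k) u)) ?_ ?_ (fun r => ?_) v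
  · exact ⟨fun a b => by simp, fun a b => by simp⟩
  · exact ⟨fun a b => by rw [map_add, add_apply], fun a b => by rw [map_smul, smul_apply]⟩
  have h1 : coordBilin (G y) (EuclideanSpace.single r 1) w = ∑ a, K y ![r, a] * u a := by
    rw [← P.sum_inv_mul hy r fun e => ∑ a, K y ![e, a] * u a, coordBilin_apply]
    simp only [PiLp.single_apply, ite_mul, one_mul, zero_mul, mul_ite, mul_zero]
    rw [Finset.sum_comm]
    simp only [Finset.sum_ite_eq', Finset.mem_univ, if_true]
    refine Finset.sum_congr rfl fun f _ => ?_
    congr 1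
    simp only [hw, Finset.mul_sum]
    rw [Finset.sum_comm]
    refine Finset.sum_congr rfl fun e _ => Finset.sum_congr rfl fun a _ => ?_
    rw [hsymm]
    ring
  have h2 := hK y hy (EuclideanSpace.single r 1) u
  rw [coordBilin_apply] at h2
  simp only [PiLp.single_apply, ite_mul, one_mul, zero_mul, mul_ite, mul_zero,
    Matrix.of_apply] at h2
  rw [Finset.sum_comm] at h2
  simp only [Finset.sum_ite_eq', Finset.mem_univ, if_true] at h2
  rw [h1, h2, map_sum]
  exact Finset.sum_congr rfl fun k _ => by rw [map_smul, map_smul, genK, smul_eq_mul, smul_eq_mul]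

/-- On the diagonal `u, u, u` the first factor of the bracket supplies only a direction; linearity
in it splits the expression into bracket terms of generating functions. -/
theorem sum_insertD (P : CoordPKY O G H T) {s c : ι → ℝ} {r d : κ → ℝ} {K L : Comp D 2}
    (hK : IsGenComb O G H s c K) (hL : IsGenComb O G H r d L)
    {y : EuclideanSpace ℝ (Fin D)} (hy : y ∈ O) (u : EuclideanSpace ℝ (Fin D)) :
    ∑ i, ∑ j, ∑ k, insertD G K L y i j k * (u i * u j * u k) =
      ∑ k, ∑ l, c k * d l * LocalPKY.bracketTerm (fun y => coordBilin (G y)) (endo G H)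
        (fun y => coordConn (torsionConn G T y)) y (s k) (r l) u := by
  have h1 : ∑ i, ∑ j, ∑ k, insertD G K L y i j k * (u i * u j * u k) =
      ∑ f, ∑ j, ∑ k, covD (leviCivita G) L y f ![j, k] *
        ((∑ a, ∑ e, K y ![e, a] * (G y)⁻¹ e f * u a) * u j * u k) := by
    have h2 : ∀ j k, ∑ i, insertD G K L y i j k * (u i * u j * u k) =
        ∑ f, covD (leviCivita G) L y f ![j, k] *
          ((∑ a, ∑ e, K y ![e, a] * (G y)⁻¹ e f * u a) * u j * u k) := by
      intro j k
      simp only [insertD, Finset.sum_mul, Finset.mul_sum]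
      rw [Finset.sum_comm' (t' := Finset.univ) (s' := fun _ => Finset.univ) (by simp)]
      rw [Finset.sum_comm]
      conv_lhs => enter [2, i]; rw [Finset.sum_comm]
      rw [Finset.sum_comm]
      refine Finset.sum_congr rfl fun f _ => Finset.sum_congr rfl fun i _ =>
        Finset.sum_congr rfl fun e _ => ?_
      ring
    conv_lhs => rw [Finset.sum_comm]; enter [2, j]; rw [Finset.sum_comm]; enter [2, k]; rw [h2]
    conv_rhs => rw [Finset.sum_comm]; enter [2, j]; rw [Finset.sum_comm]
  simp only [h1, P.sum_inv_mul_sum hK hy]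
  rw [P.sum_covD_of_isGenComb hL hy, Finset.sum_comm]
  refine Finset.sum_congr rfl fun l _ => ?_
  set Φ : EuclideanSpace ℝ (Fin D) → ℝ := fun w =>
    fderiv ℝ (fun y => genK (coordBilin (G y)) (endo G H y) (r l) u u) y w -
      2 * genK (coordBilin (G y)) (endo G H y) (r l)
        (symConn (coordConn (torsionConn G T y)) w u) u with hΦ
  have hlin : IsLinearMap ℝ Φ := by
    constructor
    · intro a b
      simp only [hΦ, genK, symConn, map_add, map_smul, add_apply, smul_apply, smul_eq_mul]
      ring
    · intro t a
      simp only [hΦ, genK, symConn, map_add, map_smul, add_apply, smul_apply, smul_eq_mul]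
      ring
  have h2 := map_sum (hlin.mk' Φ)
    (fun k => c k • detW (endo G H y) (s k) • resolvent (endo G H y) (s k) u) Finset.univ
  simp only [IsLinearMap.mk'_apply, hlin.map_smul (c _), smul_eq_mul] at h2
  change d l * Φ _ = ∑ k, c k * d l * Φ _
  rw [h2, Finset.mul_sum]
  exact Finset.sum_congr rfl fun k _ => by ring

theorem schoutenNijenhuis_eq_zero {n ε : ℕ} (P : CoordPKY O G H T) (hD : D = 2 * n + ε)
    (hε : ε ≤ 1) {x : Fin n → EuclideanSpace ℝ (Fin D) → ℝ}
    {O' : Set (EuclideanSpace ℝ (Fin D))} (hO' : O' ⊆ O) (hopen : IsOpen O')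
    (X : LocalEigen O' (endo G H) x)
    {s c : ι → ℝ} {r d : κ → ℝ} {K L : Comp D 2}
    (hK : IsGenComb O G H s c K) (hL : IsGenComb O G H r d L)
    {y : EuclideanSpace ℝ (Fin D)} (hy : y ∈ O') (i j k : Fin D) :
    schoutenNijenhuis G K L y i j k = 0 := by
  have hE : Module.finrank ℝ (EuclideanSpace ℝ (Fin D)) = 2 * n + ε := by simp [hD]
  have h := sym3_eq_zero_of_cubic
    (S := fun a b c => insertD G K L y a b c - insertD G L K y a b c) (fun u => ?_) i j k
  · rw [schoutenNijenhuis, ← h]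
    simp only [sym3]
    ring
  simp only [sub_mul, Finset.sum_sub_distrib]
  rw [P.sum_insertD hK hL (hO' hy), P.sum_insertD hL hK (hO' hy), sub_eq_zero, Finset.sum_comm]
  refine Finset.sum_congr rfl fun l _ => Finset.sum_congr rfl fun k _ => ?_
  rw [X.bracketTerm_comm (P.localPKY.mono hO' hopen) hE hε hy, mul_comm (c k)]

end CoordPKY

end TorsionKY

/-! ### Global statements and existence of canonical frames -/

namespace TorsionKY

theorem coordBilin_eq_sum_genK {D : ℕ} {ι : Type*} [Fintype ι] {S : Matrix (Fin D) (Fin D) ℝ}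
    {g₀ : EuclideanSpace ℝ (Fin D) →L[ℝ] EuclideanSpace ℝ (Fin D) →L[ℝ] ℝ}
    {A₀ : EuclideanSpace ℝ (Fin D) →L[ℝ] EuclideanSpace ℝ (Fin D)} {s c : ι → ℝ}
    (h : ∀ i j, S i j = ∑ k, c k * genK g₀ A₀ (s k) (EuclideanSpace.single i 1)
      (EuclideanSpace.single j 1)) (u v : EuclideanSpace ℝ (Fin D)) :
    coordBilin S u v = ∑ k, c k * genK g₀ A₀ (s k) u v := by
  refine eq_of_eq_single (f := fun u => coordBilin S u v)
    (f' := fun u => ∑ k, c k * genK g₀ A₀ (s k) u v) ?_ ?_ (fun i => ?_) u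
  · exact ⟨fun a b => by rw [map_add, add_apply], fun a b => by rw [map_smul, smul_apply]⟩
  · exact ⟨fun a b => by simp only [genK, map_add, add_apply, mul_add, Finset.sum_add_distrib],
      fun a b => by
        simp only [genK, map_smul, smul_apply, smul_eq_mul, Finset.mul_sum]
        exact Finset.sum_congr rfl fun k _ => by ring⟩
  refine eq_of_eq_single (f := fun v => coordBilin S (EuclideanSpace.single i 1) v)
    (f' := fun v => ∑ k, c k * genK g₀ A₀ (s k) (EuclideanSpace.single i 1) v) ?_ ?_
    (fun j => ?_) v
  · exact ⟨fun a b => map_add _ _ _, fun a b => map_smul _ _ _⟩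
  · exact ⟨fun a b => by simp only [genK, map_add, mul_add, Finset.sum_add_distrib],
      fun a b => by
        simp only [genK, map_smul, smul_eq_mul, Finset.mul_sum]
        exact Finset.sum_congr rfl fun k _ => by ring⟩
  rw [coordBilin_single, h]

section Manifold

variable {D : ℕ} {M : Type*} [TopologicalSpace M] [ChartedSpace (EuclideanSpace ℝ (Fin D)) M]
  [IsManifold (𝓡 D) ∞ M] {g : Metric D M} {T : FormField D M 3} {h : FormField D M 2}
  {vol : FormField D M D} {n ε : ℕ}
  {φ : OpenPartialHomeomorph M (EuclideanSpace ℝ (Fin D))}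

theorem exists_isGenComb (hε : ε ≤ 1) (hD : D = 2 * n + ε) (hT : IsSmooth (toTensor T))
    (hvol : IsVolumeElement g vol) (hh : IsPKY g T h n ε) (j : ℕ) (hj : 2 * j < D) :
    ∃ (s c : Fin (n + ε) → ℝ), ∀ φ ∈ atlas (EuclideanSpace ℝ (Fin D)) M,
      CoordPKY.IsGenComb φ.target (metricComp g φ) (comp (toTensor h) φ) s c
        (comp (killingTensor g vol h j hj) φ) := by
  obtain ⟨s, c, hsc⟩ := exists_killingTensor_eq_sum hε hD hT hvol hh j hj
  refine ⟨s, c, fun φ hφ y hy u v => ?_⟩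
  refine coordBilin_eq_sum_genK (fun i j => ?_) u v
  rw [Matrix.of_apply, comp_two_eq, coordVec_eq, coordVec_eq, hsc φ hφ y hy]

theorem isKillingTensor_killingTensor (hε : ε ≤ 1) (hD : D = 2 * n + ε)
    (hT : IsSmooth (toTensor T)) (hvol : IsVolumeElement g vol) (hh : IsPKY g T h n ε) (j : ℕ)
    (hj : 2 * j < D) : IsKillingTensor g (killingTensor g vol h j hj) := by
  obtain ⟨s, c, hsc⟩ := exists_isGenComb hε hD hT hvol hh j hj
  refine ⟨fun φ hφ i => ?_, fun p u v => ?_, fun φ hφ y hy a b c => ?_⟩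
  · have hi : i = ![i 0, i 1] := by ext k; fin_cases k <;> rfl
    rw [hi]
    exact (coordPKY hT hh hφ).contDiffOn_of_isGenComb (hsc φ hφ) _ _
  · simp only [killingTensor, Matrix.cons_val_zero, Matrix.cons_val_one]
    congr 1
    simp only [contract]
    rw [Finset.sum_comm]
    refine Finset.sum_congr rfl fun i _ => Finset.sum_congr rfl fun k _ => ?_
    have hg : (gram g p).IsSymm := Matrix.IsSymm.ext fun i j => metric_symm g p _ _
    have hs : ∀ a, (gram g p)⁻¹ (k a) (i a) = (gram g p)⁻¹ (i a) (k a) := fun a =>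
      congrFun (congrFun hg.inv.eq (i a)) (k a)
    simp only [hs]
    ring
  · exact (coordPKY hT hh hφ).sym3_covD (hsc φ hφ) hy a b c

theorem snCommute_killingTensor (hε : ε ≤ 1) (hD : D = 2 * n + ε)
    (hT : IsSmooth (toTensor T)) (hvol : IsVolumeElement g vol) (hh : IsPKY g T h n ε) (i j : ℕ)
    (hi : 2 * i < D) (hj : 2 * j < D) :
    SNCommute g (killingTensor g vol h i hi) (killingTensor g vol h j hj) := by
  obtain ⟨s, c, hsc⟩ := exists_isGenComb hε hD hT hvol hh i hi
  obtain ⟨r, d, hrd⟩ := exists_isGenComb hε hD hT hvol hh j hj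
  intro φ hφ y hy k l m
  obtain ⟨O, hO, hOo, hyO, x, X⟩ := localEigen hD hT hh hφ hy
  exact (coordPKY hT hh hφ).schoutenNijenhuis_eq_zero hD hε hO hOo X (hsc φ hφ) (hrd φ hφ) hyO k l m

theorem killingTensor_eq_of_isCanonicalFrame (hvol : IsVolumeElement g vol) (hD : D = 2 * n + ε)
    {p : M} {x Q : Fin n → ℝ} {Q0 : ℝ} {e ehat : Fin n → TangentSpace (𝓡 D) p}
    {e0 : Fin ε → TangentSpace (𝓡 D) p} (he : IsCanonicalFrame g T h p x Q Q0 e ehat e0) (j : ℕ)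
    (hj : 2 * j < D) (u v : TangentSpace (𝓡 D) p) :
    killingTensor g vol h j hj p ![u, v] =
      ∑ μ, elemSymm x (Finset.univ.erase μ) j *
          (g.inner p (e μ) u * g.inner p (e μ) v +
            g.inner p (ehat μ) u * g.inner p (ehat μ) v) +
        ∑ a, elemSymm x Finset.univ j * (g.inner p (e0 a) u * g.inner p (e0 a) v) := by
  rw [killingTensor_frame g hvol h p hD (E := Sum.elim e (Sum.elim ehat e0)) he.orthonormal
    he.form_h j hj]
  simp only [Fintype.sum_sum_type, Sum.elim_inl, Sum.elim_inr, offBlock_inl, offBlock_inr_inl,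
    offBlock_inr_inr, mul_add, Finset.sum_add_distrib, add_assoc]

/-- In the preferred chart at `p`, tangent vectors coincide with their coordinates. -/
theorem chartDiff_chartAt (p : M) (u : EuclideanSpace ℝ (Fin D)) :
    (show EuclideanSpace ℝ (Fin D) from chartDiff (chartAt (EuclideanSpace ℝ (Fin D)) p)
      (chartAt (EuclideanSpace ℝ (Fin D)) p p) u) = u := by
  have : IsManifold (𝓡 D) 1 M := IsManifold.of_le (n := ∞) (by simp)
  have h := mfderivWithin_range_extChartAt_symm (I := 𝓡 D) (x := p)
  rw [ModelWithCorners.range_eq_univ, mfderivWithin_univ] at h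
  exact congrArg (fun f : EuclideanSpace ℝ (Fin D) →L[ℝ] EuclideanSpace ℝ (Fin D) => f u) h

/-- A second point `q` appears because the inverse chart returns `p` only up to a propositional
equality. -/
theorem assocForm_eq {p q : M} (hq : q = p) (v : EuclideanSpace ℝ (Fin D)) :
    assocForm g T h q v = ∑ i, CoordPKY.xi
      (metricComp g (chartAt (EuclideanSpace ℝ (Fin D)) p))
      (comp (toTensor h) (chartAt (EuclideanSpace ℝ (Fin D)) p))
      (comp (toTensor T) (chartAt (EuclideanSpace ℝ (Fin D)) p))
      (chartAt (EuclideanSpace ℝ (Fin D)) p p) i * v i := by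
  subst hq
  refine (Finset.mul_sum _ _ _).trans ?_
  exact Finset.sum_congr rfl fun i _ => (mul_assoc _ _ _).symm

theorem exists_isCanonicalFrame (hε : ε ≤ 1) (hD : D = 2 * n + ε) (hT : IsSmooth (toTensor T))
    (hh : IsPKY g T h n ε) (p : M) :
    ∃ (x Q : Fin n → ℝ) (Q0 : ℝ) (e ehat : Fin n → TangentSpace (𝓡 D) p)
      (e0 : Fin ε → TangentSpace (𝓡 D) p), IsCanonicalFrame g T h p x Q Q0 e ehat e0 := by
  set φ := chartAt (EuclideanSpace ℝ (Fin D)) p with hφdef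
  have hφ : φ ∈ atlas (EuclideanSpace ℝ (Fin D)) M := chart_mem_atlas _ p
  set y := φ p with hydef
  have hy : y ∈ φ.target := φ.map_source (mem_chart_source _ p)
  have hq : φ.symm y = p := φ.left_inv (mem_chart_source _ p)
  suffices H : ∃ (x Q : Fin n → ℝ) (Q0 : ℝ) (e ehat : Fin n → TangentSpace (𝓡 D) (φ.symm y))
      (e0 : Fin ε → TangentSpace (𝓡 D) (φ.symm y)),
      IsCanonicalFrame g T h (φ.symm y) x Q Q0 e ehat e0 by
    have key : ∀ r : M, r = p → (∃ (x Q : Fin n → ℝ) (Q0 : ℝ)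
        (e ehat : Fin n → TangentSpace (𝓡 D) r) (e0 : Fin ε → TangentSpace (𝓡 D) r),
        IsCanonicalFrame g T h r x Q Q0 e ehat e0) →
        ∃ (x Q : Fin n → ℝ) (Q0 : ℝ) (e ehat : Fin n → TangentSpace (𝓡 D) p)
          (e0 : Fin ε → TangentSpace (𝓡 D) p),
          IsCanonicalFrame g T h p x Q Q0 e ehat e0 := by
      rintro r rfl h
      exact h
    exact key _ hq H
  obtain ⟨x, q, e, hort, hsum, hform, -, hξe, hξhat, hqpos⟩ := exists_frame_at hε hD hT hh hφ hy
  obtain ⟨L, hL⟩ := exists_chartDiff_equiv hφ hy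
  have P := coordPKY hT hh hφ
  set B := coordBilin (metricComp g φ y) with hB
  set ξ := chartXi g T h φ y with hξ
  -- The component of `ξ` along `e_0` must be the non-negative number `√Q_0`, so the kernel vector
  -- is reversed if necessary; the hatted vectors already have the right sign.
  have hsign : ∀ a : Fin ε, ∃ σ : ℝ, σ * σ = 1 ∧ σ * B ξ (e (.inr (.inr a))) =
      |B ξ (e (.inr (.inr a)))| := fun a => by
    rcases le_total 0 (B ξ (e (.inr (.inr a)))) with h | h
    · exact ⟨1, by norm_num, by rw [abs_of_nonneg h, one_mul]⟩
    · exact ⟨-1, by norm_num, by rw [abs_of_nonpos h, neg_one_mul]⟩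
  choose σ hσ hσξ using hsign
  have hQ0 : ∀ a, √(∑ a : Fin ε, B ξ (e (.inr (.inr a))) ^ 2) =
      σ a * B ξ (e (.inr (.inr a))) := fun a => by
    have : Subsingleton (Fin ε) := by
      rw [Fin.subsingleton_iff_le_one]; exact hε
    rw [Fintype.sum_subsingleton _ a, Real.sqrt_sq_eq_abs, hσξ]
  have hg : ∀ u v, g.inner (φ.symm y) (chartDiff φ y u) (chartDiff φ y v) = B u v := fun u v =>
    (coordBilin_metricComp g y u v).symm
  refine ⟨x, fun μ => q μ ^ 2, ∑ a : Fin ε, B ξ (e (.inr (.inr a))) ^ 2,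
    fun μ => chartDiff φ y (e (.inl μ)), fun μ => chartDiff φ y (e (.inr (.inl μ))),
    fun a => chartDiff φ y (σ a • e (.inr (.inr a))), ?_, ?_, ?_, fun μ => pow_pos (hqpos μ) 2,
    Finset.sum_nonneg fun a _ => sq_nonneg _⟩
  · rintro (μ | μ | a) (ν | ν | b) <;>
      simp only [Sum.elim_inl, Sum.elim_inr, hg, map_smul, smul_apply, smul_eq_mul, hort]
    · simp
    · simp
    · simp
    · simp
    · by_cases hab : a = b
      · subst hab
        simp [hσ]
      · simp [hab]
  · intro u v
    obtain ⟨u, rfl⟩ := L.surjective u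
    obtain ⟨v, rfl⟩ := L.surjective v
    simp only [hL, hg]
    rw [form_chartDiff, ← P.inner_endo hy, ← hB, hform]
  · intro v
    obtain ⟨v, rfl⟩ := L.surjective v
    simp only [hL, hg]
    have h1 : assocForm g T h (φ.symm y) (chartDiff φ y v) = B ξ v := by
      rw [hB, hξ, P.inner_xiVec hy]
      refine (assocForm_eq hq _).trans (Finset.sum_congr rfl fun i _ => ?_)
      congr 1
      exact congrArg (fun w : EuclideanSpace ℝ (Fin D) => w i) (chartDiff_chartAt p v)
    rw [h1, hsum]
    have hs : ∀ a, B (e a) ξ = B ξ (e a) := fun a => P.coordBilin_symm _ _ _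
    simp only [Fintype.sum_sum_type, hs, hξe, hξhat, zero_mul, Finset.sum_const_zero, zero_add,
      map_smul, smul_apply, smul_eq_mul]
    congr 1
    · exact Finset.sum_congr rfl fun μ _ => by rw [Real.sqrt_sq (hqpos μ).le]
    · refine Finset.sum_congr rfl fun a _ => ?_
      rw [hQ0 a]
      linear_combination (-(B ξ (e (.inr (.inr a))) * B (e (.inr (.inr a))) v)) * hσ a

end Manifold

end TorsionKY
theorem mainTheorem2 (D n ε : ℕ) (hε : ε ≤ 1) (hD : D = 2 * n + ε)
    (M : Type*) [TopologicalSpace M] [ChartedSpace (EuclideanSpace ℝ (Fin D)) M]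
    [IsManifold (𝓡 D) ∞ M]
    (g : TorsionKY.Metric D M) (T : TorsionKY.FormField D M 3) (h : TorsionKY.FormField D M 2)
    (vol : TorsionKY.FormField D M D)
    (hT : TorsionKY.IsSmooth (TorsionKY.toTensor T))
    (hvol : TorsionKY.IsVolumeElement g vol)
    (hh : TorsionKY.IsPKY g T h n ε) :
    -- the `K^{(j)}` are Killing tensors
    (∀ (j : ℕ) (hj : 2 * j < D),
      TorsionKY.IsKillingTensor g (TorsionKY.killingTensor g vol h j hj)) ∧
    -- canonical frames exist, and in any of them `K^{(j)}` is diagonal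
    (∀ p : M, ∃ (x Q : Fin n → ℝ) (Q0 : ℝ) (e ehat : Fin n → TangentSpace (𝓡 D) p)
      (e0 : Fin ε → TangentSpace (𝓡 D) p),
      TorsionKY.IsCanonicalFrame g T h p x Q Q0 e ehat e0) ∧
    (∀ (p : M) (x Q : Fin n → ℝ) (Q0 : ℝ) (e ehat : Fin n → TangentSpace (𝓡 D) p)
      (e0 : Fin ε → TangentSpace (𝓡 D) p),
      TorsionKY.IsCanonicalFrame g T h p x Q Q0 e ehat e0 →
      ∀ (j : ℕ) (hj : 2 * j < D) (u v : TangentSpace (𝓡 D) p),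
        TorsionKY.killingTensor g vol h j hj p ![u, v] =
          ∑ μ, TorsionKY.elemSymm x (Finset.univ.erase μ) j *
              (g.inner p (e μ) u * g.inner p (e μ) v +
                g.inner p (ehat μ) u * g.inner p (ehat μ) v) +
            ∑ a, TorsionKY.elemSymm x Finset.univ j *
              (g.inner p (e0 a) u * g.inner p (e0 a) v)) ∧
    -- the `K^{(j)}` commute
    (∀ (i j : ℕ) (hi : 2 * i < D) (hj : 2 * j < D),
      TorsionKY.SNCommute g (TorsionKY.killingTensor g vol h i hi)
        (TorsionKY.killingTensor g vol h j hj)) :=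
  ⟨fun j hj => TorsionKY.isKillingTensor_killingTensor hε hD hT hvol hh j hj,
    fun p => TorsionKY.exists_isCanonicalFrame hε hD hT hh p,
    fun _ _ _ _ _ _ _ he j hj u v =>
      TorsionKY.killingTensor_eq_of_isCanonicalFrame hvol hD he j hj u v,
    fun i j hi hj => TorsionKY.snCommute_killingTensor hε hD hT hvol hh i j hi hj⟩
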